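/- \textbf{Setting.} Let $d\in\{1,2,3\}$, $\gamma>1$, $c_v>0$, $T>0$, and let $\Omega=[0,1]^d$ be the flat torus. For a state $q=(\rho,\mathbf m,S)\in(0,\infty)\times\mathbb R^d\times\mathbb R$ put $\mathbf v=\mathbf m/\rho$, $e=\frac{\rho^{\gamma-1}}{\gamma-1}\exp\!\big(\frac{S}{\rho c_v}\big)$, $p=(\gamma-1)\rho e$, $\vartheta=e/c_v$ (the temperature), $c=\sqrt{\gamma p/\rho}$, $\rho E=\rho e+\frac{|\mathbf m|^2}{2\rho}$. Let $\mathbf p(q)=\nabla_q(\rho E)=(r,\mathbf v,\vartheta)$ with $r=\big(\gamma-\frac{S}{\rho c_v}\big)\frac{\rho^{\gamma-1}}{\gamma-1}\exp\!\big(\frac{S}{\rho c_v}\big)-\frac{|\mathbf m|^2}{2\rho^2}$, let $\mathbf H=\nabla_q\mathbf p=\nabla^2_q(\rho E)$, and for $s=1,\dots,d$ let $\mathbf f^s=\big(m_s,\ \tfrac{m_s}{\rho}\mathbf m+p\,\mathbf e_s,\ \tfrac{S m_s}{\rho}\big)$ and $F^s=(\rho E+p)\,v_s$. \textbf{Scheme.}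 For $h=1/n$, $n\in\mathbb N$, divide $\Omega$ periodically into the $n^d$ cubic cells $K$ of side $h$. At an interface $\sigma$ with normal $\mathbf e_s$ between $L$ and $K=L+h\mathbf e_s$, write $\delta g=g_K-g_L$ and $$\lambda_\sigma=\tfrac12\max_{M\in\{L,K\}}\max\{|v_s-c|,|v_s|,|v_s+c|\}(q_M),\qquad \mathbf H_\sigma=\int_0^1\mathbf H(q_L+\theta(q_K-q_L))\,d\theta,$$ $$\alpha_\sigma=\frac{\delta F^s+\tfrac12(\mathbf f^s(q_L)+\mathbf f^s(q_K))\cdot\delta\mathbf p-\delta(\mathbf p\cdot\mathbf f^s)}{\delta\mathbf p\cdot\delta\mathbf p},\qquad D_\sigma=\alpha_\sigma\,\delta\mathbf p+\lambda_\sigma\,\delta q,$$ with $\alpha_\sigma=0$ if $\delta\mathbf p=0$. A solution of the space semi-discrete HTC scheme on $[0,T]$ is a family $q_h(t)=(q_K(t))_K$, continuous on $[0,T]$, such that for all $t\in(0,T)$ and all cells $K$ $$\frac{d q_K}{dt}=-\sum_{s=1}^d\frac{\mathbf f^s(q_{K+h\mathbf e_s})-\mathbf f^s(q_{K-h\mathbf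 e_s})}{2h}+\frac1h\sum_{s=1}^d\big(D_{(K,K+h\mathbf e_s)}-D_{(K-h\mathbf e_s,K)}\big)+\frac1h\,(0,\mathbf 0,\Pi_K),$$ $$\Pi_K=\frac{1}{2\vartheta_K}\sum_{\sigma\subset\partial K}\lambda_\sigma\,\delta q\cdot\mathbf H_\sigma\,\delta q .$$ The family $q_h(t)=(\rho_h,\mathbf m_h,S_h)(t)$ is identified with the corresponding piecewise constant function on $\Omega$; $p_h$ and $(\rho E)_h$ are evaluated from it. \textbf{Theorem (Consistency formulation).} Let $q_h$, where $h=1/n$ runs through a sequence tending to $0$, be solutions of the HTC scheme on $[0,T]$ whose initial data $q_h^0=q_h(0)$ are bounded uniformly in $h$ (as are the cell averages of initial data in $L^\infty(\Omega)$). Assume that there are constants $\underline\rho>0$, $\overline E>0$ with $\rho_h(t)\ge\underline\rho$ and $(\rho E)_h(t)\le\overline E$ for all $h$ and all $t\in[0,T]$. Then for every $\tau\in(0,T)$: \begin{itemize} \item for all $\varphi\in C^1([0,T],C^2(\Omega))$, as $h\to0$, $$\Big[\int_\Omega\rho_h\varphi\,dx\Big]_{t=0}^{t=\tau}=\int_0^\tau\!\!\int_\Omega\big(\rho_h\partial_t\varphi+\mathbf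 m_h\cdot\nabla\varphi\big)\,dx\,dt+o(1);$$ \item for all $\boldsymbol\varphi\in C^1([0,T],C^2(\Omega;\mathbb R^d))$, as $h\to0$, $$\Big[\int_\Omega\mathbf m_h\cdot\boldsymbol\varphi\,dx\Big]_{t=0}^{t=\tau}=\int_0^\tau\!\!\int_\Omega\Big(\mathbf m_h\cdot\partial_t\boldsymbol\varphi+\Big(\frac{\mathbf m_h\otimes\mathbf m_h}{\rho_h}+p_h\mathbb I\Big):\nabla\boldsymbol\varphi\Big)\,dx\,dt+o(1);$$ \item for all $\varphi\in C^1([0,T],C^2(\Omega))$ with $\varphi\ge0$, as $h\to0$, $$\Big[\int_\Omega S_h\varphi\,dx\Big]_{t=0}^{t=\tau}\ge\int_0^\tau\!\!\int_\Omega\Big(S_h\partial_t\varphi+\frac{S_h\mathbf m_h}{\rho_h}\cdot\nabla\varphi\Big)\,dx\,dt+o(1);$$ \item for every $h$, $\displaystyle\int_\Omega(\rho E)_h(\tau)\,dx=\int_\Omega(\rho E)_h(0)\,dx.$ \end{itemize} -/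

import Mathlib

open Set Filter Topology MeasureTheory

noncomputable section

namespace HTC

/-! ## The Euler system in the variables density, momentum, total entropy -/

/-- The state vector `q = (ρ, m, S)`: density, momentum (a vector in `ℝ^d`), total entropy. The same
type also holds the dual variables `p = (r, v, T)` and the fluxes. -/
abbrev State (d : ℕ) : Type := ℝ × (Fin d → ℝ) × ℝ

/-- Density `ρ`. -/
def rho {d : ℕ} (q : State d) : ℝ := q.1

/-- Momentum `m = ρ v`. -/
def mom {d : ℕ} (q : State d) : Fin d → ℝ := q.2.1

/-- Total entropy `S = ρ s`. -/
def ent {d : ℕ} (q : State d) : ℝ := q.2.2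

/-- The Euclidean inner product of `ℝ^{d+2}`. -/
def dot {d : ℕ} (a b : State d) : ℝ := a.1 * b.1 + (∑ i, a.2.1 i * b.2.1 i) + a.2.2 * b.2.2

/-- Velocity `v = m / ρ`. -/
def vel {d : ℕ} (q : State d) : Fin d → ℝ := fun i => mom q i / rho q

/-- Specific internal energy of the ideal gas, `e = ρ^(γ-1) / (γ-1) * exp (s / c_v)`, `s = S / ρ`. -/
def internalEnergy {d : ℕ} (γ cv : ℝ) (q : State d) : ℝ :=
  rho q ^ (γ - 1) / (γ - 1) * Real.exp (ent q / rho q / cv)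

/-- Total energy per volume `ρ E = ρ (e + |v|^2 / 2)`. -/
def totalEnergy {d : ℕ} (γ cv : ℝ) (q : State d) : ℝ :=
  rho q * (internalEnergy γ cv q + (∑ i, vel q i ^ 2) / 2)

/-- Pressure `p = (γ - 1) ρ e`. -/
def pressure {d : ℕ} (γ cv : ℝ) (q : State d) : ℝ :=
  (γ - 1) * rho q * internalEnergy γ cv q

/-- Temperature `T = e / c_v`. -/
def temperature {d : ℕ} (γ cv : ℝ) (q : State d) : ℝ := internalEnergy γ cv q / cv

/-- Sound speed `c = √(γ p / ρ)`. -/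
def soundSpeed {d : ℕ} (γ cv : ℝ) (q : State d) : ℝ := Real.sqrt (γ * pressure γ cv q / rho q)

/-- The dual variables `p = ∇_q (ρ E) = (r, v, T)`. -/
def dual {d : ℕ} (γ cv : ℝ) (q : State d) : State d :=
  ((γ - ent q / (rho q * cv)) * (rho q ^ (γ - 1) / (γ - 1)) * Real.exp (ent q / (rho q * cv))
      - 1 / (2 * rho q ^ 2) * ∑ i, mom q i ^ 2,
    vel q, temperature γ cv q)

/-- The energy Hessian `H(q)`, that is, the Jacobian of `q ↦ p`. -/
def hess {d : ℕ} (γ cv : ℝ) (q : State d) : State d →L[ℝ] State d := fderiv ℝ (dual γ cv) q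

/-- The flux `f^s(q) = (m_s, m m_s / ρ + p e_s, S m_s / ρ)` in direction `s`. -/
def flux {d : ℕ} (γ cv : ℝ) (s : Fin d) (q : State d) : State d :=
  (mom q s, fun i => mom q i * mom q s / rho q + (if i = s then pressure γ cv q else 0),
    ent q * mom q s / rho q)

/-- The energy flux `F^s(q) = (ρ E + p) v_s` in direction `s`. -/
def energyFlux {d : ℕ} (γ cv : ℝ) (s : Fin d) (q : State d) : ℝ :=
  (totalEnergy γ cv q + pressure γ cv q) * vel q s

/-- The largest modulus of the eigenvalues `v_s - c`, `v_s`, `v_s + c` in direction `s`. -/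
def maxSpeed {d : ℕ} (γ cv : ℝ) (s : Fin d) (q : State d) : ℝ :=
  max |vel q s - soundSpeed γ cv q| (max |vel q s| |vel q s + soundSpeed γ cv q|)

/-! ## Interface quantities

In this part `a` and `b` are the values in the two cells `L` and `K = L + h e_s` at an interface
with normal `e_s`, so that the jump of `g` in the direction of `e_s` is `g b - g a`. -/

/-- The local diffusion coefficient `λ_σ`. -/
def lam {d : ℕ} (γ cv : ℝ) (s : Fin d) (a b : State d) : ℝ :=
  1 / 2 * max (maxSpeed γ cv s a) (maxSpeed γ cv s b)

/-- The Abgrall correction factor `α_σ`. For a vanishing jump the quotient is read as `0`, which is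
immaterial since `α_σ` enters the scheme only in the product with the jump of `p`. -/
def alpha {d : ℕ} (γ cv : ℝ) (s : Fin d) (a b : State d) : ℝ :=
  ((energyFlux γ cv s b - energyFlux γ cv s a)
      + dot ((1 / 2 : ℝ) • (flux γ cv s a + flux γ cv s b)) (dual γ cv b - dual γ cv a)
      - (dot (dual γ cv b) (flux γ cv s b) - dot (dual γ cv a) (flux γ cv s a)))
    / dot (dual γ cv b - dual γ cv a) (dual γ cv b - dual γ cv a)

/-- The Roe matrix `(H_h)_σ = ∫₀¹ H(a + θ (b - a)) dθ`. -/
def roe {d : ℕ} (γ cv : ℝ) (a b : State d) : State d →L[ℝ] State d :=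
  ∫ θ in (0 : ℝ)..1, hess γ cv (a + θ • (b - a))

/-- The correction and diffusion part `α_σ [[p]] + λ_σ [[q]]` of the numerical flux. -/
def diffusion {d : ℕ} (γ cv : ℝ) (s : Fin d) (a b : State d) : State d :=
  alpha γ cv s a b • (dual γ cv b - dual γ cv a) + lam γ cv s a b • (b - a)

/-- The dissipation `λ_σ [[q]] · (H_h)_σ [[q]]` at an interface. -/
def dissipation {d : ℕ} (γ cv : ℝ) (s : Fin d) (a b : State d) : ℝ :=
  lam γ cv s a b * dot (b - a) (roe γ cv a b (b - a))

/-! ## The periodic mesh and the scheme -/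

/-- The cells of the uniform periodic mesh of `[0,1]^d` with `n` cells in each direction. -/
abbrev Cell (d n : ℕ) : Type := Fin d → ZMod n

/-- The mesh size `h = 1 / n`. -/
def meshSize (n : ℕ) : ℝ := 1 / n

/-- The neighbour `K + h e_s`. -/
def right {d n : ℕ} (K : Cell d n) (s : Fin d) : Cell d n := K + Pi.single s 1

/-- The neighbour `K - h e_s`. -/
def left {d n : ℕ} (K : Cell d n) (s : Fin d) : Cell d n := K - Pi.single s 1

/-- The entropy production `(Π_h)_K`: `1 / (2 T_K)` times the sum of the dissipation over the `2 d`
interfaces of `K`. -/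
def production {d n : ℕ} (γ cv : ℝ) (q : Cell d n → State d) (K : Cell d n) : ℝ :=
  1 / 2 * (1 / temperature γ cv (q K)) *
    ∑ s, (dissipation γ cv s (q K) (q (right K s)) + dissipation γ cv s (q (left K s)) (q K))

/-- The right-hand side `d q_K / d t` of the space semi-discrete scheme: minus the central discrete
divergence of the flux, plus `1 / h` times the sum of `α_σ [[p]] + λ_σ [[q]]` over the interfaces
of `K` (with the jumps taken outward from `K`), plus `(Π_h)_K / h` in the entropy equation. -/
def rhs {d n : ℕ} (γ cv : ℝ) (q : Cell d n → State d) (K : Cell d n) : State d :=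
  - (∑ s, (1 / (2 * meshSize n)) • (flux γ cv s (q (right K s)) - flux γ cv s (q (left K s))))
  + (1 / meshSize n) •
      (∑ s, (diffusion γ cv s (q K) (q (right K s)) - diffusion γ cv s (q (left K s)) (q K)))
  + ((0 : ℝ), (0 : Fin d → ℝ), 1 / meshSize n * production γ cv q K)

/-- `q` is a solution of the scheme on `[0,T]`: continuous on `[0,T]` and satisfying the system of
ordinary differential equations in the interior. Its initial data are `q 0`. -/
def IsSolution {d n : ℕ} (γ cv T : ℝ) (q : ℝ → Cell d n → State d) : Prop :=
  ∀ K, ContinuousOn (fun t => q t K) (Icc 0 T) ∧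
    ∀ t ∈ Ioo 0 T, HasDerivAt (fun t' => q t' K) (rhs γ cv (q t) K) t

/-- The cell that contains the point `x` (of the torus; `x` is any representative in `ℝ^d`). -/
def cellOf (d n : ℕ) (x : Fin d → ℝ) : Cell d n := fun i => ((⌊(n : ℝ) * x i⌋ : ℤ) : ZMod n)

/-- The (periodic) piecewise constant function with values `q K` on the cells `K`. -/
def pwc {d n : ℕ} (q : Cell d n → State d) (x : Fin d → ℝ) : State d := q (cellOf d n x)

/-! ## Test functions and weak forms on the torus -/

/-- The fundamental domain `[0,1]^d` of the flat torus. -/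
def Omega (d : ℕ) : Set (Fin d → ℝ) := Icc 0 1

/-- The partial derivative `∂_s f` in space. -/
def pderiv {d : ℕ} (s : Fin d) (f : (Fin d → ℝ) → ℝ) (x : Fin d → ℝ) : ℝ :=
  fderiv ℝ f x (Pi.single s 1)

/-- `φ ∈ C¹([0,T], C²(Ω; F))` on the flat torus `Ω`: the functions `φ t` are 1-periodic in each
variable and of class `C²`; their space derivatives up to order two are jointly continuous and
differentiable in time, and the time derivatives are the jointly continuous space derivatives of a
function `ψ = ∂_t φ`. -/
structure IsTest {d : ℕ} {F : Type*} [NormedAddCommGroup F] [NormedSpace ℝ F] (T : ℝ)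
    (φ : ℝ → (Fin d → ℝ) → F) : Prop where
  periodic : ∀ t ∈ Icc 0 T, ∀ x s, φ t (x + Pi.single s 1) = φ t x
  contDiff : ∀ t ∈ Icc 0 T, ContDiff ℝ 2 (φ t)
  continuous_deriv : ∀ j ≤ 2, ContinuousOn
    (fun z : ℝ × (Fin d → ℝ) => iteratedFDeriv ℝ j (φ z.1) z.2) (Icc 0 T ×ˢ univ)
  time_deriv : ∃ ψ : ℝ → (Fin d → ℝ) → F,
    (∀ t ∈ Icc 0 T, ContDiff ℝ 2 (ψ t)) ∧
    ∀ j ≤ 2,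
      ContinuousOn (fun z : ℝ × (Fin d → ℝ) => iteratedFDeriv ℝ j (ψ z.1) z.2)
        (Icc 0 T ×ˢ univ) ∧
      ∀ t ∈ Icc 0 T, ∀ x, HasDerivWithinAt (fun t' => iteratedFDeriv ℝ j (φ t') x)
        (iteratedFDeriv ℝ j (ψ t) x) (Icc 0 T) t

/-- `[∫ ρ_h φ dx]_{t=0}^{t=τ} - ∫_0^τ ∫ (ρ_h ∂_t φ + m_h · ∇φ) dx dt`. -/
def densityError {d n : ℕ} (q : ℝ → Cell d n → State d) (φ : ℝ → (Fin d → ℝ) → ℝ) (τ : ℝ) : ℝ :=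
  (∫ x in Omega d, rho (pwc (q τ) x) * φ τ x) - (∫ x in Omega d, rho (pwc (q 0) x) * φ 0 x)
    - ∫ t in (0 : ℝ)..τ, ∫ x in Omega d,
        (rho (pwc (q t) x) * deriv (fun t' => φ t' x) t
          + ∑ s, mom (pwc (q t) x) s * pderiv s (φ t) x)

/-- `[∫ m_h · φ dx]_{t=0}^{t=τ} - ∫_0^τ ∫ (m_h · ∂_t φ + (m_h ⊗ m_h / ρ_h + p_h I) : ∇φ) dx dt`. -/
def momentumError {d n : ℕ} (γ cv : ℝ) (q : ℝ → Cell d n → State d)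
    (φ : ℝ → (Fin d → ℝ) → (Fin d → ℝ)) (τ : ℝ) : ℝ :=
  (∫ x in Omega d, ∑ i, mom (pwc (q τ) x) i * φ τ x i)
    - (∫ x in Omega d, ∑ i, mom (pwc (q 0) x) i * φ 0 x i)
    - ∫ t in (0 : ℝ)..τ, ∫ x in Omega d,
        ((∑ i, mom (pwc (q t) x) i * deriv (fun t' => φ t' x i) t)
          + ∑ i, ∑ s,
              (mom (pwc (q t) x) i * mom (pwc (q t) x) s / rho (pwc (q t) x)
                  + (if i = s then pressure γ cv (pwc (q t) x) else 0))
                * pderiv s (fun y => φ t y i) x)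

/-- `[∫ S_h φ dx]_{t=0}^{t=τ} - ∫_0^τ ∫ (S_h ∂_t φ + (m_h S_h / ρ_h) · ∇φ) dx dt`. -/
def entropyError {d n : ℕ} (q : ℝ → Cell d n → State d) (φ : ℝ → (Fin d → ℝ) → ℝ) (τ : ℝ) : ℝ :=
  (∫ x in Omega d, ent (pwc (q τ) x) * φ τ x) - (∫ x in Omega d, ent (pwc (q 0) x) * φ 0 x)
    - ∫ t in (0 : ℝ)..τ, ∫ x in Omega d,
        (ent (pwc (q t) x) * deriv (fun t' => φ t' x) t
          + ∑ s, mom (pwc (q t) x) s * ent (pwc (q t) x) / rho (pwc (q t) x)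
              * pderiv s (φ t) x)

end HTC

end

/-! Tested with a smooth field, the scheme gives the weak form plus three errors: replacing
increments of the field by gradients, which is controlled by uniform continuity and an `L¹` bound on
the fluxes; the entropy production, which has a sign and appears only in the entropy equation; and
the numerical diffusion, bounded by a multiple of `∫ Σ h^d λ |[[q]]|`. The theorem thus reduces to
showing that this last quantity (`diffRate`) tends to zero in time mean, which is
`exists_diffRate_bound`.

The Roe matrix maps `[[q]]` to `[[p]]` (`roe_apply`), so the dissipation is `λ [[p]]·[[q]]`. The
factor `α` cancels exactly the energy defect of the central flux, and the dissipation is returned as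
heat; hence total energy is conserved (`sum_dual_rhs`). The numerator of `α` is at most `2 λ
[[p]]·[[q]]` (`abs_alphaNum_le`), so the correction never exceeds the diffusion by more than a fixed
factor. Mass is conserved and the specific entropy `s` is bounded above, so the total entropy is
bounded above, and its balance gives the weak BV estimate: the time integral of `(1/h) Σ h^d λ
[[p]]·[[q]] (1/T_a + 1/T_b)` is bounded. This production controls `[[ρ]][[log ρ]]`, `ρ [[log T]]²`
and `ρ |[[v]]|² / T` (`density_le_prod`, `temp_le_prod`, `vel_le_prod`).

The difficulty is the jump of `S = ρ s`: neither an upper bound of `ρ` nor a lower bound of `T`, and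
hence of `s`, is available. Cutting `s` at a level `Y` gives `λ |[[q]]| ≤ C (Y³ production + ρ/Y + ρ
(|s| - Y)⁺)` (`lam_absSum_le`). With `Y = n^(1/4)` the first two terms vanish after summation, so
what remains is an equi-integrability statement for `S` (`exists_equi_bound`).

It comes from a renormalised entropy `η(ρ, S)` that vanishes for `-s ≤ M` and grows like `ρ |s|
log²(|s|/M)`, where `M` is of order `log n`. It contains a second term, `log ρ` times a logarithmic
profile of `-s/M`, chosen so that in the jump of `∇η` the leading jumps of `log ρ` cancel
(`abs_renorm_jump_le`). This is needed because `[[p]]` controls `[[log ρ]]` only with a weight of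
order `1/|s|` (`log_jump_le_dual_jump`). The price is that `η` is not merely transported: a
compression term `ρ Φ(-s/M) [[v]]` appears. It lives only where `-s ≥ M`, where the gas is so cold
(`T ≤ h²`) that production controls the velocity jump (`cold_vel_jump_le`). Since the states are
polynomially bounded in `n`, all logarithms cost a factor `L` of order `log n`, and `d/dt ∫ η ≤ C L
(production + 1)` (`sum_renormGrad_rhs_le`). Thus `∫ η` is of order `log n`, whereas on `|s| >
n^(1/4)` it dominates `log² n` times `ρ |s|`. The tail of the entropy is therefore of order `1 / log
n`. -/

noncomputable section

namespace HTC

variable {d : ℕ} {γ cv : ℝ}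

/-! ## Thermodynamic relations -/

/-- Logarithm of the density. -/
def logRho (q : State d) : ℝ := Real.log (rho q)

/-- Specific entropy `s = S / ρ`. -/
def spec (q : State d) : ℝ := ent q / rho q

/-- Logarithm of the temperature. -/
def logTemp (γ cv : ℝ) (q : State d) : ℝ := Real.log (temperature γ cv q)

/-- Specific Gibbs energy. -/
def gibbs (γ cv : ℝ) (q : State d) : ℝ := (γ * cv - spec q) * temperature γ cv q

/-- Squared length of the velocity. -/
def velSq (q : State d) : ℝ := ∑ i, vel q i ^ 2

lemma temperature_pos (hγ : 1 < γ) (hcv : 0 < cv) {q : State d} (hq : 0 < rho q) :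
    0 < temperature γ cv q := by
  have : 0 < γ - 1 := by linarith
  unfold temperature internalEnergy
  have := Real.rpow_pos_of_pos hq (γ - 1)
  positivity

lemma exp_logTemp (hγ : 1 < γ) (hcv : 0 < cv) {q : State d} (hq : 0 < rho q) :
    Real.exp (logTemp γ cv q) = temperature γ cv q :=
  Real.exp_log (temperature_pos hγ hcv hq)

lemma exp_logRho {q : State d} (hq : 0 < rho q) : Real.exp (logRho q) = rho q := Real.exp_log hq

lemma logTemp_eq (hγ : 1 < γ) (hcv : 0 < cv) {q : State d} (hq : 0 < rho q) :
    logTemp γ cv q = (γ - 1) * logRho q + spec q / cv - Real.log ((γ - 1) * cv) := by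
  have h1 : 0 < γ - 1 := by linarith
  have h2 := Real.rpow_pos_of_pos hq (γ - 1)
  unfold logTemp temperature internalEnergy logRho spec
  rw [show rho q ^ (γ - 1) / (γ - 1) * Real.exp (ent q / rho q / cv) / cv
      = rho q ^ (γ - 1) * Real.exp (ent q / rho q / cv) / ((γ - 1) * cv) by field_simp,
    Real.log_div (by positivity) (by positivity), Real.log_mul (by positivity) (by positivity),
    Real.log_rpow hq, Real.log_exp]

/-- In the variables `log ρ` and `log T` the specific entropy is affine, so its jumps split exactly
into jumps that the production controls, without any lower bound on the temperature. -/
lemma spec_eq (hγ : 1 < γ) (hcv : 0 < cv) {q : State d} (hq : 0 < rho q) :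
    spec q = cv * logTemp γ cv q - cv * (γ - 1) * logRho q + cv * Real.log ((γ - 1) * cv) := by
  rw [logTemp_eq hγ hcv hq]; field_simp; ring

lemma ent_eq {q : State d} (hq : 0 < rho q) : ent q = rho q * spec q := by
  unfold spec; field_simp

lemma mom_eq {q : State d} (hq : 0 < rho q) (i : Fin d) : mom q i = rho q * vel q i := by
  unfold vel; field_simp

lemma internalEnergy_eq (hcv : 0 < cv) (q : State d) :
    internalEnergy γ cv q = cv * temperature γ cv q := by
  unfold temperature; field_simp

lemma pressure_eq (hcv : 0 < cv) (q : State d) :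
    pressure γ cv q = cv * (γ - 1) * rho q * temperature γ cv q := by
  unfold pressure; rw [internalEnergy_eq hcv]; ring

lemma totalEnergy_eq (hcv : 0 < cv) (q : State d) :
    totalEnergy γ cv q = rho q * (cv * temperature γ cv q + velSq q / 2) := by
  unfold totalEnergy velSq; rw [internalEnergy_eq hcv]

lemma dual_eq (hγ : 1 < γ) (hcv : 0 < cv) {q : State d} (hq : 0 < rho q) :
    dual γ cv q = (gibbs γ cv q - velSq q / 2, vel q, temperature γ cv q) := by
  have h1 : 0 < γ - 1 := by linarith
  unfold dual gibbs velSq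
  congr 1
  congr 1
  · unfold temperature internalEnergy spec
    rw [div_div (ent q) (rho q) cv]
    field_simp
  · unfold vel
    rw [Finset.mul_sum, Finset.sum_div]
    refine Finset.sum_congr rfl fun i _ => ?_
    field_simp

/-- Euler's relation: the enthalpy `ρ g + S T` equals `γ c_v ρ T`, so only the pressure work
survives. This is the flux potential of the energy. -/
lemma dot_dual_flux (hγ : 1 < γ) (hcv : 0 < cv) {q : State d} (hq : 0 < rho q) (s : Fin d) :
    dot (dual γ cv q) (flux γ cv s q) - energyFlux γ cv s q = pressure γ cv q * vel q s := by
  rw [dual_eq hγ hcv hq]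
  unfold dot flux energyFlux
  rw [totalEnergy_eq hcv]
  have e1 : ∑ i, vel q i * (mom q i * mom q s / rho q + if i = s then pressure γ cv q else 0)
      = rho q * vel q s * velSq q + vel q s * pressure γ cv q := by
    simp only [mul_add, Finset.sum_add_distrib, mul_ite, mul_zero, Finset.sum_ite_eq',
      Finset.mem_univ, if_true, velSq, Finset.mul_sum]
    congr 1
    refine Finset.sum_congr rfl fun i _ => ?_
    rw [mom_eq hq, mom_eq hq]; field_simp
  simp only [e1]
  rw [mom_eq hq, ent_eq hq, pressure_eq hcv, gibbs]
  field_simp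
  ring

/-! ## Two-state identities -/

/-- The convexity defect of the thermal part of the energy, based at `a`. -/
def defect (γ cv : ℝ) (a b : State d) : ℝ :=
  cv * rho a * (temperature γ cv a - temperature γ cv b
      - temperature γ cv b * (logTemp γ cv a - logTemp γ cv b))
    + cv * (γ - 1) * temperature γ cv b
      * (rho a * (logRho a - logRho b) - rho a + rho b)

/-- Squared velocity jump. -/
def velJump (a b : State d) : ℝ := ∑ i, (vel b i - vel a i) ^ 2

/-- The quadratic form `[[p]] · [[q]]`. -/
def jumpForm (γ cv : ℝ) (a b : State d) : ℝ := dot (dual γ cv b - dual γ cv a) (b - a)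

lemma velJump_nonneg (a b : State d) : 0 ≤ velJump a b :=
  Finset.sum_nonneg fun _ _ => sq_nonneg _

lemma thermal_defect_nonneg (hγ : 1 < γ) (hcv : 0 < cv) {a b : State d} (ha : 0 < rho a)
    (hb : 0 < rho b) : 0 ≤ temperature γ cv a - temperature γ cv b
      - temperature γ cv b * (logTemp γ cv a - logTemp γ cv b) := by
  have h := Real.add_one_le_exp (logTemp γ cv a - logTemp γ cv b)
  have hb' := temperature_pos hγ hcv hb
  rw [Real.exp_sub, exp_logTemp hγ hcv ha, exp_logTemp hγ hcv hb, le_div_iff₀ hb'] at h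
  linarith

lemma density_defect_nonneg {a b : State d} (ha : 0 < rho a)
    (hb : 0 < rho b) : 0 ≤ rho a * (logRho a - logRho b) - rho a + rho b := by
  have h := Real.add_one_le_exp (logRho b - logRho a)
  rw [Real.exp_sub, exp_logRho ha, exp_logRho hb, le_div_iff₀ ha] at h
  linarith

lemma defect_nonneg (hγ : 1 < γ) (hcv : 0 < cv) {a b : State d} (ha : 0 < rho a)
    (hb : 0 < rho b) : 0 ≤ defect γ cv a b := by
  have h1 := thermal_defect_nonneg hγ hcv ha hb
  have h2 := density_defect_nonneg ha hb
  have h3 := temperature_pos hγ hcv hb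
  have h4 : 0 < γ - 1 := by linarith
  unfold defect; positivity

/-- By Gibbs–Duhem, `dp = ρ dg + S dT`, so this is the Bregman distance of the pressure as a convex
function of `(g, T)`. The two representations play different roles: the logarithmic one shows signs,
this one shows up in the balances. -/
lemma defect_eq (hγ : 1 < γ) (hcv : 0 < cv) {a b : State d} (ha : 0 < rho a) (hb : 0 < rho b) :
    defect γ cv a b = pressure γ cv b - pressure γ cv a - rho a * (gibbs γ cv b - gibbs γ cv a)
      - ent a * (temperature γ cv b - temperature γ cv a) := by
  rw [pressure_eq hcv, pressure_eq hcv, ent_eq ha, gibbs, gibbs, spec_eq hγ hcv ha,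
    spec_eq hγ hcv hb, defect]
  ring

lemma thermal_form_eq (hγ : 1 < γ) (hcv : 0 < cv) {a b : State d} (ha : 0 < rho a)
    (hb : 0 < rho b) :
    (rho b - rho a) * (gibbs γ cv b - gibbs γ cv a)
      + (ent b - ent a) * (temperature γ cv b - temperature γ cv a)
      = defect γ cv a b + defect γ cv b a := by
  rw [defect_eq hγ hcv ha hb, defect_eq hγ hcv hb ha]; ring

/-- In the product rule for the jump of `m = ρ v`, the part with `[[ρ]]` is cancelled by the kinetic
term `-|v|²/2` of the first dual variable. What is left is a sum of nonnegative thermal and kinetic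
parts. -/
lemma jumpForm_eq (hγ : 1 < γ) (hcv : 0 < cv) {a b : State d} (ha : 0 < rho a) (hb : 0 < rho b) :
    jumpForm γ cv a b = defect γ cv a b + defect γ cv b a
      + (rho a + rho b) / 2 * velJump a b := by
  rw [← thermal_form_eq hγ hcv ha hb, jumpForm, dual_eq hγ hcv ha, dual_eq hγ hcv hb]
  unfold dot velJump velSq
  have : ∑ i, (vel b i - vel a i) * (mom b i - mom a i)
      = (rho b - rho a) * ((∑ i, vel b i ^ 2) / 2 - (∑ i, vel a i ^ 2) / 2)
        + (rho a + rho b) / 2 * ∑ i, (vel b i - vel a i) ^ 2 := by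
    rw [← sub_div, ← Finset.sum_sub_distrib, Finset.sum_div, Finset.mul_sum, Finset.mul_sum,
      ← Finset.sum_add_distrib]
    refine Finset.sum_congr rfl fun i _ => ?_
    rw [mom_eq ha, mom_eq hb]; ring
  simp only [mom] at this
  simp only [Prod.fst_sub, Prod.snd_sub, Pi.sub_apply]
  rw [this]
  simp only [rho, ent]
  ring

lemma jumpForm_nonneg (hγ : 1 < γ) (hcv : 0 < cv) {a b : State d} (ha : 0 < rho a)
    (hb : 0 < rho b) : 0 ≤ jumpForm γ cv a b := by
  rw [jumpForm_eq hγ hcv ha hb]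
  have h1 := defect_nonneg hγ hcv ha hb
  have h2 := defect_nonneg hγ hcv hb ha
  have h3 := velJump_nonneg a b
  positivity

/-- Numerator of the correction factor `α_σ`. -/
def alphaNum (γ cv : ℝ) (s : Fin d) (a b : State d) : ℝ :=
  (energyFlux γ cv s b - energyFlux γ cv s a)
      + dot ((1 / 2 : ℝ) • (flux γ cv s a + flux γ cv s b)) (dual γ cv b - dual γ cv a)
      - (dot (dual γ cv b) (flux γ cv s b) - dot (dual γ cv a) (flux γ cv s a))

/-- The numerator is the error of a trapezoidal rule for the flux potential, so it is of third order
for small smooth jumps: the defects are of second order, and their difference is of third. Only the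
dominance by the nonnegative parts of `jumpForm_eq` is used later, since jumps need not be small. -/
lemma alphaNum_eq (hγ : 1 < γ) (hcv : 0 < cv) {a b : State d} (ha : 0 < rho a) (hb : 0 < rho b)
    (s : Fin d) :
    alphaNum γ cv s a b = 1 / 4 * (mom b s - mom a s) * velJump a b
      + 1 / 4 * (vel b s - vel a s) * (defect γ cv a b + defect γ cv b a)
      + (vel a s + vel b s) / 2 * ((defect γ cv b a - defect γ cv a b) / 2) := by
  have e1 := dot_dual_flux hγ hcv ha s
  have e2 := dot_dual_flux hγ hcv hb s
  have e3 : dot ((1 / 2 : ℝ) • (flux γ cv s a + flux γ cv s b)) (dual γ cv b - dual γ cv a)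
      = (mom a s + mom b s) / 2 * (gibbs γ cv b - gibbs γ cv a)
        + 1 / 4 * (mom b s - mom a s) * velJump a b
        + (pressure γ cv a + pressure γ cv b) / 2 * (vel b s - vel a s)
        + (ent a * vel a s + ent b * vel b s) / 2
          * (temperature γ cv b - temperature γ cv a) := by
    rw [dual_eq hγ hcv ha, dual_eq hγ hcv hb]
    unfold dot flux velJump velSq
    simp only [Prod.fst_sub, Prod.snd_sub, Pi.sub_apply, Prod.smul_fst, Prod.smul_snd,
      Pi.smul_apply, smul_eq_mul, Prod.fst_add, Prod.snd_add, Pi.add_apply]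
    have : ∑ i, 1 / 2 * (mom a i * mom a s / rho a + (if i = s then pressure γ cv a else 0)
          + (mom b i * mom b s / rho b + if i = s then pressure γ cv b else 0))
          * (vel b i - vel a i)
        = (mom a s + mom b s) / 2 * ((∑ i, vel b i ^ 2) / 2 - (∑ i, vel a i ^ 2) / 2)
          + 1 / 4 * (mom b s - mom a s) * ∑ i, (vel b i - vel a i) ^ 2
          + (pressure γ cv a + pressure γ cv b) / 2 * (vel b s - vel a s) := by
      have e4 : (pressure γ cv a + pressure γ cv b) / 2 * (vel b s - vel a s)
          = ∑ i, if i = s then (pressure γ cv a + pressure γ cv b) / 2 * (vel b i - vel a i)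
            else 0 := by simp
      rw [e4, ← sub_div, ← Finset.sum_sub_distrib, Finset.sum_div, Finset.mul_sum, Finset.mul_sum,
        ← Finset.sum_add_distrib, ← Finset.sum_add_distrib]
      refine Finset.sum_congr rfl fun i _ => ?_
      rw [mom_eq ha, mom_eq ha, mom_eq hb, mom_eq hb]
      split_ifs <;> field_simp <;> ring
    rw [this]
    simp only [vel]
    ring
  unfold alphaNum
  rw [e3]
  have h1 := defect_eq hγ hcv ha hb
  have h2 := defect_eq hγ hcv hb ha
  rw [h1, h2]
  rw [mom_eq ha, mom_eq hb]
  linear_combination e1 - e2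

lemma abs_vel_le_lam_left (s : Fin d) (a b : State d) : |vel a s| ≤ 2 * lam γ cv s a b := by
  have h1 : |vel a s| ≤ maxSpeed γ cv s a := (le_max_left _ _).trans (le_max_right _ _)
  have h2 : maxSpeed γ cv s a ≤ _ := le_max_left _ (maxSpeed γ cv s b)
  unfold lam; linarith

lemma lam_comm (s : Fin d) (a b : State d) : lam γ cv s a b = lam γ cv s b a := by
  unfold lam; rw [max_comm]

lemma abs_vel_le_lam_right (s : Fin d) (a b : State d) : |vel b s| ≤ 2 * lam γ cv s a b := by
  rw [lam_comm]; exact abs_vel_le_lam_left s b a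

lemma lam_nonneg (s : Fin d) (a b : State d) : 0 ≤ lam γ cv s a b := by
  linarith [abs_nonneg (vel a s), abs_vel_le_lam_left (γ := γ) (cv := cv) s a b]

/-- The sound speed is half the difference of `v + c` and `v - c`. Besides bounding velocities, `λ`
is therefore bounded below by a multiple of the square root of the temperature, which matters in
cold gas. -/
lemma soundSpeed_le_lam_left (s : Fin d) (a b : State d) :
    soundSpeed γ cv a ≤ 2 * lam γ cv s a b := by
  have h2 : maxSpeed γ cv s a ≤ _ := le_max_left _ (maxSpeed γ cv s b)
  have h3 : |vel a s - soundSpeed γ cv a| ≤ maxSpeed γ cv s a := le_max_left _ _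
  have h4 : |vel a s + soundSpeed γ cv a| ≤ maxSpeed γ cv s a :=
    (le_max_right _ _).trans (le_max_right _ _)
  have h5 := (neg_abs_le (vel a s - soundSpeed γ cv a))
  have h6 := le_abs_self (vel a s + soundSpeed γ cv a)
  unfold lam; linarith

lemma soundSpeed_eq (hcv : 0 < cv) {q : State d} (hq : 0 < rho q) :
    soundSpeed γ cv q = Real.sqrt (γ * (cv * (γ - 1)) * temperature γ cv q) := by
  unfold soundSpeed; rw [pressure_eq hcv]; congr 1; field_simp

lemma sqrt_temperature_le_lam_left (hcv : 0 < cv) {a : State d} (ha : 0 < rho a) (s : Fin d)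
    (b : State d) :
    Real.sqrt (γ * (cv * (γ - 1)) * temperature γ cv a) ≤ 2 * lam γ cv s a b := by
  rw [← soundSpeed_eq hcv ha]; exact soundSpeed_le_lam_left s a b

lemma maxSpeed_le (s : Fin d) (q : State d) :
    maxSpeed γ cv s q ≤ |vel q s| + soundSpeed γ cv q := by
  have h0 : 0 ≤ soundSpeed γ cv q := Real.sqrt_nonneg _
  unfold maxSpeed
  refine max_le ?_ (max_le ?_ ?_)
  · exact (abs_sub _ _).trans_eq (by rw [abs_of_nonneg h0])
  · linarith
  · exact (abs_add_le _ _).trans_eq (by rw [abs_of_nonneg h0])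

/-- Both velocities are at most `2 λ` in modulus, and every term of `alphaNum_eq` is a velocity or a
momentum jump times a nonnegative part of the jump form. No smallness enters. -/
lemma abs_alphaNum_le (hγ : 1 < γ) (hcv : 0 < cv) {a b : State d} (ha : 0 < rho a)
    (hb : 0 < rho b) (s : Fin d) :
    |alphaNum γ cv s a b| ≤ 2 * lam γ cv s a b * jumpForm γ cv a b := by
  rw [alphaNum_eq hγ hcv ha hb, jumpForm_eq hγ hcv ha hb, mom_eq ha, mom_eq hb]
  have hV1 := abs_le.1 (abs_vel_le_lam_left (γ := γ) (cv := cv) s a b)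
  have hV2 := abs_le.1 (abs_vel_le_lam_right (γ := γ) (cv := cv) s a b)
  set V := 2 * lam γ cv s a b
  have h1 := defect_nonneg hγ hcv ha hb
  have h2 := defect_nonneg hγ hcv hb ha
  have h3 := velJump_nonneg a b
  set T1 := defect γ cv a b
  set T2 := defect γ cv b a
  set D := velJump a b
  have k1 : |1 / 4 * (rho b * vel b s - rho a * vel a s) * D| ≤ 1 / 4 * ((rho a + rho b) * V) * D := by
    rw [abs_mul, abs_of_nonneg h3]
    refine mul_le_mul_of_nonneg_right ?_ h3
    rw [abs_mul, abs_of_pos (by norm_num : (0:ℝ) < 1 / 4)]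
    refine mul_le_mul_of_nonneg_left ?_ (by norm_num)
    rw [abs_le]; constructor <;> nlinarith
  have k2 : |1 / 4 * (vel b s - vel a s) * (T1 + T2)| ≤ 1 / 2 * V * (T1 + T2) := by
    rw [abs_mul, abs_of_nonneg (add_nonneg h1 h2)]
    refine mul_le_mul_of_nonneg_right ?_ (add_nonneg h1 h2)
    rw [abs_le]; constructor <;> linarith
  have k3 : |(vel a s + vel b s) / 2 * ((T2 - T1) / 2)| ≤ V * ((T1 + T2) / 2) := by
    rw [abs_mul]
    refine mul_le_mul ?_ ?_ (abs_nonneg _) (by linarith)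
    · rw [abs_le]; constructor <;> linarith
    · rw [abs_le]; constructor <;> linarith
  have hV : 0 ≤ V := by linarith
  have k4 : 0 ≤ V * ((rho a + rho b) * D) := by positivity
  refine (abs_add_three _ _ _).trans ?_
  nlinarith

lemma alpha_eq (s : Fin d) (a b : State d) : alpha γ cv s a b
    = alphaNum γ cv s a b / dot (dual γ cv b - dual γ cv a) (dual γ cv b - dual γ cv a) := rfl

/-! ## The Euclidean inner product of states -/

lemma dot_add_left (a b c : State d) : dot (a + b) c = dot a c + dot b c := by
  simp only [dot, Prod.fst_add, Prod.snd_add, Pi.add_apply, add_mul, Finset.sum_add_distrib]; ring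

lemma dot_smul_left (r : ℝ) (a c : State d) : dot (r • a) c = r * dot a c := by
  simp only [dot, Prod.smul_fst, Prod.smul_snd, Pi.smul_apply, smul_eq_mul, mul_assoc,
    ← Finset.mul_sum]; ring

lemma dot_comm (a b : State d) : dot a b = dot b a := by
  simp only [dot, mul_comm]

lemma dot_add_right (a b c : State d) : dot a (b + c) = dot a b + dot a c := by
  rw [dot_comm, dot_add_left, dot_comm b, dot_comm c]

lemma dot_smul_right (r : ℝ) (a c : State d) : dot a (r • c) = r * dot a c := by
  rw [dot_comm, dot_smul_left, dot_comm]

lemma dot_neg_right (a b : State d) : dot a (-b) = -dot a b := by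
  rw [← neg_one_smul ℝ, dot_smul_right]; ring

lemma dot_neg_left (a b : State d) : dot (-a) b = -dot a b := by
  rw [dot_comm, dot_neg_right, dot_comm]

lemma dot_sub_right (a b c : State d) : dot a (b - c) = dot a b - dot a c := by
  rw [sub_eq_add_neg, dot_add_right, dot_neg_right]; ring

lemma dot_zero_right (a : State d) : dot a 0 = 0 := by simp [dot]

lemma dot_sum_right {ι : Type*} (u : Finset ι) (a : State d) (f : ι → State d) :
    dot a (∑ i ∈ u, f i) = ∑ i ∈ u, dot a (f i) := by
  classical
  induction u using Finset.induction_on with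
  | empty => simp [dot_zero_right]
  | insert i u hi ih => rw [Finset.sum_insert hi, Finset.sum_insert hi, dot_add_right, ih]

lemma dot_self_nonneg (a : State d) : 0 ≤ dot a a := by
  unfold dot
  have := Finset.sum_nonneg (s := Finset.univ) fun i _ => mul_self_nonneg (a.2.1 i)
  have := mul_self_nonneg a.1
  have := mul_self_nonneg a.2.2
  linarith

lemma dot_sq_le (a b : State d) : dot a b ^ 2 ≤ dot a a * dot b b := by
  have h : ∀ x : ℝ, 0 ≤ dot b b * (x * x) + 2 * dot a b * x + dot a a := fun x => by
    have := dot_self_nonneg (a + x • b)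
    rw [dot_add_left, dot_add_right, dot_add_right, dot_smul_left, dot_smul_left, dot_smul_right,
      dot_smul_right, dot_comm b a] at this
    linarith
  have := discrim_le_zero h
  unfold discrim at this
  linarith

/-- Euclidean length of a state vector. -/
def len (a : State d) : ℝ := Real.sqrt (dot a a)

lemma len_nonneg (a : State d) : 0 ≤ len a := Real.sqrt_nonneg _

lemma len_mul_self (a : State d) : len a * len a = dot a a :=
  Real.mul_self_sqrt (dot_self_nonneg a)

lemma abs_dot_le (a b : State d) : |dot a b| ≤ len a * len b := by
  refine abs_le_of_sq_le_sq ?_ (mul_nonneg (len_nonneg a) (len_nonneg b))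
  rw [mul_pow, pow_two (len a), pow_two (len b), len_mul_self, len_mul_self]
  exact dot_sq_le a b

/-- The sum of the absolute values of the components. -/
def absSum (a : State d) : ℝ := |a.1| + (∑ i, |a.2.1 i|) + |a.2.2|

lemma absSum_nonneg (a : State d) : 0 ≤ absSum a := by
  unfold absSum
  have := Finset.sum_nonneg (s := Finset.univ) fun i _ => abs_nonneg (a.2.1 i)
  positivity

lemma len_le_absSum (a : State d) : len a ≤ absSum a := by
  refine Real.sqrt_le_iff.2 ⟨absSum_nonneg a, ?_⟩
  have h1 : ∑ i, a.2.1 i * a.2.1 i ≤ (∑ i, |a.2.1 i|) ^ 2 := by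
    have := Finset.sum_sq_le_sq_sum_of_nonneg (s := Finset.univ) (f := fun i => |a.2.1 i|)
      (fun i _ => abs_nonneg _)
    simpa [sq_abs, pow_two] using this
  have h0 : 0 ≤ ∑ i, |a.2.1 i| := Finset.sum_nonneg fun i _ => abs_nonneg (a.2.1 i)
  unfold dot absSum
  rw [← abs_mul_abs_self a.1, ← abs_mul_abs_self a.2.2]
  nlinarith [abs_nonneg a.1, abs_nonneg a.2.2, mul_nonneg (abs_nonneg a.1) h0,
    mul_nonneg (abs_nonneg a.2.2) h0, mul_nonneg (abs_nonneg a.1) (abs_nonneg a.2.2)]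

/-- If `|[[p]] · w| ≤ k |[[p]]|²` then the correction contributes at most `2 k λ [[p]]·[[q]]`. -/
lemma abs_alpha_mul_dot_le (hγ : 1 < γ) (hcv : 0 < cv) {a b : State d} (ha : 0 < rho a)
    (hb : 0 < rho b) (s : Fin d) {w : State d} {k : ℝ} (hk : 0 ≤ k)
    (hw : |dot (dual γ cv b - dual γ cv a) w|
      ≤ k * dot (dual γ cv b - dual γ cv a) (dual γ cv b - dual γ cv a)) :
    |alpha γ cv s a b * dot (dual γ cv b - dual γ cv a) w|
      ≤ k * (2 * lam γ cv s a b * jumpForm γ cv a b) := by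
  have h1 := abs_alphaNum_le hγ hcv ha hb s
  have h2 := dot_self_nonneg (dual γ cv b - dual γ cv a)
  rw [abs_mul, alpha_eq, abs_div, abs_of_nonneg h2]
  rcases h2.eq_or_lt with h0 | h0
  · rw [← h0, div_zero, zero_mul]
    exact mul_nonneg hk ((abs_nonneg _).trans h1)
  · rw [div_mul_eq_mul_div, div_le_iff₀ h0]
    calc _ ≤ |alphaNum γ cv s a b| * (k * dot (dual γ cv b - dual γ cv a)
            (dual γ cv b - dual γ cv a)) := mul_le_mul_of_nonneg_left hw (abs_nonneg _)
      _ ≤ (2 * lam γ cv s a b * jumpForm γ cv a b) * (k * dot (dual γ cv b - dual γ cv a)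
            (dual γ cv b - dual γ cv a)) := by gcongr
      _ = _ := by ring

/-- Dividing `|α| |[[p]]|² ≤ 2 λ [[p]]·[[q]] ≤ 2 λ |[[p]]| |[[q]]|` by `|[[p]]|` bounds the
correction by twice the diffusion, however badly conditioned the map from `q` to `p` is; together
they make the factor three. -/
lemma abs_dot_diffusion_le (hγ : 1 < γ) (hcv : 0 < cv) {a b : State d} (ha : 0 < rho a)
    (hb : 0 < rho b) (s : Fin d) (w : State d) :
    |dot (diffusion γ cv s a b) w| ≤ 3 * lam γ cv s a b * len (b - a) * len w := by
  have hl := lam_nonneg (γ := γ) (cv := cv) s a b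
  have hα : |alpha γ cv s a b| * len (dual γ cv b - dual γ cv a)
      ≤ 2 * lam γ cv s a b * len (b - a) := by
    have h1 := abs_alphaNum_le hγ hcv ha hb s
    have h2 := len_nonneg (dual γ cv b - dual γ cv a)
    have h3 := (le_abs_self _).trans (abs_dot_le (dual γ cv b - dual γ cv a) (b - a))
    rw [alpha_eq, abs_div, abs_of_nonneg (dot_self_nonneg _), ← len_mul_self]
    rcases h2.eq_or_lt with h0 | h0
    · rw [← h0]; have := len_nonneg (b - a); simp; positivity
    · rw [div_mul_eq_mul_div, div_le_iff₀ (by positivity)]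
      calc _ ≤ (2 * lam γ cv s a b * (len (dual γ cv b - dual γ cv a) * len (b - a)))
              * len (dual γ cv b - dual γ cv a) := by
            refine mul_le_mul_of_nonneg_right (h1.trans ?_) h2
            exact mul_le_mul_of_nonneg_left h3 (by positivity)
        _ = _ := by ring
  unfold diffusion
  rw [dot_add_left, dot_smul_left, dot_smul_left]
  have hw := len_nonneg w
  calc _ ≤ |alpha γ cv s a b * dot (dual γ cv b - dual γ cv a) w|
        + |lam γ cv s a b * dot (b - a) w| := abs_add_le _ _
    _ ≤ |alpha γ cv s a b| * (len (dual γ cv b - dual γ cv a) * len w)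
        + lam γ cv s a b * (len (b - a) * len w) := by
      rw [abs_mul, abs_mul, abs_of_nonneg hl]
      gcongr <;> exact abs_dot_le _ _
    _ ≤ 2 * lam γ cv s a b * len (b - a) * len w + lam γ cv s a b * (len (b - a) * len w) := by
      rw [← mul_assoc]; gcongr
    _ = _ := by ring

/-! ## Lower bounds of the entropy production -/

/-- The entropy production at an interface, summed over the two adjacent cells. -/
def prod (γ cv : ℝ) (s : Fin d) (a b : State d) : ℝ :=
  lam γ cv s a b * jumpForm γ cv a b * (1 / temperature γ cv a + 1 / temperature γ cv b)

/-- With `t` the jump of `log T`, the factor `1 + exp (-t)` is what the weights `1/T_a + 1/T_b`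
supply. Together with the convexity defect it gives a quadratic bound on both half-lines, where the
defect alone grows only linearly as `t → -∞`. -/
lemma half_sq_le_exp (t : ℝ) :
    t ^ 2 / 2 ≤ (Real.exp t - 1 - t) * (1 + Real.exp (-t)) := by
  have h0 : 0 ≤ Real.exp t - 1 - t := by linarith [Real.add_one_le_exp t]
  rcases le_or_gt 0 t with ht | ht
  · have := Real.quadratic_le_exp_of_nonneg ht
    have h2 := mul_nonneg h0 (Real.exp_pos (-t)).le
    nlinarith
  · obtain ⟨u, rfl⟩ : ∃ u, t = -u := ⟨-t, by ring⟩
    have hu : 0 < u := by linarith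
    have e : Real.exp (-u) * Real.exp u = 1 := by rw [← Real.exp_add]; simp
    rw [neg_neg]
    -- Expanding the product leaves `exp (-u) + u + (u - 1) exp u`, and the first two terms are at
    -- least `1`.
    suffices u ^ 2 / 2 ≤ 1 + (u - 1) * Real.exp u by nlinarith
    rcases le_or_gt 1 u with h1 | h1
    · have := Real.quadratic_le_exp_of_nonneg hu.le
      have h3 : (u - 1) * (1 + u + u ^ 2 / 2) ≤ (u - 1) * Real.exp u :=
        mul_le_mul_of_nonneg_left this (by linarith)
      have h4 : 0 ≤ (u - 1) * u ^ 2 := mul_nonneg (by linarith) (sq_nonneg u)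
      nlinarith
    · have := Real.exp_bound' hu.le h1.le (n := 3) (by norm_num)
      norm_num [Finset.sum_range_succ, Nat.factorial] at this
      have h3 : (1 - u) * Real.exp u ≤ (1 - u) * (1 + u + u ^ 2 / 2 + u ^ 3 * 4 / 18) :=
        mul_le_mul_of_nonneg_left (by linarith) (by linarith)
      have : 0 ≤ u ^ 3 := by positivity
      have : 0 ≤ u ^ 4 := by positivity
      nlinarith

lemma jumpForm_comm (a b : State d) : jumpForm γ cv a b = jumpForm γ cv b a := by
  unfold jumpForm
  rw [← neg_sub (dual γ cv b), ← neg_sub b a, dot_neg_left, dot_neg_right, neg_neg]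

lemma prod_comm (s : Fin d) (a b : State d) : prod γ cv s a b = prod γ cv s b a := by
  unfold prod; rw [lam_comm, jumpForm_comm, add_comm]

lemma prod_nonneg (hγ : 1 < γ) (hcv : 0 < cv) {a b : State d} (ha : 0 < rho a)
    (hb : 0 < rho b) (s : Fin d) : 0 ≤ prod γ cv s a b := by
  have := lam_nonneg (γ := γ) (cv := cv) s a b
  have := jumpForm_nonneg hγ hcv ha hb
  have := temperature_pos hγ hcv ha
  have := temperature_pos hγ hcv hb
  unfold prod; positivity

/-- Each defect is paired with the reciprocal of the temperature that multiplies its density part.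
The temperatures cancel and the two one-sided defects add up to a symmetric expression in `ρ` alone.
-/
lemma density_le_prod (hγ : 1 < γ) (hcv : 0 < cv) {a b : State d} (ha : 0 < rho a)
    (hb : 0 < rho b) (s : Fin d) :
    lam γ cv s a b * (cv * (γ - 1) * ((rho b - rho a) * (logRho b - logRho a)))
      ≤ prod γ cv s a b := by
  have hl := lam_nonneg (γ := γ) (cv := cv) s a b
  have ta := temperature_pos hγ hcv ha
  have tb := temperature_pos hγ hcv hb
  rw [prod, mul_assoc (lam γ cv s a b) (jumpForm γ cv a b)]
  refine mul_le_mul_of_nonneg_left ?_ hl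
  have h1 := thermal_defect_nonneg hγ hcv ha hb
  have h2 := density_defect_nonneg ha hb
  have h3 := thermal_defect_nonneg hγ hcv hb ha
  have h4 := density_defect_nonneg hb ha
  have hk : 0 < cv * (γ - 1) := mul_pos hcv (by linarith)
  have d1 : cv * (γ - 1) * temperature γ cv b * (rho a * (logRho a - logRho b) - rho a + rho b)
      ≤ defect γ cv a b := by
    unfold defect; have := mul_nonneg (mul_pos hcv ha).le h1; linarith
  have d2 : cv * (γ - 1) * temperature γ cv a * (rho b * (logRho b - logRho a) - rho b + rho a)
      ≤ defect γ cv b a := by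
    unfold defect; have := mul_nonneg (mul_pos hcv hb).le h3; linarith
  have d3 : defect γ cv a b + defect γ cv b a ≤ jumpForm γ cv a b := by
    rw [jumpForm_eq hγ hcv ha hb]
    have := velJump_nonneg a b
    have : 0 ≤ (rho a + rho b) / 2 * velJump a b := by positivity
    linarith
  have n1 := defect_nonneg hγ hcv ha hb
  have n2 := defect_nonneg hγ hcv hb ha
  calc _ = cv * (γ - 1) * temperature γ cv b * (rho a * (logRho a - logRho b) - rho a + rho b)
          * (1 / temperature γ cv b)
        + cv * (γ - 1) * temperature γ cv a * (rho b * (logRho b - logRho a) - rho b + rho a)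
          * (1 / temperature γ cv a) := by field_simp; ring
    _ ≤ defect γ cv a b * (1 / temperature γ cv b)
        + defect γ cv b a * (1 / temperature γ cv a) := by gcongr
    _ ≤ (defect γ cv a b + defect γ cv b a)
        * (1 / temperature γ cv a + 1 / temperature γ cv b) := by
      have : 0 ≤ defect γ cv a b * (1 / temperature γ cv a) := by positivity
      have : 0 ≤ defect γ cv b a * (1 / temperature γ cv b) := by positivity
      linarith
    _ ≤ _ := by gcongr

/-- The thermal part of a defect is `T_b (exp t - 1 - t)` with `t` the jump of `log T`; multiplied
by both reciprocal temperatures it is bounded below by `half_sq_le_exp`. -/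
lemma temp_le_prod (hγ : 1 < γ) (hcv : 0 < cv) {a b : State d} (ha : 0 < rho a)
    (hb : 0 < rho b) (s : Fin d) :
    lam γ cv s a b * (cv / 2 * (rho a + rho b) * (logTemp γ cv b - logTemp γ cv a) ^ 2)
      ≤ prod γ cv s a b := by
  have hl := lam_nonneg (γ := γ) (cv := cv) s a b
  rw [prod, mul_assoc (lam γ cv s a b) (jumpForm γ cv a b)]
  refine mul_le_mul_of_nonneg_left ?_ hl
  have key : ∀ {a b : State d}, 0 < rho a → 0 < rho b →
      cv / 2 * rho a * (logTemp γ cv b - logTemp γ cv a) ^ 2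
        ≤ defect γ cv a b * (1 / temperature γ cv a + 1 / temperature γ cv b) := by
    intro a b ha hb
    have ta := temperature_pos hγ hcv ha
    have tb := temperature_pos hγ hcv hb
    have hk : 0 < cv * (γ - 1) := mul_pos hcv (by linarith)
    have h2 := density_defect_nonneg ha hb
    have h := half_sq_le_exp (logTemp γ cv a - logTemp γ cv b)
    rw [neg_sub, Real.exp_sub, Real.exp_sub, exp_logTemp hγ hcv ha, exp_logTemp hγ hcv hb] at h
    calc _ = cv * rho a * ((logTemp γ cv a - logTemp γ cv b) ^ 2 / 2) := by ring
      _ ≤ cv * rho a * ((temperature γ cv a / temperature γ cv b - 1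
            - (logTemp γ cv a - logTemp γ cv b)) * (1 + temperature γ cv b / temperature γ cv a)) := by
          gcongr
      _ = cv * rho a * (temperature γ cv a - temperature γ cv b
            - temperature γ cv b * (logTemp γ cv a - logTemp γ cv b))
            * (1 / temperature γ cv a + 1 / temperature γ cv b) := by field_simp; ring
      _ ≤ _ := by
        unfold defect
        refine mul_le_mul_of_nonneg_right ?_ (by positivity)
        have := mul_nonneg (mul_pos hk tb).le h2
        linarith
  have k1 := key ha hb
  have k2 := key hb ha
  have ta := temperature_pos hγ hcv ha
  have tb := temperature_pos hγ hcv hb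
  have d3 : defect γ cv a b + defect γ cv b a ≤ jumpForm γ cv a b := by
    rw [jumpForm_eq hγ hcv ha hb]
    have := velJump_nonneg a b
    have : 0 ≤ (rho a + rho b) / 2 * velJump a b := by positivity
    linarith
  calc _ = cv / 2 * rho a * (logTemp γ cv b - logTemp γ cv a) ^ 2
        + cv / 2 * rho b * (logTemp γ cv a - logTemp γ cv b) ^ 2 := by ring
    _ ≤ (defect γ cv a b + defect γ cv b a)
        * (1 / temperature γ cv a + 1 / temperature γ cv b) := by linarith
    _ ≤ _ := by gcongr

lemma vel_le_prod (hγ : 1 < γ) (hcv : 0 < cv) {a b : State d} (ha : 0 < rho a)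
    (hb : 0 < rho b) (s : Fin d) :
    lam γ cv s a b * ((rho a + rho b) / 2 * velJump a b)
      * (1 / temperature γ cv a + 1 / temperature γ cv b) ≤ prod γ cv s a b := by
  have hl := lam_nonneg (γ := γ) (cv := cv) s a b
  have ta := temperature_pos hγ hcv ha
  have tb := temperature_pos hγ hcv hb
  unfold prod
  gcongr
  rw [jumpForm_eq hγ hcv ha hb]
  have := defect_nonneg hγ hcv ha hb
  have := defect_nonneg hγ hcv hb ha
  linarith

/-! ## Calculus along curves of states -/

lemma _root_.HasDerivAt.state_rho {x : ℝ → State d} {x' : State d} {t : ℝ}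
    (h : HasDerivAt x x' t) : HasDerivAt (fun t => rho (x t)) (rho x') t :=
  ((ContinuousLinearMap.fst ℝ ℝ ((Fin d → ℝ) × ℝ)).hasFDerivAt).comp_hasDerivAt t h

lemma _root_.HasDerivAt.state_mom {x : ℝ → State d} {x' : State d} {t : ℝ}
    (h : HasDerivAt x x' t) (i : Fin d) : HasDerivAt (fun t => mom (x t) i) (mom x' i) t :=
  (((ContinuousLinearMap.proj (R := ℝ) (φ := fun _ : Fin d => ℝ) i).comp
    ((ContinuousLinearMap.fst ℝ (Fin d → ℝ) ℝ).comp
    (ContinuousLinearMap.snd ℝ ℝ ((Fin d → ℝ) × ℝ)))).hasFDerivAt).comp_hasDerivAt t h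

lemma _root_.HasDerivAt.state_ent {x : ℝ → State d} {x' : State d} {t : ℝ}
    (h : HasDerivAt x x' t) : HasDerivAt (fun t => ent (x t)) (ent x') t :=
  (((ContinuousLinearMap.snd ℝ (Fin d → ℝ) ℝ).comp
    (ContinuousLinearMap.snd ℝ ℝ ((Fin d → ℝ) × ℝ))).hasFDerivAt).comp_hasDerivAt t h

lemma _root_.HasDerivAt.state_spec {x : ℝ → State d} {x' : State d} {t : ℝ}
    (h : HasDerivAt x x' t) (hx : 0 < rho (x t)) :
    HasDerivAt (fun t => spec (x t)) ((ent x' - spec (x t) * rho x') / rho (x t)) t := by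
  refine (h.state_ent.div h.state_rho hx.ne').congr_deriv ?_
  unfold spec; field_simp

lemma _root_.HasDerivAt.state_logRho {x : ℝ → State d} {x' : State d} {t : ℝ}
    (h : HasDerivAt x x' t) (hx : 0 < rho (x t)) :
    HasDerivAt (fun t => logRho (x t)) (rho x' / rho (x t)) t :=
  h.state_rho.log hx.ne'

lemma _root_.HasDerivAt.state_totalEnergy (hγ : 1 < γ) (hcv : 0 < cv) {x : ℝ → State d}
    {x' : State d} {t : ℝ} (h : HasDerivAt x x' t) (hx : 0 < rho (x t)) :
    HasDerivAt (fun t => totalEnergy γ cv (x t)) (dot (dual γ cv (x t)) x') t := by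
  have h1 : 0 < γ - 1 := by linarith
  have hr := h.state_rho
  have hs := h.state_spec hx
  have hv : ∀ i, HasDerivAt (fun t => vel (x t) i)
      ((mom x' i - vel (x t) i * rho x') / rho (x t)) t := fun i => by
    refine ((h.state_mom i).div h.state_rho hx.ne').congr_deriv ?_
    unfold vel; field_simp
  have hk : HasDerivAt (fun t => velSq (x t))
      (∑ i, 2 * vel (x t) i * ((mom x' i - vel (x t) i * rho x') / rho (x t))) t := by
    unfold velSq
    refine (HasDerivAt.fun_sum fun i _ => (hv i).pow 2).congr_deriv ?_
    refine Finset.sum_congr rfl fun i _ => ?_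
    simp
  have he : HasDerivAt (fun t => internalEnergy γ cv (x t))
      (rho x' * (γ - 1) * rho (x t) ^ (γ - 1 - 1) / (γ - 1) * Real.exp (spec (x t) / cv)
        + rho (x t) ^ (γ - 1) / (γ - 1) * (Real.exp (spec (x t) / cv)
          * ((ent x' - spec (x t) * rho x') / rho (x t) / cv))) t :=
    ((hr.rpow_const (Or.inl hx.ne')).div_const _).mul ((hs.div_const cv).exp)
  have hE := hr.mul (he.add (hk.div_const 2))
  refine hE.congr_deriv ?_
  rw [dual_eq hγ hcv hx]
  have e1 : ∑ i, 2 * vel (x t) i * ((mom x' i - vel (x t) i * rho x') / rho (x t))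
      = (2 * (∑ i, vel (x t) i * mom x' i) - 2 * velSq (x t) * rho x') / rho (x t) := by
    unfold velSq
    rw [Finset.mul_sum, Finset.mul_sum, Finset.sum_mul, ← Finset.sum_sub_distrib, Finset.sum_div]
    refine Finset.sum_congr rfl fun i _ => ?_
    field_simp
  have e2 : rho (x t) ^ (γ - 1 - 1) = rho (x t) ^ (γ - 1) / rho (x t) := by
    rw [Real.rpow_sub_one hx.ne']
  simp only [Pi.add_apply, e1, e2]
  have e3 : temperature γ cv (x t) = rho (x t) ^ (γ - 1) / (γ - 1) * Real.exp (spec (x t) / cv) / cv :=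
    rfl
  have e4 : internalEnergy γ cv (x t) = rho (x t) ^ (γ - 1) / (γ - 1) * Real.exp (spec (x t) / cv) :=
    rfl
  unfold dot gibbs
  rw [e4, e3]
  simp only [rho, mom, ent]
  have hx' : (x t).1 ≠ 0 := hx.ne'
  field_simp
  ring

section continuity

variable {X : Type*} [TopologicalSpace X] {u : Set X} {x y : X → State d}

lemma _root_.ContinuousOn.state_rho (h : ContinuousOn x u) : ContinuousOn (fun t => rho (x t)) u :=
  continuous_fst.comp_continuousOn h

lemma _root_.ContinuousOn.state_mom (h : ContinuousOn x u) (i : Fin d) :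
    ContinuousOn (fun t => mom (x t) i) u :=
  ((continuous_apply i).comp (continuous_fst.comp continuous_snd)).comp_continuousOn h

lemma _root_.ContinuousOn.state_ent (h : ContinuousOn x u) : ContinuousOn (fun t => ent (x t)) u :=
  (continuous_snd.comp continuous_snd).comp_continuousOn h

lemma _root_.ContinuousOn.state_spec (h : ContinuousOn x u) (hx : ∀ t ∈ u, 0 < rho (x t)) :
    ContinuousOn (fun t => spec (x t)) u :=
  h.state_ent.div h.state_rho fun t ht => (hx t ht).ne'

lemma _root_.ContinuousOn.state_vel (h : ContinuousOn x u) (hx : ∀ t ∈ u, 0 < rho (x t))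
    (i : Fin d) : ContinuousOn (fun t => vel (x t) i) u :=
  (h.state_mom i).div h.state_rho fun t ht => (hx t ht).ne'

lemma _root_.ContinuousOn.state_velSq (h : ContinuousOn x u) (hx : ∀ t ∈ u, 0 < rho (x t)) :
    ContinuousOn (fun t => velSq (x t)) u :=
  continuousOn_finsetSum _ fun i _ => (h.state_vel hx i).pow 2

lemma _root_.ContinuousOn.state_logRho (h : ContinuousOn x u) (hx : ∀ t ∈ u, 0 < rho (x t)) :
    ContinuousOn (fun t => logRho (x t)) u :=
  h.state_rho.log fun t ht => (hx t ht).ne'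

lemma _root_.ContinuousOn.state_internalEnergy (h : ContinuousOn x u)
    (hx : ∀ t ∈ u, 0 < rho (x t)) : ContinuousOn (fun t => internalEnergy γ cv (x t)) u :=
  ((h.state_rho.rpow_const fun t ht => Or.inl (hx t ht).ne').div_const _).mul
    (((h.state_spec hx).div_const cv).rexp)

lemma _root_.ContinuousOn.state_temperature (h : ContinuousOn x u) (hx : ∀ t ∈ u, 0 < rho (x t)) :
    ContinuousOn (fun t => temperature γ cv (x t)) u :=
  (h.state_internalEnergy hx).div_const _

lemma _root_.ContinuousOn.state_pressure (h : ContinuousOn x u) (hx : ∀ t ∈ u, 0 < rho (x t)) :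
    ContinuousOn (fun t => pressure γ cv (x t)) u :=
  (continuousOn_const.mul h.state_rho).mul (h.state_internalEnergy hx)

lemma _root_.ContinuousOn.state_totalEnergy (h : ContinuousOn x u)
    (hx : ∀ t ∈ u, 0 < rho (x t)) : ContinuousOn (fun t => totalEnergy γ cv (x t)) u :=
  h.state_rho.mul ((h.state_internalEnergy hx).add ((h.state_velSq hx).div_const _))

lemma _root_.ContinuousOn.state_maxSpeed (h : ContinuousOn x u) (hx : ∀ t ∈ u, 0 < rho (x t))
    (s : Fin d) : ContinuousOn (fun t => maxSpeed γ cv s (x t)) u := by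
  have hc : ContinuousOn (fun t => soundSpeed γ cv (x t)) u :=
    ((continuousOn_const.mul (h.state_pressure hx)).div h.state_rho
      fun t ht => (hx t ht).ne').sqrt
  have hv := h.state_vel hx s
  exact (hv.sub hc).abs.sup (hv.abs.sup (hv.add hc).abs)

lemma _root_.ContinuousOn.state_lam (h : ContinuousOn x u) (hx : ∀ t ∈ u, 0 < rho (x t))
    (h' : ContinuousOn y u) (hy : ∀ t ∈ u, 0 < rho (y t)) (s : Fin d) :
    ContinuousOn (fun t => lam γ cv s (x t) (y t)) u :=
  continuousOn_const.mul ((h.state_maxSpeed hx s).sup (h'.state_maxSpeed hy s))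

lemma _root_.ContinuousOn.state_dot (h : ContinuousOn x u) (h' : ContinuousOn y u) :
    ContinuousOn (fun t => dot (x t) (y t)) u := by
  unfold dot
  exact ((h.state_rho.mul h'.state_rho).add
    (continuousOn_finsetSum _ fun i _ => (h.state_mom i).mul (h'.state_mom i))).add
    (h.state_ent.mul h'.state_ent)

lemma _root_.ContinuousOn.state_dual (hγ : 1 < γ) (hcv : 0 < cv) (h : ContinuousOn x u)
    (hx : ∀ t ∈ u, 0 < rho (x t)) :
    ContinuousOn (fun t => dual γ cv (x t)) u := by
  have : ContinuousOn (fun t => (gibbs γ cv (x t) - velSq (x t) / 2, vel (x t),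
      temperature γ cv (x t))) u :=
    (((continuousOn_const.sub (h.state_spec hx)).mul (h.state_temperature hx)).sub
      ((h.state_velSq hx).div_const 2)).prodMk
      ((continuousOn_pi.2 fun i => h.state_vel hx i).prodMk (h.state_temperature hx))
  exact this.congr fun t ht => dual_eq hγ hcv (hx t ht)

lemma _root_.ContinuousOn.state_prod (hγ : 1 < γ) (hcv : 0 < cv) (h : ContinuousOn x u)
    (hx : ∀ t ∈ u, 0 < rho (x t)) (h' : ContinuousOn y u) (hy : ∀ t ∈ u, 0 < rho (y t))
    (s : Fin d) : ContinuousOn (fun t => prod γ cv s (x t) (y t)) u := by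
  unfold prod jumpForm
  refine ((h.state_lam hx h' hy s).mul (((h'.state_dual hγ hcv hy).sub
    (h.state_dual hγ hcv hx)).state_dot (h'.sub h))).mul ?_
  exact (continuousOn_const.div (h.state_temperature hx)
    fun t ht => (temperature_pos hγ hcv (hx t ht)).ne').add
    (continuousOn_const.div (h'.state_temperature hy)
    fun t ht => (temperature_pos hγ hcv (hy t ht)).ne')

lemma _root_.ContinuousOn.state_absSum (h : ContinuousOn x u) :
    ContinuousOn (fun t => absSum (x t)) u :=
  (h.state_rho.abs.add (continuousOn_finsetSum _ fun i _ => (h.state_mom i).abs)).add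
    h.state_ent.abs

end continuity

/-! ## The Roe matrix -/

lemma contDiffOn_dual : ContDiffOn ℝ 1 (dual (d := d) γ cv) {q | 0 < rho q} := by
  have h1 : ContDiffOn ℝ 1 (fun q : State d => q.1) {q | 0 < rho q} := contDiff_fst.contDiffOn
  have h2 : ∀ i, ContDiffOn ℝ 1 (fun q : State d => q.2.1 i) {q | 0 < rho q} := fun i =>
    ((contDiff_apply ℝ ℝ i).comp (contDiff_fst.comp contDiff_snd)).contDiffOn
  have h3 : ContDiffOn ℝ 1 (fun q : State d => q.2.2) {q | 0 < rho q} :=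
    (contDiff_snd.comp contDiff_snd).contDiffOn
  have hr : ∀ q ∈ {q : State d | 0 < rho q}, q.1 ≠ 0 := fun q hq => (ne_of_gt hq : rho q ≠ 0)
  -- Nothing is assumed about `cv`. At zero the quotients by `cv` are zero, so the exponentials
  -- become constant and the temperature vanishes.
  by_cases hcv : cv = 0
  · subst hcv
    unfold dual temperature vel rho mom ent
    simp only [mul_zero, div_zero, Real.exp_zero, mul_one, sub_zero]
    refine ContDiffOn.prodMk (ContDiffOn.sub ?_ ?_) (ContDiffOn.prodMk ?_ contDiffOn_const)
    · exact contDiffOn_const.mul ((h1.rpow_const_of_ne hr).div_const _)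
    · exact (contDiffOn_const.div (contDiffOn_const.mul (h1.pow 2))
        fun q hq => mul_ne_zero two_ne_zero (pow_ne_zero _ (hr q hq))).mul
        (ContDiffOn.sum fun i _ => (h2 i).pow 2)
    · exact contDiffOn_pi.2 fun i => (h2 i).div h1 hr
  · have hs : ContDiffOn ℝ 1 (fun q : State d => q.2.2 / (q.1 * cv)) {q | 0 < rho q} :=
      h3.div (h1.mul contDiffOn_const) fun q hq => mul_ne_zero (hr q hq) hcv
    have hs' : ContDiffOn ℝ 1 (fun q : State d => q.2.2 / q.1 / cv) {q | 0 < rho q} :=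
      (h3.div h1 hr).div_const cv
    have hp : ContDiffOn ℝ 1 (fun q : State d => q.1 ^ (γ - 1) / (γ - 1)) {q | 0 < rho q} :=
      (h1.rpow_const_of_ne hr).div_const _
    unfold dual temperature internalEnergy vel rho mom ent
    refine ContDiffOn.prodMk (ContDiffOn.sub ?_ ?_) (ContDiffOn.prodMk ?_ ?_)
    · exact ((contDiffOn_const.sub hs).mul hp).mul hs.exp
    · exact (contDiffOn_const.div (contDiffOn_const.mul (h1.pow 2))
        fun q hq => mul_ne_zero two_ne_zero (pow_ne_zero _ (hr q hq))).mul
        (ContDiffOn.sum fun i _ => (h2 i).pow 2)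
    · exact contDiffOn_pi.2 fun i => (h2 i).div h1 hr
    · exact (hp.mul hs'.exp).div_const _

/-- Fundamental theorem of calculus along the segment from `a` to `b`, which stays in the half-space
of positive density. It turns the dissipation into `λ [[p]]·[[q]]`, so the Hessian is not needed
afterwards. -/
lemma roe_apply {a b : State d} (ha : 0 < rho a) (hb : 0 < rho b) :
    roe γ cv a b (b - a) = dual γ cv b - dual γ cv a := by
  have hopen : IsOpen {q : State d | 0 < rho q} := isOpen_lt continuous_const continuous_fst
  have hpos : ∀ θ ∈ Icc (0 : ℝ) 1, a + θ • (b - a) ∈ {q : State d | 0 < rho q} := by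
    intro θ hθ
    have : rho (a + θ • (b - a)) = (1 - θ) * rho a + θ * rho b := by
      simp only [rho, Prod.fst_add, Prod.smul_fst, Prod.fst_sub, smul_eq_mul]; ring
    simp only [mem_ofPred_eq, this]
    rcases hθ.1.eq_or_lt with h | h
    · rw [← h]; simpa using ha
    · have := mul_pos h hb
      have := mul_nonneg (sub_nonneg.2 hθ.2) ha.le
      linarith
  have hline : Continuous fun θ : ℝ => a + θ • (b - a) := by fun_prop
  have hcont : ContinuousOn (fun θ : ℝ => hess γ cv (a + θ • (b - a))) (uIcc 0 1) := by
    rw [uIcc_of_le zero_le_one]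
    exact (contDiffOn_dual.continuousOn_fderiv_of_isOpen hopen le_rfl).comp hline.continuousOn hpos
  have hd : ∀ θ ∈ uIcc (0 : ℝ) 1, HasDerivAt (fun θ => dual γ cv (a + θ • (b - a)))
      (hess γ cv (a + θ • (b - a)) (b - a)) θ := by
    intro θ hθ
    rw [uIcc_of_le zero_le_one] at hθ
    have h1 : HasFDerivAt (dual γ cv) (hess γ cv (a + θ • (b - a))) (a + θ • (b - a)) :=
      ((contDiffOn_dual.differentiableOn one_ne_zero _ (hpos θ hθ)).differentiableAt
        (hopen.mem_nhds (hpos θ hθ))).hasFDerivAt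
    have h2 : HasDerivAt (fun θ : ℝ => a + θ • (b - a)) (b - a) θ := by
      simpa using ((hasDerivAt_id θ).smul_const (b - a)).const_add a
    exact h1.comp_hasDerivAt θ h2
  have hint : IntervalIntegrable (fun θ : ℝ => hess γ cv (a + θ • (b - a))) volume 0 1 :=
    hcont.intervalIntegrable
  have key := intervalIntegral.integral_eq_sub_of_hasDerivAt hd
    (hcont.clm_apply continuousOn_const).intervalIntegrable
  rw [roe, ContinuousLinearMap.intervalIntegral_apply hint, key]
  simp

lemma dissipation_eq {a b : State d} (ha : 0 < rho a) (hb : 0 < rho b) (s : Fin d) :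
    dissipation γ cv s a b = lam γ cv s a b * jumpForm γ cv a b := by
  rw [dissipation, roe_apply ha hb, dot_comm, jumpForm]

/-! ## Summation by parts -/

section discrete

lemma left_right {n : ℕ} (K : Cell d n) (s : Fin d) : left (right K s) s = K := by
  simp [left, right]

variable {n : ℕ} [NeZero n]

lemma meshSize_pos : 0 < meshSize n := by
  have : 0 < n := Nat.pos_of_ne_zero (NeZero.ne n)
  unfold meshSize; positivity

lemma sum_right {M : Type*} [AddCommMonoid M] (g : Cell d n → M) (s : Fin d) :
    ∑ K, g (right K s) = ∑ K, g K :=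
  Fintype.sum_equiv (Equiv.addRight (Pi.single s 1 : Cell d n)) _ _ fun _ => rfl

/-- Entropy production of the whole mesh. -/
def prodSum (γ cv : ℝ) (q : Cell d n → State d) : ℝ :=
  ∑ K, ∑ s, prod γ cv s (q K) (q (right K s))

/-- Every interface is seen from its two cells; regrouping by interfaces collects the two weights
`B/T`. The weight `B = T` gives the energy balance, `B = 1` the entropy balance. -/
lemma sum_mul_production {q : Cell d n → State d} (hq : ∀ K, 0 < rho (q K)) (B : Cell d n → ℝ) :
    ∑ K, B K * production γ cv q K = 1 / 2 * ∑ K, ∑ s,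
      lam γ cv s (q K) (q (right K s)) * jumpForm γ cv (q K) (q (right K s))
        * (B K * (1 / temperature γ cv (q K))
          + B (right K s) * (1 / temperature γ cv (q (right K s)))) := by
  have e : ∀ s, ∑ K, B K * (1 / temperature γ cv (q K))
        * (lam γ cv s (q (left K s)) (q K) * jumpForm γ cv (q (left K s)) (q K))
      = ∑ K, B (right K s) * (1 / temperature γ cv (q (right K s)))
        * (lam γ cv s (q K) (q (right K s)) * jumpForm γ cv (q K) (q (right K s))) := by
    intro s
    rw [← sum_right _ s]
    simp only [left_right]
  simp only [production, dissipation_eq (hq _) (hq _)]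
  simp only [Finset.sum_add_distrib, mul_add]
  congr 1
  · rw [Finset.mul_sum]
    refine Finset.sum_congr rfl fun K _ => ?_
    rw [Finset.mul_sum, Finset.mul_sum, Finset.mul_sum]
    refine Finset.sum_congr rfl fun s _ => ?_
    ring
  · simp only [Finset.mul_sum]
    rw [Finset.sum_comm, Finset.sum_comm (f := fun K s => 1 / 2 *
      (lam γ cv s (q K) (q (right K s)) * jumpForm γ cv (q K) (q (right K s))
        * (B (right K s) * (1 / temperature γ cv (q (right K s))))))]
    refine Finset.sum_congr rfl fun s _ => ?_
    have := congrArg (fun z => 1 / 2 * z) (e s)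
    simp only [Finset.mul_sum] at this
    convert this using 1
    · exact Finset.sum_congr rfl fun K _ => by ring
    · exact Finset.sum_congr rfl fun K _ => by ring

lemma sum_production {q : Cell d n → State d} (hq : ∀ K, 0 < rho (q K)) :
    ∑ K, production γ cv q K = 1 / 2 * prodSum γ cv q := by
  have := sum_mul_production (γ := γ) (cv := cv) hq fun _ => 1
  simpa [prod, prodSum] using this

/-- Discrete integration by parts against an arbitrary field. It is applied to the dual variables
(energy), constants (mass, entropy), the gradient of the renormalised entropy, and nodal values of
test fields. -/
lemma sum_dot_rhs (q A : Cell d n → State d) :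
    ∑ K, dot (A K) (rhs γ cv q K) = 1 / meshSize n * (∑ K, ∑ s,
      (1 / 2 * dot (flux γ cv s (q K) + flux γ cv s (q (right K s))) (A (right K s) - A K)
        - dot (diffusion γ cv s (q K) (q (right K s))) (A (right K s) - A K)))
      + 1 / meshSize n * ∑ K, (A K).2.2 * production γ cv q K := by
  have hh := (meshSize_pos (n := n)).ne'
  have e1 : ∀ K, dot (A K) (rhs γ cv q K) = 1 / meshSize n * (∑ s,
      (-(1 / 2) * (dot (flux γ cv s (q (right K s))) (A K) - dot (flux γ cv s (q (left K s))) (A K))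
      + (dot (diffusion γ cv s (q K) (q (right K s))) (A K)
        - dot (diffusion γ cv s (q (left K s)) (q K)) (A K))))
      + 1 / meshSize n * ((A K).2.2 * production γ cv q K) := by
    intro K
    have e2 : dot (A K) ((0 : ℝ), (0 : Fin d → ℝ), 1 / meshSize n * production γ cv q K)
        = 1 / meshSize n * ((A K).2.2 * production γ cv q K) := by
      simp [dot]; ring
    rw [rhs, dot_add_right, dot_add_right, e2, dot_neg_right, dot_smul_right, dot_sum_right,
      dot_sum_right, Finset.sum_add_distrib, mul_add, Finset.mul_sum, ← Finset.sum_neg_distrib]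
    congr 2
    · rw [Finset.mul_sum]
      refine Finset.sum_congr rfl fun s _ => ?_
      rw [dot_smul_right, dot_sub_right, dot_comm (A K), dot_comm (A K)]
      field_simp
    · rw [← Finset.mul_sum]
      congr 1
      refine Finset.sum_congr rfl fun s _ => ?_
      rw [dot_sub_right, dot_comm (A K), dot_comm (A K)]
  simp only [e1]
  rw [Finset.sum_add_distrib, ← Finset.mul_sum, ← Finset.mul_sum]
  congr 2
  rw [Finset.sum_comm]
  conv_rhs => rw [Finset.sum_comm]
  refine Finset.sum_congr rfl fun s _ => ?_
  have f1 := sum_right (fun K : Cell d n => dot (flux γ cv s (q (left K s))) (A K)) s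
  have f2 := sum_right (fun K : Cell d n => dot (flux γ cv s (q K)) (A K)) s
  have f3 := sum_right (fun K : Cell d n => dot (diffusion γ cv s (q (left K s)) (q K)) (A K)) s
  simp only [left_right] at f1 f3
  simp only [dot_sub_right, dot_add_left, mul_add, mul_sub, Finset.sum_add_distrib,
    Finset.sum_sub_distrib, ← Finset.mul_sum]
  have f4 := sum_right (fun K => dot (flux γ cv s (q K)) (A K)) s
  rw [← f1, ← f3, ← f2]
  ring

end discrete

/-! ## Pointwise bounds -/

/-- The pointwise bounds that follow from a lower bound of the density and an upper bound of the
energy. -/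
structure Bounded (γ cv B : ℝ) (q : State d) : Prop where
  one_le : 1 ≤ B
  low : 1 ≤ B * rho q
  temp : temperature γ cv q ≤ B
  heat : rho q * temperature γ cv q ≤ B
  spec_le : spec q ≤ B
  vel_le : ∀ i, |vel q i| ≤ B
  kin : rho q * velSq q ≤ B
  press : pressure γ cv q ≤ B
  sound : soundSpeed γ cv q ≤ B

lemma Bounded.pos {B : ℝ} {q : State d} (h : Bounded γ cv B q) : 0 < rho q := by
  by_contra h0
  push Not at h0
  nlinarith [h.low, h.one_le]

lemma Bounded.mono {B B' : ℝ} (hB : B ≤ B') {q : State d} (h : Bounded γ cv B q) :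
    Bounded γ cv B' q where
  one_le := h.one_le.trans hB
  low := h.low.trans (mul_le_mul_of_nonneg_right hB h.pos.le)
  temp := h.temp.trans hB
  heat := h.heat.trans hB
  spec_le := h.spec_le.trans hB
  vel_le i := (h.vel_le i).trans hB
  kin := h.kin.trans hB
  press := h.press.trans hB
  sound := h.sound.trans hB

lemma Bounded.lam_le {B : ℝ} {a b : State d} (ha : Bounded γ cv B a) (hb : Bounded γ cv B b)
    (s : Fin d) : lam γ cv s a b ≤ B := by
  have h1 : maxSpeed γ cv s a ≤ 2 * B := by
    linarith [maxSpeed_le (γ := γ) (cv := cv) s a, ha.vel_le s, ha.sound]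
  have h2 : maxSpeed γ cv s b ≤ 2 * B := by
    linarith [maxSpeed_le (γ := γ) (cv := cv) s b, hb.vel_le s, hb.sound]
  have := max_le h1 h2
  unfold lam; linarith

lemma velSq_nonneg (q : State d) : 0 ≤ velSq q := Finset.sum_nonneg fun _ _ => sq_nonneg _

/-- The energy density is `c_v ρ T + ρ |v|²/2`, so it bounds `ρ T` and `ρ |v|²`, and division by the
lower density bound gives `T` and `v`. Since `s` increases with `T` and decreases with `ρ`, it is
bounded above only; the density has no upper bound here. -/
lemma exists_bounded (hγ : 1 < γ) (hcv : 0 < cv) {ρlow Ebar : ℝ} (hρ : 0 < ρlow)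
    (hE : 0 < Ebar) : ∃ B : ℝ, ∀ q : State d, ρlow ≤ rho q → totalEnergy γ cv q ≤ Ebar →
      Bounded γ cv B q := by
  have hg : 0 < γ - 1 := by linarith
  set κ := cv * (γ - 1) with hκ
  have hκ0 : 0 < κ := by positivity
  set Θ := Ebar / (cv * ρlow) with hΘ
  have hΘ0 : 0 < Θ := by positivity
  set S0 := cv * Real.log Θ - κ * Real.log ρlow + cv * Real.log ((γ - 1) * cv) with hS0
  set V := Real.sqrt (2 * Ebar / ρlow)
  set c0 := Real.sqrt (γ * κ * Θ)
  refine ⟨1 + 1 / ρlow + Θ + Ebar / cv + |S0| + V + 2 * Ebar + (γ - 1) * Ebar + c0,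
    fun q hq hq' => ?_⟩
  have hr : 0 < rho q := hρ.trans_le hq
  have ht := temperature_pos hγ hcv hr
  rw [totalEnergy_eq hcv] at hq'
  have hv := velSq_nonneg q
  have p1 : 0 < rho q * temperature γ cv q := by positivity
  have p2 : 0 ≤ rho q * velSq q := by positivity
  have e1 : rho q * temperature γ cv q ≤ Ebar / cv := by
    rw [le_div_iff₀ hcv]; nlinarith
  have e2 : temperature γ cv q ≤ Θ := by
    rw [hΘ, le_div_iff₀ (by positivity)]
    have : ρlow * temperature γ cv q ≤ rho q * temperature γ cv q := by gcongr
    nlinarith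
  have e3 : rho q * velSq q ≤ 2 * Ebar := by nlinarith
  have e4 : ∀ i, |vel q i| ≤ V := fun i => by
    refine Real.le_sqrt_of_sq_le ?_
    rw [sq_abs, le_div_iff₀ hρ]
    have h1 : vel q i ^ 2 ≤ velSq q :=
      Finset.single_le_sum (f := fun i => vel q i ^ 2) (fun _ _ => sq_nonneg _) (Finset.mem_univ i)
    calc vel q i ^ 2 * ρlow ≤ velSq q * rho q := by gcongr
      _ ≤ 2 * Ebar := by linarith
  have e5 : spec q ≤ S0 := by
    rw [spec_eq hγ hcv hr, hS0]
    have h1 : logTemp γ cv q ≤ Real.log Θ := Real.log_le_log ht e2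
    have h2 : Real.log ρlow ≤ logRho q := Real.log_le_log hρ hq
    have h3 := mul_le_mul_of_nonneg_left h1 hcv.le
    have h4 := mul_le_mul_of_nonneg_left h2 hκ0.le
    linarith
  have e6 : pressure γ cv q ≤ (γ - 1) * Ebar := by
    rw [pressure_eq hcv]
    rw [le_div_iff₀ hcv] at e1
    nlinarith
  have e7 : soundSpeed γ cv q ≤ c0 := by
    rw [soundSpeed_eq hcv hr]
    exact Real.sqrt_le_sqrt (mul_le_mul_of_nonneg_left e2 (by positivity))
  have q1 : 0 < 1 / ρlow := by positivity
  have q2 : 0 < Ebar / cv := by positivity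
  have q3 := abs_nonneg S0
  have q4 : 0 ≤ V := Real.sqrt_nonneg _
  have q5 : 0 ≤ c0 := Real.sqrt_nonneg _
  have q6 : 0 < (γ - 1) * Ebar := by positivity
  refine ⟨by linarith, ?_, by linarith, by linarith, by linarith [le_abs_self S0],
    fun i => by linarith [e4 i], by linarith, by linarith, by linarith⟩
  calc 1 = 1 / ρlow * ρlow := by field_simp
    _ ≤ _ := by
      refine mul_le_mul (by linarith) hq hρ.le (by positivity)

/-! ## Global balances -/

/-- The convention for a vanishing jump is harmless: `[[p]] = 0` makes `[[p]]·[[q]]` vanish, and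
with it the numerator. -/
lemma alpha_mul_self (hγ : 1 < γ) (hcv : 0 < cv) {a b : State d} (ha : 0 < rho a)
    (hb : 0 < rho b) (s : Fin d) :
    alpha γ cv s a b * dot (dual γ cv b - dual γ cv a) (dual γ cv b - dual γ cv a)
      = alphaNum γ cv s a b := by
  rw [alpha_eq]
  rcases eq_or_ne (dot (dual γ cv b - dual γ cv a) (dual γ cv b - dual γ cv a)) 0 with h | h
  · rw [h, mul_zero]
    have h1 : jumpForm γ cv a b = 0 := by
      have h2 := abs_dot_le (dual γ cv b - dual γ cv a) (b - a)
      rw [len, h, Real.sqrt_zero, zero_mul] at h2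
      exact abs_eq_zero.1 (le_antisymm h2 (abs_nonneg _))
    have h3 := abs_alphaNum_le hγ hcv ha hb s
    rw [h1, mul_zero] at h3
    exact (abs_eq_zero.1 (le_antisymm h3 (abs_nonneg _))).symm
  · field_simp

lemma norm_components (q : State d) {C : ℝ} (h : ‖q‖ ≤ C) : |rho q| ≤ C ∧ |ent q| ≤ C := by
  have h1 := norm_fst_le q
  have h2 := (norm_snd_le q.2).trans (norm_snd_le q)
  exact ⟨h1.trans h, h2.trans h⟩

section discrete

variable {n : ℕ} [NeZero n]

/-- Chain rule for the energy. By the choice of `α`, the central flux and the correction reduce to a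
jump of the flux potential, which telescopes on the torus; the loss `λ [[p]]·[[q]]` is exactly what
the production, weighted by the temperature, gives back. -/
lemma sum_dual_rhs (hγ : 1 < γ) (hcv : 0 < cv) {q : Cell d n → State d}
    (hq : ∀ K, 0 < rho (q K)) : ∑ K, dot (dual γ cv (q K)) (rhs γ cv q K) = 0 := by
  rw [sum_dot_rhs, ← mul_add]
  have e1 : ∑ K, (dual γ cv (q K)).2.2 * production γ cv q K
      = ∑ K, ∑ s, lam γ cv s (q K) (q (right K s)) * jumpForm γ cv (q K) (q (right K s)) := by
    rw [sum_mul_production hq, Finset.mul_sum]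
    refine Finset.sum_congr rfl fun K _ => ?_
    rw [Finset.mul_sum]
    refine Finset.sum_congr rfl fun s _ => ?_
    have t1 := (temperature_pos hγ hcv (hq K)).ne'
    have t2 := (temperature_pos hγ hcv (hq (right K s))).ne'
    simp only [dual]
    field_simp
    ring
  rw [e1, ← Finset.sum_add_distrib]
  set G : Fin d → Cell d n → ℝ := fun s K =>
    dot (dual γ cv (q K)) (flux γ cv s (q K)) - energyFlux γ cv s (q K) with hG
  have e2 : ∀ K : Cell d n, (∑ s, (1 / 2 * dot (flux γ cv s (q K) + flux γ cv s (q (right K s)))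
          (dual γ cv (q (right K s)) - dual γ cv (q K))
        - dot (diffusion γ cv s (q K) (q (right K s)))
          (dual γ cv (q (right K s)) - dual γ cv (q K))))
      + ∑ s, lam γ cv s (q K) (q (right K s)) * jumpForm γ cv (q K) (q (right K s))
      = ∑ s, (G s (right K s) - G s K) := by
    intro K
    rw [← Finset.sum_add_distrib]
    refine Finset.sum_congr rfl fun s _ => ?_
    have h1 := alpha_mul_self hγ hcv (hq K) (hq (right K s)) s
    unfold alphaNum at h1
    rw [diffusion, dot_add_left (alpha _ _ _ _ _ • _), dot_smul_left (alpha _ _ _ _ _), h1,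
      dot_smul_left, dot_smul_left, jumpForm,
      dot_comm (q (right K s) - q K)]
    simp only [hG]
    ring
  rw [Finset.sum_congr rfl fun K _ => e2 K, Finset.sum_comm]
  simp only [Finset.sum_sub_distrib, sum_right, sub_self, Finset.sum_const_zero, mul_zero]

lemma sum_dot_const_rhs (q : Cell d n → State d) (A : State d) :
    ∑ K, dot A (rhs γ cv q K) = 1 / meshSize n * (A.2.2 * ∑ K, production γ cv q K) := by
  rw [sum_dot_rhs q fun _ => A, ← Finset.mul_sum]
  simp [dot_zero_right]

lemma sum_rho_rhs (q : Cell d n → State d) : ∑ K, rho (rhs γ cv q K) = 0 := by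
  have := sum_dot_const_rhs (γ := γ) (cv := cv) q ((1, 0, 0) : State d)
  simpa [dot, rho] using this

lemma sum_ent_rhs {q : Cell d n → State d} (hq : ∀ K, 0 < rho (q K)) :
    ∑ K, ent (rhs γ cv q K) = 1 / meshSize n * (1 / 2 * prodSum γ cv q) := by
  have := sum_dot_const_rhs (γ := γ) (cv := cv) q ((0, 0, 1) : State d)
  rw [sum_production hq] at this
  simpa [dot, ent] using this

/-! ### Averages over the cells -/

lemma meshSize_pow_mul_card : meshSize n ^ d * (Fintype.card (Cell d n) : ℝ) = 1 := by
  have : (n : ℝ) ≠ 0 := Nat.cast_ne_zero.2 (NeZero.ne n)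
  simp only [Cell, Fintype.card_fun, ZMod.card, Fintype.card_fin, meshSize]
  push_cast
  rw [← mul_pow]; field_simp; simp

/-- Average over the cells of the mesh. -/
def cellSum (g : Cell d n → ℝ) : ℝ := meshSize n ^ d * ∑ K, g K

lemma cellSum_mono {g g' : Cell d n → ℝ} (h : ∀ K, g K ≤ g' K) : cellSum g ≤ cellSum g' :=
  mul_le_mul_of_nonneg_left (Finset.sum_le_sum fun K _ => h K) (pow_nonneg meshSize_pos.le _)

lemma cellSum_const (c : ℝ) : cellSum (fun _ : Cell d n => c) = c := by
  rw [cellSum, Finset.sum_const, nsmul_eq_mul, ← mul_assoc, Finset.card_univ,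
    meshSize_pow_mul_card, one_mul]

lemma cellSum_nonneg {g : Cell d n → ℝ} (h : ∀ K, 0 ≤ g K) : 0 ≤ cellSum g :=
  mul_nonneg (pow_nonneg meshSize_pos.le _) (Finset.sum_nonneg fun K _ => h K)

lemma cellSum_add (g g' : Cell d n → ℝ) :
    cellSum (fun K => g K + g' K) = cellSum g + cellSum g' := by
  simp only [cellSum, Finset.sum_add_distrib, mul_add]

lemma cellSum_mul (c : ℝ) (g : Cell d n → ℝ) : cellSum (fun K => c * g K) = c * cellSum g := by
  simp only [cellSum, ← Finset.mul_sum]; ring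

lemma cellSum_right (g : Cell d n → ℝ) (s : Fin d) :
    cellSum (fun K => g (right K s)) = cellSum g := by
  simp only [cellSum, sum_right]

lemma cellSum_finsetSum {ι : Type*} (u : Finset ι) (g : ι → Cell d n → ℝ) :
    cellSum (fun K => ∑ i ∈ u, g i K) = ∑ i ∈ u, cellSum (g i) := by
  simp only [cellSum, Finset.mul_sum]; rw [Finset.sum_comm]

/-- Total entropy production rate, up to the factor two. -/
def prodRate (γ cv : ℝ) (q : Cell d n → State d) : ℝ :=
  1 / meshSize n * cellSum fun K => ∑ s, prod γ cv s (q K) (q (right K s))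

lemma prodRate_nonneg (hγ : 1 < γ) (hcv : 0 < cv) {q : Cell d n → State d}
    (hq : ∀ K, 0 < rho (q K)) : 0 ≤ prodRate γ cv q :=
  mul_nonneg (one_div_nonneg.2 meshSize_pos.le) (cellSum_nonneg fun _ =>
    Finset.sum_nonneg fun s _ => prod_nonneg hγ hcv (hq _) (hq _) s)

/-- Comparison of an increment with the integral of a bound of the derivative. -/
lemma sub_le_integral_of_deriv_le {W W' g : ℝ → ℝ} {T τ : ℝ} (hτ : τ ∈ Icc 0 T)
    (hW : ContinuousOn W (Icc 0 T)) (hW' : ∀ t ∈ Ioo 0 T, HasDerivAt W (W' t) t)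
    (hg : ContinuousOn g (Icc 0 T)) (h : ∀ t ∈ Ioo 0 T, W' t ≤ g t) :
    W τ - W 0 ≤ ∫ t in (0 : ℝ)..τ, g t := by
  have hsub : Icc 0 τ ⊆ Icc 0 T := Icc_subset_Icc_right hτ.2
  have hsub' : Ioo 0 τ ⊆ Ioo 0 T := Ioo_subset_Ioo_right hτ.2
  exact intervalIntegral.sub_le_integral_of_hasDeriv_right_of_le hτ.1 (hW.mono hsub)
    (fun x hx => (hW' x (hsub' hx)).hasDerivWithinAt)
    ((hg.mono hsub).integrableOn_compact isCompact_Icc) fun x hx => h x (hsub' hx)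

lemma eq_of_deriv_zero {W : ℝ → ℝ} {T τ : ℝ} (hτ : τ ∈ Icc 0 T)
    (hW : ContinuousOn W (Icc 0 T)) (hW' : ∀ t ∈ Ioo 0 T, HasDerivAt W 0 t) : W τ = W 0 := by
  have h1 := sub_le_integral_of_deriv_le hτ hW hW' continuousOn_const fun t _ => le_refl (0 : ℝ)
  have h2 := sub_le_integral_of_deriv_le hτ hW.neg
    (fun t ht => ((hW' t ht).neg.congr_deriv neg_zero)) continuousOn_const fun t _ => le_refl (0 : ℝ)
  simp only [intervalIntegral.integral_zero, Pi.neg_apply] at h1 h2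
  linarith

/-! ### Conserved quantities and the entropy budget of a solution -/

variable {T : ℝ}

lemma IsSolution.sum_energy (hγ : 1 < γ) (hcv : 0 < cv) {q : ℝ → Cell d n → State d}
    (hq : IsSolution γ cv T q) (hpos : ∀ t ∈ Icc 0 T, ∀ K, 0 < rho (q t K)) {τ : ℝ}
    (hτ : τ ∈ Icc 0 T) :
    ∑ K, totalEnergy γ cv (q τ K) = ∑ K, totalEnergy γ cv (q 0 K) := by
  refine eq_of_deriv_zero (W := fun t => ∑ K, totalEnergy γ cv (q t K)) hτ ?_ fun t ht => ?_
  · exact continuousOn_finsetSum _ fun K _ =>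
      (hq K).1.state_totalEnergy fun t ht => hpos t ht K
  · have hp := hpos t (Ioo_subset_Icc_self ht)
    rw [← sum_dual_rhs hγ hcv hp]
    exact HasDerivAt.fun_sum fun K _ => ((hq K).2 t ht).state_totalEnergy hγ hcv (hp K)

lemma IsSolution.sum_rho {q : ℝ → Cell d n → State d} (hq : IsSolution γ cv T q) {τ : ℝ}
    (hτ : τ ∈ Icc 0 T) : ∑ K, rho (q τ K) = ∑ K, rho (q 0 K) := by
  refine eq_of_deriv_zero (W := fun t => ∑ K, rho (q t K)) hτ ?_ fun t ht => ?_
  · exact continuousOn_finsetSum _ fun K _ => (hq K).1.state_rho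
  · rw [← sum_rho_rhs (γ := γ) (cv := cv) (q t)]
    exact HasDerivAt.fun_sum fun K _ => ((hq K).2 t ht).state_rho

lemma IsSolution.continuousOn_prodRate (hγ : 1 < γ) (hcv : 0 < cv)
    {q : ℝ → Cell d n → State d} (hq : IsSolution γ cv T q)
    (hpos : ∀ t ∈ Icc 0 T, ∀ K, 0 < rho (q t K)) :
    ContinuousOn (fun t => prodRate γ cv (q t)) (Icc 0 T) :=
  continuousOn_const.mul (continuousOn_const.mul (continuousOn_finsetSum _ fun K _ =>
    continuousOn_finsetSum _ fun s _ => (hq K).1.state_prod hγ hcv (fun t ht => hpos t ht K)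
      (hq (right K s)).1 (fun t ht => hpos t ht (right K s)) s))

/-- Testing with the constant entropy direction kills all fluxes and leaves the production. The
factor two compensates the `1/2` in its definition. -/
lemma IsSolution.integral_prodRate (hγ : 1 < γ) (hcv : 0 < cv)
    {q : ℝ → Cell d n → State d} (hq : IsSolution γ cv T q)
    (hpos : ∀ t ∈ Icc 0 T, ∀ K, 0 < rho (q t K)) {τ : ℝ} (hτ : τ ∈ Icc 0 T) :
    ∫ t in (0 : ℝ)..τ, prodRate γ cv (q t)
      = 2 * (cellSum (fun K => ent (q τ K)) - cellSum fun K => ent (q 0 K)) := by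
  have hc := hq.continuousOn_prodRate hγ hcv hpos
  have hW : ContinuousOn (fun t => 2 * cellSum fun K => ent (q t K)) (Icc 0 T) :=
    continuousOn_const.mul (continuousOn_const.mul
      (continuousOn_finsetSum _ fun K _ => (hq K).1.state_ent))
  have hW' : ∀ t ∈ Ioo 0 T, HasDerivAt (fun t => 2 * cellSum fun K => ent (q t K))
      (prodRate γ cv (q t)) t := fun t ht => by
    refine (((HasDerivAt.fun_sum fun K _ => ((hq K).2 t ht).state_ent).const_mul
      (meshSize n ^ d)).const_mul 2).congr_deriv ?_
    rw [sum_ent_rhs (hpos t (Ioo_subset_Icc_self ht)), prodRate, cellSum, prodSum]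
    ring
  have h1 := sub_le_integral_of_deriv_le hτ hW hW' hc fun t _ => le_rfl
  have h2 := sub_le_integral_of_deriv_le hτ hW.neg (fun t ht => (hW' t ht).neg) hc.neg
    fun t _ => le_rfl
  simp only [Pi.neg_apply, intervalIntegral.integral_neg] at h1 h2
  linarith

/-- A solution together with the bounds that do not depend on the mesh. -/
structure BoundedSolution (γ cv T B : ℝ) (q : ℝ → Cell d n → State d) : Prop where
  sol : IsSolution γ cv T q
  bdd : ∀ t ∈ Icc 0 T, ∀ K, Bounded γ cv B (q t K)
  mass : ∀ t ∈ Icc 0 T, cellSum (fun K => rho (q t K)) ≤ B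
  entropy : ∀ t ∈ Icc 0 T, cellSum (fun K => |ent (q t K)|) ≤ B
  prod_le : ∀ t ∈ Icc 0 T, ∫ t' in (0 : ℝ)..t, prodRate γ cv (q t') ≤ B
  init : ∀ K, |spec (q 0 K)| ≤ B

end discrete

/-- Mass conservation and the upper bound of `s` bound the total entropy from above; the initial
data bound it from below, since it does not decrease. The difference is the total production, which
is thereby bounded uniformly in the mesh. -/
lemma exists_boundedSolution (d : ℕ) (hγ : 1 < γ) (hcv : 0 < cv) {T : ℝ} (hT : 0 < T)
    {ρlow Ebar : ℝ}
    (hρ : 0 < ρlow) (hE : 0 < Ebar) (C : ℝ) : ∃ B : ℝ, 1 ≤ B ∧ ∀ (n : ℕ) [NeZero n]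
      (q : ℝ → Cell d n → State d), IsSolution γ cv T q → (∀ K, ‖q 0 K‖ ≤ C) →
      (∀ t ∈ Icc 0 T, ∀ K, ρlow ≤ rho (q t K)) →
      (∀ t ∈ Icc 0 T, ∀ K, totalEnergy γ cv (q t K) ≤ Ebar) → BoundedSolution γ cv T B q := by
  obtain ⟨B, hB⟩ := exists_bounded (d := d) hγ hcv hρ hE
  have hC' : C ≤ |C| := le_abs_self C
  have hC0 := abs_nonneg C
  have hC1 : 0 ≤ |C| / ρlow := by positivity
  have hB' : B ≤ |B| := le_abs_self B
  have hB0 := abs_nonneg B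
  have hBC : 0 ≤ |B| * |C| := by positivity
  refine ⟨1 + |B| + |C| + 2 * (|B| * |C| + |C|) + |C| / ρlow, by linarith,
    fun n _ q hq hinit hlow hen => ?_⟩
  have h0 : (0 : ℝ) ∈ Icc 0 T := ⟨le_rfl, hT.le⟩
  have hb : ∀ t ∈ Icc 0 T, ∀ K, Bounded γ cv B (q t K) := fun t ht K =>
    hB _ (hlow t ht K) (hen t ht K)
  have hpos : ∀ t ∈ Icc 0 T, ∀ K, 0 < rho (q t K) := fun t ht K => (hb t ht K).pos
  have mass : ∀ t ∈ Icc 0 T, cellSum (fun K => rho (q t K)) ≤ |C| := fun t ht => by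
    rw [cellSum, hq.sum_rho ht]
    refine (cellSum_mono (g := fun K => rho (q 0 K)) fun K => ?_).trans_eq (cellSum_const |C|)
    exact (le_abs_self _).trans ((norm_components _ (hinit K)).1.trans hC')
  have ent_le : ∀ t ∈ Icc 0 T, ∀ K, ent (q t K) ≤ |B| * rho (q t K) := fun t ht K => by
    rw [ent_eq (hpos t ht K), mul_comm]
    exact mul_le_mul_of_nonneg_right ((hb t ht K).spec_le.trans hB') (hpos t ht K).le
  have up : ∀ t ∈ Icc 0 T, cellSum (fun K => ent (q t K)) ≤ |B| * |C| := fun t ht => by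
    refine (cellSum_mono (ent_le t ht)).trans ?_
    rw [cellSum_mul]
    exact mul_le_mul_of_nonneg_left (mass t ht) hB0
  have lo : -|C| ≤ cellSum (fun K => ent (q 0 K)) := by
    rw [← cellSum_const (d := d) (n := n) (-|C|)]
    refine cellSum_mono fun K => ?_
    exact neg_le_of_abs_le ((norm_components _ (hinit K)).2.trans hC')
  have ip : ∀ t ∈ Icc 0 T, ∫ t' in (0 : ℝ)..t, prodRate γ cv (q t')
      = 2 * (cellSum (fun K => ent (q t K)) - cellSum fun K => ent (q 0 K)) := fun t ht =>
    hq.integral_prodRate hγ hcv hpos ht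
  refine ⟨hq, fun t ht K => (hb t ht K).mono (by linarith), fun t ht => by linarith [mass t ht],
    fun t ht => ?_, fun t ht => ?_, fun K => ?_⟩
  · have h1 : 0 ≤ ∫ t' in (0 : ℝ)..t, prodRate γ cv (q t') :=
      intervalIntegral.integral_nonneg ht.1 fun t' ht' =>
        prodRate_nonneg hγ hcv (hpos t' ⟨ht'.1, ht'.2.trans ht.2⟩)
    rw [ip t ht] at h1
    -- From `S ≤ |B| ρ` follows `|S| ≤ 2 |B| ρ - S`, and the integral of the right-hand side is
    -- bounded because total entropy stays above its initial value.
    have h2 : cellSum (fun K => |ent (q t K)|)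
        ≤ cellSum (fun K => 2 * (|B| * rho (q t K)) + (-1) * ent (q t K)) := by
      refine cellSum_mono fun K => ?_
      have := ent_le t ht K
      have h3 : 0 ≤ |B| * rho (q t K) := mul_nonneg hB0 (hpos t ht K).le
      rw [abs_le]; constructor <;> linarith
    rw [cellSum_add, cellSum_mul, cellSum_mul, cellSum_mul] at h2
    have h4 := mul_le_mul_of_nonneg_left (mass t ht) hB0
    linarith
  · rw [ip t ht]
    linarith [up t ht]
  · have h1 := (norm_components _ (hinit K)).2.trans hC'
    have h2 : |spec (q 0 K)| ≤ |C| / ρlow := by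
      unfold spec
      rw [abs_div, abs_of_pos (hpos 0 h0 K)]
      exact div_le_div₀ hC0 h1 hρ (hlow 0 h0 K)
    linarith

/-! ## Truncated logarithmic profiles -/

/-- If `f' 1 = 0` then `f`, frozen to the left of `1`, is differentiable. -/
lemma hasDerivAt_comp_max {f f' : ℝ → ℝ} (hf : ∀ t, 1 ≤ t → HasDerivAt f (f' t) t)
    (h1 : f' 1 = 0) (z : ℝ) : HasDerivAt (fun z => f (max z 1)) (f' (max z 1)) z := by
  rcases lt_trichotomy z 1 with h | h | h
  · rw [max_eq_right h.le, h1]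
    refine (hasDerivAt_const z (f 1)).congr_of_eventuallyEq ?_
    filter_upwards [Iio_mem_nhds h] with t ht
    rw [max_eq_right (le_of_lt ht)]
  · subst h
    rw [max_self]
    have hr : HasDerivWithinAt (fun z => f (max z 1)) (f' 1) (Ici 1) 1 :=
      (hf 1 le_rfl).hasDerivWithinAt.congr (fun t ht => by rw [max_eq_left ht]) (by simp)
    have hl : HasDerivWithinAt (fun z => f (max z 1)) (f' 1) (Iic 1) 1 := by
      rw [h1]
      exact (hasDerivWithinAt_const (1 : ℝ) (Iic 1) (f 1)).congr
        (fun t ht => by rw [max_eq_right ht]) (by simp)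
    have := hl.union hr
    rwa [Iic_union_Ici, hasDerivWithinAt_univ] at this
  · rw [max_eq_left h.le]
    refine (hf z h.le).congr_of_eventuallyEq ?_
    filter_upwards [Ioi_mem_nhds h] with t ht
    rw [max_eq_left (le_of_lt ht)]

/-- A function with `|f' t| ≤ k / t` on `[1, ∞)`, frozen to the left of `1`. -/
lemma abs_sub_comp_max_le {f f' : ℝ → ℝ} {k : ℝ} (hf : ∀ t, 1 ≤ t → HasDerivAt f (f' t) t)
    {x y : ℝ} (hk : ∀ t, 1 ≤ t → t ≤ max 1 (max x y) → |f' t| ≤ k / t) :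
    |f (max y 1) - f (max x 1)| ≤ k * (|y - x| / max 1 (min x y)) := by
  have key : ∀ x y : ℝ, x ≤ y → (∀ t, 1 ≤ t → t ≤ max 1 (max x y) → |f' t| ≤ k / t) →
      |f (max y 1) - f (max x 1)| ≤ k * (|y - x| / max 1 (min x y)) := by
    intro x y hxy hk
    have h1 : max x 1 ≤ max y 1 := max_le_max_right 1 hxy
    have hm : 1 ≤ max x 1 := le_max_right _ _
    have hk0 : 0 ≤ k := by
      have := (abs_nonneg _).trans (hk 1 le_rfl (le_max_left _ _))
      simpa using this
    have h2 : ∀ t ∈ Icc (max x 1) (max y 1), ‖f' t‖ ≤ k / max x 1 := fun t ht => by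
      refine (hk t (hm.trans ht.1) (ht.2.trans ?_)).trans ?_
      · rw [max_comm]; exact max_le_max_left 1 (le_max_right x y)
      · exact div_le_div_of_nonneg_left hk0 (by linarith) ht.1
    have h3 := (convex_Icc (max x 1) (max y 1)).norm_image_sub_le_of_norm_hasDerivWithin_le
      (fun t ht => (hf t (hm.trans ht.1)).hasDerivWithinAt) h2 (left_mem_Icc.2 h1)
      (right_mem_Icc.2 h1)
    rw [Real.norm_eq_abs, Real.norm_eq_abs] at h3
    refine h3.trans ?_
    have h4 : |max y 1 - max x 1| ≤ |y - x| := abs_max_sub_max_le_abs y x 1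
    rw [min_eq_left hxy, max_comm 1 x]
    calc k / max x 1 * |max y 1 - max x 1| ≤ k / max x 1 * |y - x| := by gcongr
      _ = _ := by ring
  rcases le_total x y with h | h
  · exact key x y h hk
  · rw [abs_sub_comm, abs_sub_comm y x, min_comm]
    exact key y x h (by rwa [max_comm y x])

lemma exists_mean_value {f f' : ℝ → ℝ} (hf : ∀ t, HasDerivAt f (f' t) t) (x y : ℝ) :
    ∃ ξ, |ξ - x| ≤ |y - x| ∧ min x y ≤ ξ ∧ ξ ≤ max x y ∧ f y - f x = f' ξ * (y - x) := by
  have hc : Continuous f := continuous_iff_continuousAt.2 fun t => (hf t).continuousAt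
  rcases lt_trichotomy x y with h | h | h
  · obtain ⟨ξ, hξ, e⟩ := exists_hasDerivAt_eq_slope f f' h hc.continuousOn fun t _ => hf t
    refine ⟨ξ, ?_, ?_, ?_, ?_⟩
    · rw [abs_of_pos (sub_pos.2 hξ.1), abs_of_pos (sub_pos.2 h)]; linarith [hξ.2]
    · exact (min_le_left _ _).trans hξ.1.le
    · exact hξ.2.le.trans (le_max_right _ _)
    · rw [e]; field_simp [(sub_pos.2 h).ne']
  · subst h; exact ⟨x, by simp⟩
  · obtain ⟨ξ, hξ, e⟩ := exists_hasDerivAt_eq_slope f f' h hc.continuousOn fun t _ => hf t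
    refine ⟨ξ, ?_, ?_, ?_, ?_⟩
    · rw [abs_of_neg (sub_neg.2 hξ.2), abs_of_neg (sub_neg.2 h)]; linarith [hξ.1]
    · exact (min_le_right _ _).trans hξ.1.le
    · exact hξ.2.le.trans (le_max_left _ _)
    · rw [e]; field_simp [(sub_pos.2 h).ne']; ring

/-- First-order Taylor estimate for a function with Lipschitz derivative. -/
lemma abs_taylor_le {f f' : ℝ → ℝ} (hf : ∀ t, HasDerivAt f (f' t) t) {k : ℝ} (hk : 0 ≤ k)
    (hl : ∀ x y, |f' y - f' x| ≤ k * |y - x|) (x y : ℝ) :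
    |f y - f x - f' x * (y - x)| ≤ k * (y - x) ^ 2 := by
  obtain ⟨ξ, h1, -, -, h2⟩ := exists_mean_value hf x y
  rw [h2, ← sub_mul, abs_mul, ← sq_abs (y - x), pow_two, ← mul_assoc]
  exact mul_le_mul_of_nonneg_right ((hl x ξ).trans (mul_le_mul_of_nonneg_left h1 hk))
    (abs_nonneg _)

/-- `log y + 1 / y - 1` for `y = max z 1`. -/
def cutLog (z : ℝ) : ℝ := Real.log (max z 1) + 1 / max z 1 - 1

/-- The derivative of `cutLog`. -/
def cutLog' (z : ℝ) : ℝ := 1 / max z 1 - 1 / max z 1 ^ 2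

/-- `cutLog z - z * cutLog' z`. -/
def cutExc (z : ℝ) : ℝ := Real.log (max z 1) + 2 / max z 1 - 2

/-- The convex profile growing like `z log² z`. -/
def cutSq (z : ℝ) : ℝ :=
  1 / 2 * max z 1 * Real.log (max z 1) ^ 2 - 3 * max z 1 * Real.log (max z 1) + 5 * max z 1
    - 2 * Real.log (max z 1) - 5

/-- The derivative of `cutSq`. -/
def cutSq' (z : ℝ) : ℝ :=
  1 / 2 * Real.log (max z 1) ^ 2 - 2 * Real.log (max z 1) + 2 - 2 / max z 1

lemma hasDerivAt_one_div {t : ℝ} (ht : t ≠ 0) (k : ℝ) :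
    HasDerivAt (fun t => k / t) (-k / t ^ 2) t := by
  refine ((hasDerivAt_const t k).div (hasDerivAt_id t) ht).congr_deriv ?_
  simp

lemma hasDerivAt_cutLog (z : ℝ) : HasDerivAt cutLog (cutLog' z) z := by
  refine hasDerivAt_comp_max (f := fun y => Real.log y + 1 / y - 1)
    (f' := fun y => 1 / y - 1 / y ^ 2) (fun t ht => ?_) (by norm_num) z
  have h0 : t ≠ 0 := by positivity
  refine (((Real.hasDerivAt_log h0).add (hasDerivAt_one_div h0 1)).sub_const 1).congr_deriv ?_
  field_simp; ring

lemma hasDerivAt_cutSq (z : ℝ) : HasDerivAt cutSq (cutSq' z) z := by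
  refine hasDerivAt_comp_max (f := fun y => 1 / 2 * y * Real.log y ^ 2 - 3 * y * Real.log y + 5 * y
    - 2 * Real.log y - 5)
    (f' := fun y => 1 / 2 * Real.log y ^ 2 - 2 * Real.log y + 2 - 2 / y)
    (fun t ht => ?_) (by norm_num) z
  have h0 : t ≠ 0 := by positivity
  have hl := Real.hasDerivAt_log h0
  have hi := hasDerivAt_id t
  refine ((((((hi.const_mul (1 / 2)).mul (hl.pow 2)).sub ((hi.const_mul 3).mul hl)).add
    (hi.const_mul 5)).sub (hl.const_mul 2)).sub_const 5).congr_deriv ?_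
  simp
  field_simp
  ring

lemma hasDerivAt_cutSq'_aux {t : ℝ} (ht : 1 ≤ t) :
    HasDerivAt (fun y => 1 / 2 * Real.log y ^ 2 - 2 * Real.log y + 2 - 2 / y)
      ((Real.log t + 2 / t - 2) / t) t := by
  have h0 : t ≠ 0 := by positivity
  have hl := Real.hasDerivAt_log h0
  refine (((((hl.pow 2).const_mul (1 / 2)).sub (hl.const_mul 2)).add_const 2).sub
    (hasDerivAt_one_div h0 2)).congr_deriv ?_
  simp
  field_simp
  ring

/-- The two profiles are coupled: the second derivative of `cutSq`, times `max z 1`, is the Legendre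
excess `cutExc` of `cutLog`. This is the relation that cancels the leading density jumps in the
gradient of the renormalised entropy. -/
lemma hasDerivAt_cutSq' (z : ℝ) : HasDerivAt cutSq' (cutExc z / max z 1) z :=
  hasDerivAt_comp_max (f := fun y => 1 / 2 * Real.log y ^ 2 - 2 * Real.log y + 2 - 2 / y)
    (f' := fun y => (Real.log y + 2 / y - 2) / y) (fun _ ht => hasDerivAt_cutSq'_aux ht)
    (by norm_num) z

lemma cut_of_le_one {z : ℝ} (hz : z ≤ 1) :
    cutLog z = 0 ∧ cutLog' z = 0 ∧ cutExc z = 0 ∧ cutSq z = 0 ∧ cutSq' z = 0 := by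
  simp only [cutLog, cutLog', cutExc, cutSq, cutSq', max_eq_right hz]
  norm_num

lemma cutExc_eq (z : ℝ) : cutExc z = cutLog z - z * cutLog' z := by
  rcases le_total z 1 with h | h
  · obtain ⟨h1, h2, h3, -, -⟩ := cut_of_le_one h
    rw [h1, h2, h3]; ring
  · have h0 : z ≠ 0 := by positivity
    simp only [cutLog, cutLog', cutExc, max_eq_left h]
    field_simp; ring

lemma hasDerivAt_cutSq_legendre (z : ℝ) :
    HasDerivAt (fun z => cutSq z - z * cutSq' z) (-cutExc z) z := by
  refine ((hasDerivAt_cutSq z).sub ((hasDerivAt_id z).mul (hasDerivAt_cutSq' z))).congr_deriv ?_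
  rcases le_total z 1 with h | h
  · rw [(cut_of_le_one h).2.2.1]; simp
  · have h0 : z ≠ 0 := by positivity
    rw [max_eq_left h]; simp; field_simp

lemma log_le_sub_one {t : ℝ} (ht : 1 ≤ t) : Real.log t ≤ t - 1 :=
  Real.log_le_sub_one_of_pos (by linarith)

lemma abs_cutLog_sub_le (x y : ℝ) :
    |cutLog y - cutLog x| ≤ |y - x| / max 1 (min x y) := by
  have := abs_sub_comp_max_le (f := fun y => Real.log y + 1 / y - 1)
    (f' := fun y => 1 / y - 1 / y ^ 2) (k := 1) (x := x) (y := y) (fun t ht => ?_) (fun t ht _ => ?_)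
  · rwa [one_mul] at this
  · have h0 : t ≠ 0 := by positivity
    refine (((Real.hasDerivAt_log h0).add (hasDerivAt_one_div h0 1)).sub_const 1).congr_deriv ?_
    field_simp; ring
  · have h0 : 0 < t := by linarith
    rw [abs_le]
    constructor
    · rw [← sub_nonneg]; field_simp; linarith
    · have : 0 ≤ 1 / t ^ 2 := by positivity
      linarith

lemma abs_cutExc_sub_le (x y : ℝ) :
    |cutExc y - cutExc x| ≤ |y - x| / max 1 (min x y) := by
  have := abs_sub_comp_max_le (f := fun y => Real.log y + 2 / y - 2)
    (f' := fun y => 1 / y - 2 / y ^ 2) (k := 1) (x := x) (y := y) (fun t ht => ?_) (fun t ht _ => ?_)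
  · rwa [one_mul] at this
  · have h0 : t ≠ 0 := by positivity
    refine (((Real.hasDerivAt_log h0).add (hasDerivAt_one_div h0 2)).sub_const 2).congr_deriv ?_
    field_simp; ring
  · have h0 : 0 < t := by linarith
    rw [abs_le]
    constructor
    · rw [← sub_nonneg]; field_simp; linarith
    · have : 0 ≤ 2 / t ^ 2 := by positivity
      linarith

lemma abs_cutLog'_sub_le (x y : ℝ) :
    |cutLog' y - cutLog' x| ≤ |y - x| / max 1 (min x y) := by
  have := abs_sub_comp_max_le (f := fun y => 1 / y - 1 / y ^ 2)
    (f' := fun y => -1 / y ^ 2 + 2 / y ^ 3) (k := 1) (x := x) (y := y) (fun t ht => ?_)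
    (fun t ht _ => ?_)
  · rwa [one_mul] at this
  · have h0 : t ≠ 0 := by positivity
    refine ((hasDerivAt_one_div h0 1).sub
      ((hasDerivAt_const t (1 : ℝ)).div ((hasDerivAt_id t).pow 2)
        (pow_ne_zero 2 h0))).congr_deriv ?_
    simp; field_simp; ring
  · have h0 : 0 < t := by linarith
    rw [abs_le]
    constructor
    · rw [← sub_nonneg]; field_simp; nlinarith
    · rw [← sub_nonneg]; field_simp; nlinarith

lemma abs_cutExc_le {z L : ℝ} (hL : 1 ≤ L) (hz : Real.log (max z 1) ≤ L) : |cutExc z| ≤ L := by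
  have h1 : (1 : ℝ) ≤ max z 1 := le_max_right _ _
  have h2 : 0 < max z 1 := by linarith
  have h3 : 2 / max z 1 ≤ 2 := by rw [div_le_iff₀ h2]; linarith
  have h4 : -1 ≤ Real.log (max z 1) + 2 / max z 1 - 2 := by
    have := Real.one_sub_inv_le_log_of_pos h2
    rw [← one_div] at this
    have : 0 < 1 / max z 1 := by positivity
    have : 2 / max z 1 = 2 * (1 / max z 1) := by ring
    linarith
  unfold cutExc
  rw [abs_le]; constructor <;> linarith

lemma abs_cutSq'_sub_le_mul {x y L : ℝ} (hL : 1 ≤ L) (hx : Real.log (max x 1) ≤ L)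
    (hy : Real.log (max y 1) ≤ L) :
    |cutSq' y - cutSq' x| ≤ L * (|y - x| / max 1 (min x y)) := by
  refine abs_sub_comp_max_le (f := fun y => 1 / 2 * Real.log y ^ 2 - 2 * Real.log y + 2 - 2 / y)
    (f' := fun y => (Real.log y + 2 / y - 2) / y) (fun t ht => hasDerivAt_cutSq'_aux ht)
    fun t ht ht' => ?_
  have h0 : 0 < t := by linarith
  rw [abs_div, abs_of_pos h0]
  refine div_le_div_of_nonneg_right ?_ h0.le
  have h := abs_cutExc_le (z := t) hL (by
    rw [max_eq_left ht]
    refine (Real.log_le_log h0 ht').trans ?_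
    rcases le_total x y with h | h
    · rw [max_eq_right h, max_comm]; exact hy
    · rw [max_eq_left h, max_comm]; exact hx)
  rwa [cutExc, max_eq_left ht] at h

lemma abs_cutSq'_sub_le (x y : ℝ) : |cutSq' y - cutSq' x| ≤ 1 * |y - x| := by
  obtain ⟨ξ, -, -, -, h⟩ := exists_mean_value hasDerivAt_cutSq' x y
  rw [h, abs_mul]
  refine mul_le_mul_of_nonneg_right ?_ (abs_nonneg _)
  have h1 : (1 : ℝ) ≤ max ξ 1 := le_max_right _ _
  set t := max ξ 1 with ht
  have h0 : 0 < t := by linarith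
  have h2 := log_le_sub_one h1
  have h3 := Real.log_nonneg h1
  rw [cutExc, ← ht, abs_div, abs_of_pos h0, div_le_one h0, abs_le]
  have h4 : 2 / t ≤ 2 := by rw [div_le_iff₀ h0]; linarith
  have h5 : 2 - t ≤ 2 / t := by rw [le_div_iff₀ h0]; nlinarith
  constructor <;> linarith

lemma div_max_le (x y : ℝ) : |y - x| / max 1 (min x y) ≤ 1 * |y - x| := by
  rw [one_mul]
  exact div_le_self (abs_nonneg _) (le_max_left _ _)

lemma abs_cutLog_taylor_le (x y : ℝ) :
    |cutLog y - cutLog x - cutLog' x * (y - x)| ≤ (y - x) ^ 2 := by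
  have := abs_taylor_le hasDerivAt_cutLog zero_le_one
    (fun x y => (abs_cutLog'_sub_le x y).trans (div_max_le x y)) x y
  rwa [one_mul] at this

lemma abs_cutSq_taylor_le (x y : ℝ) :
    |cutSq y - cutSq x - cutSq' x * (y - x)| ≤ (y - x) ^ 2 := by
  have := abs_taylor_le hasDerivAt_cutSq zero_le_one abs_cutSq'_sub_le x y
  rwa [one_mul] at this

lemma cutLog_nonneg (z : ℝ) : 0 ≤ cutLog z := by
  have h1 : (1 : ℝ) ≤ max z 1 := le_max_right _ _
  have := Real.one_sub_inv_le_log_of_pos (by linarith : 0 < max z 1)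
  unfold cutLog; rw [one_div]; linarith

lemma cutLog_le (z : ℝ) : cutLog z ≤ Real.log (max z 1) := by
  have h1 : (1 : ℝ) ≤ max z 1 := le_max_right _ _
  have : 1 / max z 1 ≤ 1 := by rw [div_le_one (by linarith)]; exact h1
  unfold cutLog; linarith

lemma cutLog'_nonneg (z : ℝ) : 0 ≤ cutLog' z := by
  have h1 : (1 : ℝ) ≤ max z 1 := le_max_right _ _
  have h0 : 0 < max z 1 := by linarith
  unfold cutLog'
  field_simp; linarith

lemma cutLog'_le (z : ℝ) : cutLog' z ≤ 1 / max z 1 := by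
  have h0 : 0 < max z 1 := by have : (1 : ℝ) ≤ max z 1 := le_max_right _ _; linarith
  have : 0 ≤ 1 / max z 1 ^ 2 := by positivity
  unfold cutLog'; linarith

lemma neg_two_le_cutSq' (z : ℝ) : -2 ≤ cutSq' z := by
  have h1 : (1 : ℝ) ≤ max z 1 := le_max_right _ _
  have : 2 / max z 1 ≤ 2 := by rw [div_le_iff₀ (by linarith)]; linarith
  unfold cutSq'
  nlinarith [sq_nonneg (Real.log (max z 1) - 2)]

/-- Jumps of the gradient of the renormalised entropy. -/
lemma abs_renorm_jump_le {κ cv M L : ℝ} (hκ : 0 < κ) (hcv : 0 < cv) (hL : 1 ≤ L) (hM : 1 ≤ M)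
    {xa xb Ra Rb dl : ℝ} (hz : xb - xa = (κ * (Rb - Ra) - cv * dl) / M) (hRa : |Ra| ≤ L)
    (hRb : |Rb| ≤ L) (hxa : Real.log (max xa 1) ≤ L) (hxb : Real.log (max xb 1) ≤ L) :
    |(M / κ * (cutSq xb - xb * cutSq' xb) + cutLog xb + Rb * cutExc xb)
        - (M / κ * (cutSq xa - xa * cutSq' xa) + cutLog xa + Ra * cutExc xa)|
      + |(1 / κ * cutSq' xb + Rb * cutLog' xb / M) - (1 / κ * cutSq' xa + Ra * cutLog' xa / M)|
      ≤ (cv / κ + 5 * (κ + cv) + (κ + cv) / κ + 1) * L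
        * (|dl| + |Rb - Ra| / (M * max 1 (min xa xb))) := by
  set μ := max 1 (min xa xb) with hμ
  have hμ1 : 1 ≤ μ := le_max_left _ _
  set U := |dl| + |Rb - Ra| / (M * μ) with hU
  have hM0 : 0 < M := by linarith
  have hμ0 : 0 < μ := by linarith
  have hMμ : 1 ≤ M * μ := one_le_mul_of_one_le_of_one_le hM hμ1
  have hL0 : 0 < L := by linarith
  have hU0 : 0 ≤ U := by positivity
  have hUl : |dl| ≤ U := le_add_of_nonneg_right (by positivity)
  have hUR : |Rb - Ra| / (M * μ) ≤ U := le_add_of_nonneg_left (abs_nonneg _)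
  have hD : |xb - xa| / μ ≤ (κ + cv) * U := by
    rw [hz, abs_div, abs_of_pos hM0, div_div]
    have h1 : |κ * (Rb - Ra) - cv * dl| ≤ κ * |Rb - Ra| + cv * |dl| := by
      refine (abs_sub _ _).trans_eq ?_
      rw [abs_mul, abs_mul, abs_of_pos hκ, abs_of_pos hcv]
    calc _ ≤ (κ * |Rb - Ra| + cv * |dl|) / (M * μ) := by gcongr
      _ = κ * (|Rb - Ra| / (M * μ)) + cv * (|dl| / (M * μ)) := by ring
      _ ≤ κ * U + cv * U := by
        have : |dl| / (M * μ) ≤ U := (div_le_self (abs_nonneg _) hMμ).trans hUl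
        gcongr
      _ = _ := by ring
  -- The Legendre part of the large profile has derivative `-cutExc`, so one intermediate point `ξ`
  -- expresses its jump through the jumps of `log ρ` and `log T`.
  obtain ⟨ξ, h1, h2, h3, h4⟩ := exists_mean_value hasDerivAt_cutSq_legendre xa xb
  have hξ : Real.log (max ξ 1) ≤ L := by
    have : max ξ 1 ≤ max (max xa xb) 1 := max_le_max_right 1 h3
    refine (Real.log_le_log (by have : (1 : ℝ) ≤ max ξ 1 := le_max_right _ _
                                linarith) this).trans ?_
    rcases le_total xa xb with h | h
    · rwa [max_eq_right h]
    · rwa [max_eq_left h]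
  have he : |cutExc xa - cutExc ξ| ≤ (κ + cv) * U := by
    rw [abs_sub_comm]
    refine (abs_cutExc_sub_le xa ξ).trans (le_trans ?_ hD)
    refine div_le_div₀ (abs_nonneg _) h1 hμ0 ?_
    exact max_le_max_left 1 (le_min (min_le_left _ _) h2)
  have hdR : |Rb - Ra| ≤ 2 * L := (abs_sub _ _).trans (by linarith)
  have hKU : 0 ≤ (κ + cv) * U := by positivity
  have hκi : 0 ≤ 1 / κ := by positivity
  -- The decisive cancellation: the profile contributes `-cutExc ξ (Rb - Ra)` and the term with `R`
  -- contributes `cutExc xa (Rb - Ra)`. Only the difference of the two values remains, which is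
  -- small where `R` jumps little compared with `M μ`.
  have hA : (M / κ * (cutSq xb - xb * cutSq' xb) + cutLog xb + Rb * cutExc xb)
        - (M / κ * (cutSq xa - xa * cutSq' xa) + cutLog xa + Ra * cutExc xa)
      = cv / κ * cutExc ξ * dl + (cutExc xa - cutExc ξ) * (Rb - Ra) + (cutLog xb - cutLog xa)
        + Rb * (cutExc xb - cutExc xa) := by
    have : M / κ * (cutSq xb - xb * cutSq' xb) - M / κ * (cutSq xa - xa * cutSq' xa)
        = -(cutExc ξ / κ) * (κ * (Rb - Ra) - cv * dl) := by
      rw [← mul_sub, h4, hz]; field_simp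
    field_simp at this ⊢
    linear_combination this
  have hB : (1 / κ * cutSq' xb + Rb * cutLog' xb / M) - (1 / κ * cutSq' xa + Ra * cutLog' xa / M)
      = 1 / κ * (cutSq' xb - cutSq' xa) + Rb * (cutLog' xb - cutLog' xa) / M
        + cutLog' xa * (Rb - Ra) / M := by ring
  have b1 : |cv / κ * cutExc ξ * dl| ≤ cv / κ * L * U := by
    rw [abs_mul, abs_mul, abs_of_pos (by positivity : 0 < cv / κ)]
    have := abs_cutExc_le hL hξ
    gcongr
  have b2 : |(cutExc xa - cutExc ξ) * (Rb - Ra)| ≤ (κ + cv) * U * (2 * L) := by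
    rw [abs_mul]; gcongr
  have b3 : |cutLog xb - cutLog xa| ≤ (κ + cv) * U * L :=
    ((abs_cutLog_sub_le xa xb).trans hD).trans (le_mul_of_one_le_right hKU hL)
  have b4 : |Rb * (cutExc xb - cutExc xa)| ≤ L * ((κ + cv) * U) := by
    rw [abs_mul]
    have := (abs_cutExc_sub_le xa xb).trans hD
    gcongr
  have b5 : |1 / κ * (cutSq' xb - cutSq' xa)| ≤ 1 / κ * (L * ((κ + cv) * U)) := by
    rw [abs_mul, abs_of_nonneg hκi]
    have := (abs_cutSq'_sub_le_mul hL hxa hxb).trans (mul_le_mul_of_nonneg_left hD hL0.le)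
    gcongr
  have b6 : |Rb * (cutLog' xb - cutLog' xa) / M| ≤ L * ((κ + cv) * U) := by
    rw [abs_div, abs_of_pos hM0, abs_mul]
    have := (abs_cutLog'_sub_le xa xb).trans hD
    refine (div_le_self (by positivity) hM).trans ?_
    gcongr
  have b7 : |cutLog' xa * (Rb - Ra) / M| ≤ L * U := by
    rw [abs_div, abs_of_pos hM0, abs_mul, abs_of_nonneg (cutLog'_nonneg xa)]
    have h5 : cutLog' xa ≤ 1 / μ := (cutLog'_le xa).trans (by
      refine one_div_le_one_div_of_le hμ0 ?_
      rw [max_comm]; exact max_le_max_left 1 (min_le_left _ _))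
    calc _ ≤ 1 / μ * |Rb - Ra| / M := by gcongr
      _ = |Rb - Ra| / (M * μ) := by field_simp
      _ ≤ U := hUR
      _ ≤ _ := le_mul_of_one_le_left hU0 hL
  rw [hA, hB]
  have t1 := abs_add_three (cv / κ * cutExc ξ * dl + (cutExc xa - cutExc ξ) * (Rb - Ra))
    (cutLog xb - cutLog xa) (Rb * (cutExc xb - cutExc xa))
  have t2 := abs_add_le (cv / κ * cutExc ξ * dl) ((cutExc xa - cutExc ξ) * (Rb - Ra))
  have t3 := abs_add_three (1 / κ * (cutSq' xb - cutSq' xa))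
    (Rb * (cutLog' xb - cutLog' xa) / M) (cutLog' xa * (Rb - Ra) / M)
  have e : (cv / κ + 5 * (κ + cv) + (κ + cv) / κ + 1) * L * U
      = cv / κ * L * U + (κ + cv) * U * (2 * L) + (κ + cv) * U * L + L * ((κ + cv) * U)
        + 1 / κ * (L * ((κ + cv) * U)) + L * ((κ + cv) * U) + L * U := by ring
  rw [e]
  linarith

/-! ## The renormalised entropy -/

/-- The rescaled negative specific entropy. -/
def zet (M : ℝ) (q : State d) : ℝ := -spec q / M

/-- The renormalised entropy, a function of density and entropy that vanishes where `-s ≤ M`. -/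
def renorm (γ cv M : ℝ) (q : State d) : ℝ :=
  rho q * (M / (cv * (γ - 1)) * cutSq (zet M q) + logRho q * cutLog (zet M q))

/-- The density derivative of `renorm`. -/
def renormRho (γ cv M : ℝ) (q : State d) : ℝ :=
  M / (cv * (γ - 1)) * (cutSq (zet M q) - zet M q * cutSq' (zet M q)) + cutLog (zet M q)
    + logRho q * cutExc (zet M q)

/-- Minus the entropy derivative of `renorm`. -/
def renormEnt (γ cv M : ℝ) (q : State d) : ℝ :=
  1 / (cv * (γ - 1)) * cutSq' (zet M q) + logRho q * cutLog' (zet M q) / M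

/-- The gradient of `renorm`. -/
def renormGrad (γ cv M : ℝ) (q : State d) : State d := (renormRho γ cv M q, 0, -renormEnt γ cv M q)

lemma dot_renormGrad (M : ℝ) (x q : State d) :
    dot x (renormGrad γ cv M q) = rho x * renormRho γ cv M q - ent x * renormEnt γ cv M q := by
  simp [dot, renormGrad, rho, ent]; ring

lemma dot_renormGrad_sub (M : ℝ) (x a b : State d) :
    dot x (renormGrad γ cv M b - renormGrad γ cv M a)
      = rho x * (renormRho γ cv M b - renormRho γ cv M a)
        - ent x * (renormEnt γ cv M b - renormEnt γ cv M a) := by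
  rw [dot_sub_right, dot_renormGrad, dot_renormGrad]; ring

lemma _root_.HasDerivAt.state_renorm (hγ : 1 < γ) (hcv : 0 < cv) {M : ℝ} (hM : 0 < M)
    {x : ℝ → State d} {x' : State d} {t : ℝ} (h : HasDerivAt x x' t) (hx : 0 < rho (x t)) :
    HasDerivAt (fun t => renorm γ cv M (x t)) (dot (renormGrad γ cv M (x t)) x') t := by
  have hκ : γ - 1 ≠ 0 := by linarith
  have hz : HasDerivAt (fun t => zet M (x t)) (-((ent x' - spec (x t) * rho x') / rho (x t)) / M) t :=
    (h.state_spec hx).neg.div_const M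
  have h1 := (hasDerivAt_cutSq (zet M (x t))).comp t hz
  have h2 := (hasDerivAt_cutLog (zet M (x t))).comp t hz
  refine (h.state_rho.mul ((h1.const_mul (M / (cv * (γ - 1)))).add
    ((h.state_logRho hx).mul h2))).congr_deriv ?_
  rw [dot_comm, dot_renormGrad, renormRho, renormEnt, cutExc_eq]
  have hs : spec (x t) = - (M * zet M (x t)) := by unfold zet; field_simp
  simp only [hs, Function.comp_apply, Pi.add_apply, Pi.mul_apply]
  field_simp
  ring

/-- Functions `ρ f(s)` are homogeneous of degree one and contribute nothing; only the factor `log ρ`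
does. The right-hand side acts as the pressure of the renormalised entropy and will multiply
velocity jumps. -/
lemma renorm_legendre (M : ℝ) (hM : 0 < M) {q : State d} (hq : 0 < rho q) :
    rho q * renormRho γ cv M q - ent q * renormEnt γ cv M q - renorm γ cv M q
      = rho q * cutLog (zet M q) := by
  have hs : ent q = - (rho q * (M * zet M q)) := by
    rw [ent_eq hq]; unfold zet; field_simp
  rw [hs, renormRho, renormEnt, renorm, cutExc_eq]
  field_simp
  ring

/-- Bounds on the logarithms of the state, with a small temperature where the renormalised entropy
does not vanish. -/
structure Tame (γ cv L M h : ℝ) (q : State d) : Prop where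
  log_le : |logRho q| ≤ L
  neg_spec_le : -spec q ≤ Real.exp L
  cold : M ≤ -spec q → temperature γ cv q ≤ h ^ 2

lemma Tame.log_max_le {L M h : ℝ} (hL : 1 ≤ L) (hM : 1 ≤ M) {q : State d}
    (hq : Tame γ cv L M h q) : Real.log (max (zet M q) 1) ≤ L := by
  have h1 : (1 : ℝ) ≤ max (zet M q) 1 := le_max_right _ _
  rw [Real.log_le_iff_le_exp (by linarith)]
  refine max_le ?_ (by linarith [Real.add_one_le_exp L])
  unfold zet
  rw [div_le_iff₀ (by linarith)]
  exact hq.neg_spec_le.trans (le_mul_of_one_le_right (Real.exp_pos L).le hM)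

lemma zet_sub (hγ : 1 < γ) (hcv : 0 < cv) (M : ℝ) {a b : State d} (ha : 0 < rho a)
    (hb : 0 < rho b) : zet M b - zet M a
      = (cv * (γ - 1) * (logRho b - logRho a) - cv * (logTemp γ cv b - logTemp γ cv a)) / M := by
  unfold zet
  rw [spec_eq hγ hcv ha, spec_eq hγ hcv hb]; ring

/-- The jump of `log ρ` enters only with the small weight that `log_jump_le_dual_jump` can afford.
-/
lemma renormGrad_jump_le (hγ : 1 < γ) (hcv : 0 < cv) : ∃ C, 0 ≤ C ∧ ∀ {L M h : ℝ}, 1 ≤ L → 1 ≤ M →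
    ∀ {a b : State d}, 0 < rho a → 0 < rho b → Tame γ cv L M h a → Tame γ cv L M h b →
      |renormRho γ cv M b - renormRho γ cv M a| + |renormEnt γ cv M b - renormEnt γ cv M a|
        ≤ C * L * (|logTemp γ cv b - logTemp γ cv a|
          + |logRho b - logRho a| / (M * max 1 (min (zet M a) (zet M b)))) := by
  have hκ : 0 < cv * (γ - 1) := mul_pos hcv (by linarith)
  refine ⟨cv / (cv * (γ - 1)) + 5 * (cv * (γ - 1) + cv) + (cv * (γ - 1) + cv) / (cv * (γ - 1)) + 1,
    by positivity, fun {_ _ _} hL hM {_ _} ha hb ta tb => abs_renorm_jump_le hκ hcv hL hM (zet_sub hγ hcv _ ha hb)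
    ta.log_le tb.log_le (ta.log_max_le hL hM) (tb.log_max_le hL hM)⟩

lemma abs_fst_le_len (a : State d) : |a.1| ≤ len a := by
  refine Real.abs_le_sqrt ?_
  have := Finset.sum_nonneg (s := Finset.univ) fun i _ => mul_self_nonneg (a.2.1 i)
  have := mul_self_nonneg a.2.2
  unfold dot; nlinarith

lemma abs_mom_le_len (a : State d) (i : Fin d) : |a.2.1 i| ≤ len a := by
  refine Real.abs_le_sqrt ?_
  have := Finset.single_le_sum (f := fun i => a.2.1 i * a.2.1 i)
    (fun i _ => mul_self_nonneg (a.2.1 i)) (Finset.mem_univ i)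
  have := mul_self_nonneg a.2.2
  have := mul_self_nonneg a.1
  unfold dot; linarith

lemma abs_snd_le_len (a : State d) : |a.2.2| ≤ len a := by
  refine Real.abs_le_sqrt ?_
  have := Finset.sum_nonneg (s := Finset.univ) fun i _ => mul_self_nonneg (a.2.1 i)
  have := mul_self_nonneg a.1
  unfold dot; nlinarith

/-- Comparisons between logarithmic and arithmetic means, for use with two temperatures whose ratio
is not bounded. -/
lemma log_jump_bounds {x y : ℝ} (hx : 0 < x) (hy : 0 < y) :
    |Real.log y - Real.log x| ≤ |y - x| * (1 / x + 1 / y) ∧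
    (x + y) / 2 * |Real.log y - Real.log x| ≤ |y - x| * (1 + |Real.log y - Real.log x| / 2) ∧
    1 + |Real.log y - Real.log x| ≤ 2 * (1 / x + 1 / y) * ((x + y) / 2) := by
  have key : ∀ x y : ℝ, 0 < x → x ≤ y → 
      |Real.log y - Real.log x| ≤ |y - x| * (1 / x + 1 / y) ∧
      (x + y) / 2 * |Real.log y - Real.log x| ≤ |y - x| * (1 + |Real.log y - Real.log x| / 2) ∧
      1 + |Real.log y - Real.log x| ≤ 2 * (1 / x + 1 / y) * ((x + y) / 2) := by
    intro x y hx hxy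
    have hy : 0 < y := hx.trans_le hxy
    have h1 : 0 ≤ Real.log y - Real.log x := sub_nonneg.2 (Real.log_le_log hx hxy)
    have h2 : Real.log y - Real.log x ≤ (y - x) / x := by
      rw [← Real.log_div hy.ne' hx.ne', sub_div, div_self hx.ne']
      exact Real.log_le_sub_one_of_pos (by positivity)
    have h3 : x * (Real.log y - Real.log x) ≤ y - x := by
      rwa [le_div_iff₀ hx, mul_comm] at h2
    rw [abs_of_nonneg h1, abs_of_nonneg (sub_nonneg.2 hxy)]
    refine ⟨h2.trans ?_, by nlinarith, ?_⟩
    · rw [div_eq_mul_one_div]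
      refine mul_le_mul_of_nonneg_left ?_ (sub_nonneg.2 hxy)
      have : 0 < 1 / y := by positivity
      linarith
    · have e1 : 2 * (1 / x + 1 / y) * ((x + y) / 2) = 1 + ((y - x) / x + 1) + (x + y) / y := by
        field_simp; ring
      have e2 : 0 < (x + y) / y := by positivity
      rw [e1]; linarith
  rcases le_total x y with h | h
  · exact key x y hx h
  · rw [abs_sub_comm, abs_sub_comm y, add_comm (1 / x), add_comm x]
    exact key y x hy h

/-- The jump of `T` is a component of `[[p]]` and controls that of `log T`. The jump of `log ρ` must
be recovered from the Gibbs energy `(γ c_v - s) T`, which costs a factor of the size of `|s|`; the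
weight `1/(M max(1, z))` absorbs it. -/
lemma log_jump_le_dual_jump (hγ : 1 < γ) (hcv : 0 < cv) (B : ℝ) :
    ∃ C, 0 ≤ C ∧ ∀ {L M h : ℝ}, 1 ≤ L → L ≤ M → ∀ {a b : State d}, Bounded γ cv B a →
      Bounded γ cv B b → Tame γ cv L M h a → Tame γ cv L M h b →
      |logTemp γ cv b - logTemp γ cv a|
          + |logRho b - logRho a| / (M * max 1 (min (zet M a) (zet M b)))
        ≤ C * (len (dual γ cv b - dual γ cv a)
          * (1 / temperature γ cv a + 1 / temperature γ cv b)) := by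
  set κ := cv * (γ - 1) with hκdef
  have hκ : 0 < κ := mul_pos hcv (by linarith)
  have hB0 : 0 ≤ |B| := abs_nonneg B
  set C2 := γ * cv + (|B| + 1 + 2 * κ) + cv + cv with hC2
  have hC20 : 0 ≤ C2 := by positivity
  refine ⟨1 + 1 / κ * (2 * (1 + d * |B|) + 2 * C2), by positivity,
    fun {L M h} hL hLM {a b} ba bb ta tb => ?_⟩
  have ra := ba.pos
  have rb := bb.pos
  have θa := temperature_pos hγ hcv ra
  have θb := temperature_pos hγ hcv rb
  obtain ⟨k1, k2, k3⟩ := log_jump_bounds θa θb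
  change |logTemp γ cv b - logTemp γ cv a| ≤ _ at k1
  change _ * |logTemp γ cv b - logTemp γ cv a| ≤ _ * (1 + |logTemp γ cv b - logTemp γ cv a| / 2) at k2
  change 1 + |logTemp γ cv b - logTemp γ cv a| ≤ _ at k3
  set w := 1 / temperature γ cv a + 1 / temperature γ cv b with hw
  have hw0 : 0 < w := by positivity
  set avg := (temperature γ cv a + temperature γ cv b) / 2 with havg
  have havg0 : 0 < avg := by positivity
  set t := |logTemp γ cv b - logTemp γ cv a| with ht
  have ht0 : 0 ≤ t := abs_nonneg _
  set P := len (dual γ cv b - dual γ cv a) with hP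
  have hP0 : 0 ≤ P := len_nonneg _
  have hM : 1 ≤ M := hL.trans hLM
  set m := M * max 1 (min (zet M a) (zet M b)) with hm
  have hmM : M ≤ m := le_mul_of_one_le_right (by linarith) (le_max_left _ _)
  have hm1 : 1 ≤ m := hM.trans hmM
  have e := dual_eq hγ hcv ra
  have e' := dual_eq hγ hcv rb
  have hD : |temperature γ cv b - temperature γ cv a| ≤ P := by
    have := abs_snd_le_len (dual γ cv b - dual γ cv a)
    rw [e, e'] at this; rw [hP, e, e']; exact this
  have hv : ∀ i, |vel b i - vel a i| ≤ P := fun i => by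
    have := abs_mom_le_len (dual γ cv b - dual γ cv a) i
    rw [e, e'] at this; rw [hP, e, e']; exact this
  have hg0 : |gibbs γ cv b - velSq b / 2 - (gibbs γ cv a - velSq a / 2)| ≤ P := by
    have := abs_fst_le_len (dual γ cv b - dual γ cv a)
    rw [e, e'] at this; rw [hP, e, e']; exact this
  have hvs : |velSq b - velSq a| / 2 ≤ d * |B| * P := by
    have : |velSq b - velSq a| ≤ ∑ _i : Fin d, 2 * |B| * P := by
      unfold velSq
      rw [← Finset.sum_sub_distrib]
      refine (Finset.abs_sum_le_sum_abs _ _).trans (Finset.sum_le_sum fun i _ => ?_)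
      rw [sq_sub_sq, abs_mul]
      have h1 : |vel b i + vel a i| ≤ 2 * |B| :=
        (abs_add_le _ _).trans (by linarith [ba.vel_le i, bb.vel_le i, le_abs_self B])
      have := hv i
      gcongr
    rw [Finset.sum_const, Finset.card_univ, Fintype.card_fin, nsmul_eq_mul] at this
    linarith
  have hg : |gibbs γ cv b - gibbs γ cv a| ≤ (1 + d * |B|) * P := by
    have : gibbs γ cv b - gibbs γ cv a
        = (gibbs γ cv b - velSq b / 2 - (gibbs γ cv a - velSq a / 2))
          + (velSq b - velSq a) / 2 := by ring
    rw [this]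
    refine (abs_add_le _ _).trans ?_
    rw [abs_div, abs_of_pos (by norm_num : (0 : ℝ) < 2)]
    linarith
  -- The smaller of the two values `-s` is at most `m`. The other differs by a jump of `s`, whose
  -- density part is at most a multiple of `L ≤ M ≤ m`, and whose temperature part is kept as `t`.
  have hs : |(spec a + spec b) / 2| ≤ (|B| + 1 + 2 * κ) * m + cv * t := by
    have hδ : |spec b - spec a| ≤ cv * t + κ * (2 * L) := by
      have : spec b - spec a = cv * (logTemp γ cv b - logTemp γ cv a)
          - κ * (logRho b - logRho a) := by
        rw [spec_eq hγ hcv ra, spec_eq hγ hcv rb, hκdef]; ring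
      rw [this]
      refine (abs_sub _ _).trans ?_
      rw [abs_mul, abs_mul, abs_of_pos hcv, abs_of_pos hκ]
      have : |logRho b - logRho a| ≤ 2 * L := (abs_sub _ _).trans (by linarith [ta.log_le, tb.log_le])
      gcongr
    have hmin : min (-spec a) (-spec b) ≤ m := by
      have hM0 : 0 < M := by linarith
      have h1 : min (-spec a) (-spec b) = M * min (zet M a) (zet M b) := by
        unfold zet
        rw [mul_min_of_nonneg _ _ hM0.le]
        congr 1 <;> field_simp
      rw [h1]
      exact mul_le_mul_of_nonneg_left (le_max_right _ _) hM0.le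
    have hδ' := abs_le.1 hδ
    have hLm : κ * (2 * L) ≤ 2 * κ * m := by nlinarith
    have hBm : |B| ≤ |B| * m := le_mul_of_one_le_right hB0 hm1
    have hsa := ba.spec_le.trans (le_abs_self B)
    have hsb := bb.spec_le.trans (le_abs_self B)
    have hcvt : 0 ≤ cv * t := by positivity
    have hkm : 0 ≤ κ * m := by positivity
    rw [abs_le]
    constructor
    · rcases min_le_iff.1 hmin with h | h
      · linarith
      · linarith
    · linarith
  -- Product rule for the jump of the Gibbs energy, with arithmetic means and solved for the jump of
  -- `log ρ`; it is exact.
  have hR : κ * avg * (logRho b - logRho a) = (gibbs γ cv b - gibbs γ cv a)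
      - (γ * cv - (spec a + spec b) / 2) * (temperature γ cv b - temperature γ cv a)
      + cv * (avg * (logTemp γ cv b - logTemp γ cv a)) := by
    have h1 := spec_eq hγ hcv ra
    have h2 := spec_eq hγ hcv rb
    unfold gibbs
    rw [havg, hκdef]
    linear_combination ((temperature γ cv a + temperature γ cv b) / 2) * h2
      - ((temperature γ cv a + temperature γ cv b) / 2) * h1
  have hR' : κ * avg * |logRho b - logRho a| ≤ (1 + d * |B|) * P + C2 * m * (1 + t) * P := by
    have h1 : κ * avg * |logRho b - logRho a| = |κ * avg * (logRho b - logRho a)| := by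
      rw [abs_mul, abs_of_pos (by positivity : 0 < κ * avg)]
    rw [h1, hR]
    have h2 : |(γ * cv - (spec a + spec b) / 2) * (temperature γ cv b - temperature γ cv a)|
        ≤ (γ * cv + ((|B| + 1 + 2 * κ) * m + cv * t)) * P := by
      rw [abs_mul]
      refine mul_le_mul ?_ hD (abs_nonneg _) (by positivity)
      refine (abs_sub _ _).trans ?_
      rw [abs_of_pos (by positivity : 0 < γ * cv)]
      linarith
    have h3 : |cv * (avg * (logTemp γ cv b - logTemp γ cv a))| ≤ cv * (P * (1 + t / 2)) := by
      rw [abs_mul, abs_mul, abs_of_pos hcv, abs_of_pos havg0]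
      refine mul_le_mul_of_nonneg_left (k2.trans ?_) hcv.le
      exact mul_le_mul_of_nonneg_right hD (by positivity)
    have h4 : (γ * cv + ((|B| + 1 + 2 * κ) * m + cv * t)) + cv * (1 + t / 2)
        ≤ C2 * m * (1 + t) := by
      have g1 : γ * cv ≤ γ * cv * (m * (1 + t)) :=
        le_mul_of_one_le_right (by positivity)
          (one_le_mul_of_one_le_of_one_le hm1 (by linarith))
      have g2 : (|B| + 1 + 2 * κ) * m ≤ (|B| + 1 + 2 * κ) * (m * (1 + t)) := by
        gcongr; exact le_mul_of_one_le_right (by linarith) (by linarith)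
      have g3 : cv * (t + 1) ≤ cv * (m * (1 + t)) := by
        gcongr; rw [add_comm]; exact le_mul_of_one_le_left (by linarith) hm1
      have g4 : 0 ≤ cv * t := by positivity
      rw [hC2]; linarith
    have h5 := mul_le_mul_of_nonneg_right h4 hP0
    refine (abs_add_le _ _).trans ((add_le_add_left (abs_sub _ _) _).trans ?_)
    linarith
  have hR'' : |logRho b - logRho a| / m ≤ 1 / κ * (2 * (1 + d * |B|) + 2 * C2) * (P * w) := by
    rw [div_le_iff₀ (by linarith)]
    have h1 : κ * avg * |logRho b - logRho a|
        ≤ κ * avg * (1 / κ * (2 * (1 + d * |B|) + 2 * C2) * (P * w) * m) := by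
      refine hR'.trans ?_
      have h2 : (1 + d * |B|) * P * (1 + t) * m ≤ (1 + d * |B|) * P * (2 * w * avg) * m := by
        gcongr
      have h3 : (1 + d * |B|) * P ≤ (1 + d * |B|) * P * ((1 + t) * m) :=
        le_mul_of_one_le_right (by positivity)
          (one_le_mul_of_one_le_of_one_le (by linarith) hm1)
      have h4 : C2 * m * (1 + t) * P ≤ C2 * m * (2 * w * avg) * P := by gcongr
      have e1 : κ * avg * (1 / κ * (2 * (1 + d * |B|) + 2 * C2) * (P * w) * m)
          = (1 + d * |B|) * P * (2 * w * avg) * m + C2 * m * (2 * w * avg) * P := by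
        field_simp
      rw [e1]; linarith
    exact le_of_mul_le_mul_left h1 (by positivity)
  have hk1 : t ≤ P * w := k1.trans (mul_le_mul_of_nonneg_right hD hw0.le)
  calc _ ≤ P * w + 1 / κ * (2 * (1 + d * |B|) + 2 * C2) * (P * w) := add_le_add hk1 hR''
    _ = _ := by ring

/-- The two preceding estimates give `|[[∇η]]| ≤ C L |[[p]]| (1/T_a + 1/T_b)`. The pairing with
`[[p]]` is then quadratic in `[[p]]`, which cancels the denominator of `α`, and the weights turn `λ
[[p]]·[[q]]` into the production. -/
lemma alpha_renorm_le (hγ : 1 < γ) (hcv : 0 < cv) (B : ℝ) :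
    ∃ C, 0 ≤ C ∧ ∀ {L M h : ℝ}, 1 ≤ L → L ≤ M → ∀ {a b : State d}, Bounded γ cv B a →
      Bounded γ cv B b → Tame γ cv L M h a → Tame γ cv L M h b → ∀ s : Fin d,
      |alpha γ cv s a b * dot (dual γ cv b - dual γ cv a)
        (renormGrad γ cv M b - renormGrad γ cv M a)| ≤ C * L * prod γ cv s a b := by
  obtain ⟨C1, hC1, h1⟩ := renormGrad_jump_le (d := d) hγ hcv
  obtain ⟨C2, hC2, h2⟩ := log_jump_le_dual_jump (d := d) hγ hcv B
  refine ⟨2 * (C1 * C2), by positivity, fun {L M h} hL hLM {a b} ba bb ta tb s => ?_⟩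
  have k1 := h1 hL (hL.trans hLM) ba.pos bb.pos ta tb
  have k2 := h2 hL hLM ba bb ta tb
  have θa := temperature_pos hγ hcv ba.pos
  have θb := temperature_pos hγ hcv bb.pos
  set w := 1 / temperature γ cv a + 1 / temperature γ cv b with hw
  have hw0 : 0 < w := by positivity
  have hP0 := len_nonneg (dual γ cv b - dual γ cv a)
  have hL0 : 0 < L := by linarith
  have key := abs_alpha_mul_dot_le hγ hcv ba.pos bb.pos s
    (w := renormGrad γ cv M b - renormGrad γ cv M a) (k := C1 * L * (C2 * w)) (by positivity) (by
      rw [dot_renormGrad_sub, ← len_mul_self]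
      have g1 := abs_fst_le_len (dual γ cv b - dual γ cv a)
      have g2 := abs_snd_le_len (dual γ cv b - dual γ cv a)
      set δ := dual γ cv b - dual γ cv a
      calc _ ≤ |rho δ| * |renormRho γ cv M b - renormRho γ cv M a|
            + |ent δ| * |renormEnt γ cv M b - renormEnt γ cv M a| := by
            rw [← abs_mul, ← abs_mul]; exact abs_sub _ _
        _ ≤ len δ * |renormRho γ cv M b - renormRho γ cv M a|
            + len δ * |renormEnt γ cv M b - renormEnt γ cv M a| :=
            add_le_add (mul_le_mul_of_nonneg_right g1 (abs_nonneg _))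
              (mul_le_mul_of_nonneg_right g2 (abs_nonneg _))
        _ ≤ len δ * (C1 * L * (C2 * (len δ * w))) := by
            rw [← mul_add]
            exact mul_le_mul_of_nonneg_left
              (k1.trans (mul_le_mul_of_nonneg_left k2 (by positivity))) hP0
        _ = _ := by ring)
  refine key.trans_eq ?_
  unfold prod
  rw [← hw]
  ring

/-- Taylor defect of the renormalised entropy. -/
def renormDefect (γ cv M : ℝ) (a b : State d) : ℝ :=
  renorm γ cv M b - renorm γ cv M a - dot (b - a) (renormGrad γ cv M a)

lemma density_log_jump {a b : State d} (ha : 0 < rho a) (hb : 0 < rho b) :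
    0 ≤ (rho b - rho a) * (logRho b - logRho a) ∧
    (rho a + rho b) * (logRho b - logRho a) ^ 2
      ≤ 2 * ((1 + |logRho b - logRho a|) * ((rho b - rho a) * (logRho b - logRho a))) ∧
    |rho b * (logRho b - logRho a) - (rho b - rho a)|
      ≤ (rho b - rho a) * (logRho b - logRho a) := by
  have h1 := density_defect_nonneg ha hb
  have h2 := density_defect_nonneg hb ha
  have key : ∀ {a b : State d}, 0 < rho a → 0 < rho b → rho a ≤ rho b →
      (rho a + rho b) * (logRho b - logRho a) ^ 2
      ≤ 2 * ((1 + |logRho b - logRho a|) * ((rho b - rho a) * (logRho b - logRho a))) := by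
    intro a b ha hb hab
    have h0 : 0 ≤ logRho b - logRho a := sub_nonneg.2 (Real.log_le_log ha hab)
    have h1 := density_defect_nonneg ha hb
    rw [abs_of_nonneg h0]
    set t := logRho b - logRho a with ht
    have h2 : rho b * t ≤ (1 + t) * (rho b - rho a) := by
      have : logRho a - logRho b = -t := by ring
      rw [this] at h1; linarith
    have h3 := mul_le_mul_of_nonneg_right h2 h0
    have h4 : rho a * (t * t) ≤ rho b * (t * t) :=
      mul_le_mul_of_nonneg_right hab (mul_self_nonneg t)
    nlinarith
  refine ⟨by linarith, ?_, ?_⟩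
  · rcases le_total (rho a) (rho b) with h | h
    · exact key ha hb h
    · have := key hb ha h
      rw [abs_sub_comm (logRho b)]
      linarith
  · rw [abs_le]; constructor <;> linarith

/-- With `S = -ρ M z` the terms of first order disappear: what remains are the Taylor remainders of
the two profiles in `z`, that of `ρ log ρ`, and one mixed product of jumps. -/
lemma renormDefect_eq {M : ℝ} (hM : 0 < M) {a b : State d}
    (ha : 0 < rho a) (hb : 0 < rho b) :
    renormDefect γ cv M a b
      = rho b * (M / (cv * (γ - 1))) * (cutSq (zet M b) - cutSq (zet M a)
          - cutSq' (zet M a) * (zet M b - zet M a))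
        + rho b * logRho a * (cutLog (zet M b) - cutLog (zet M a)
          - cutLog' (zet M a) * (zet M b - zet M a))
        + cutLog (zet M a) * (rho b * (logRho b - logRho a) - (rho b - rho a))
        + rho b * (cutLog (zet M b) - cutLog (zet M a)) * (logRho b - logRho a) := by
  have hs : ∀ {q : State d}, 0 < rho q → ent q = - (rho q * (M * zet M q)) := by
    intro q hq
    rw [ent_eq hq]; unfold zet; field_simp
  have e1 : rho (b - a) = rho b - rho a := rfl
  have e2 : ent (b - a) = ent b - ent a := rfl
  rw [renormDefect, dot_renormGrad, e1, e2, hs ha, hs hb, renormRho, renormEnt, renorm, renorm,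
    cutExc_eq]
  field_simp
  ring

/-- All contributions are quadratic in the jumps of `log ρ` and `log T` and thus controlled by
production. Passing from `[[ρ]][[log ρ]]` to `ρ [[log ρ]]²` costs a factor `L`; a possibly large
`log ρ` in front is compensated by the `1/M²` in the square of `[[z]]`, because `L ≤ M`. -/
lemma abs_renormDefect_le (hγ : 1 < γ) (hcv : 0 < cv) :
    ∃ C, 0 ≤ C ∧ ∀ {L M h : ℝ}, 1 ≤ L → L ≤ M → ∀ {a b : State d}, 0 < rho a → 0 < rho b →
      Tame γ cv L M h a → Tame γ cv L M h b → ∀ s : Fin d,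
      lam γ cv s a b * |renormDefect γ cv M a b| ≤ C * L * prod γ cv s a b := by
  obtain ⟨κ, hκdef⟩ : ∃ κ, κ = cv * (γ - 1) := ⟨_, rfl⟩
  have hκ : 0 < κ := hκdef ▸ mul_pos hcv (by linarith)
  set C1 := (1 / κ + 1) * (12 * κ ^ 2) + 1 + 6 * (cv + 2 * κ) with hC1
  set C2 := (1 / κ + 1) * (2 * cv ^ 2) + cv with hC2
  have hC10 : 0 ≤ C1 := by positivity
  have hC20 : 0 ≤ C2 := by positivity
  refine ⟨C1 / κ + C2 * 2 / cv, by positivity, fun {L M h} hL hLM {a b} ra rb ta tb s => ?_⟩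
  have hM : 1 ≤ M := hL.trans hLM
  have hM0 : 0 < M := by linarith
  have hL0 : 0 < L := by linarith
  obtain ⟨g0, g1, g2⟩ := density_log_jump ra rb
  set X := (rho b - rho a) * (logRho b - logRho a) with hX
  set δR := logRho b - logRho a with hδR
  set δl := logTemp γ cv b - logTemp γ cv a with hδl
  set Y := (rho a + rho b) * δl ^ 2 with hY
  have hY0 : 0 ≤ Y := by positivity
  have hdR : |δR| ≤ 2 * L := (abs_sub _ _).trans (by linarith [ta.log_le, tb.log_le])
  have g3 : rho b * δR ^ 2 ≤ 6 * L * X := by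
    have h1 : rho b * δR ^ 2 ≤ (rho a + rho b) * δR ^ 2 :=
      mul_le_mul_of_nonneg_right (by linarith) (sq_nonneg _)
    have h2 : (1 + |δR|) * X ≤ 3 * L * X := mul_le_mul_of_nonneg_right (by linarith) g0
    linarith
  have g4 : rho b * δl ^ 2 ≤ Y := mul_le_mul_of_nonneg_right (by linarith) (sq_nonneg _)
  have hz : zet M b - zet M a = (κ * δR - cv * δl) / M := by
    rw [hκdef]; exact zet_sub hγ hcv M ra rb
  have g5 : rho b * (κ * δR - cv * δl) ^ 2 ≤ 12 * κ ^ 2 * (L * X) + 2 * cv ^ 2 * Y := by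
    have h1 : (κ * δR - cv * δl) ^ 2 ≤ 2 * κ ^ 2 * δR ^ 2 + 2 * cv ^ 2 * δl ^ 2 := by
      nlinarith [sq_nonneg (κ * δR + cv * δl)]
    have h2 := mul_le_mul_of_nonneg_left h1 rb.le
    have h3 := mul_le_mul_of_nonneg_left g3 (by positivity : 0 ≤ 2 * κ ^ 2)
    have h4 := mul_le_mul_of_nonneg_left g4 (by positivity : 0 ≤ 2 * cv ^ 2)
    linarith
  have hG : 0 ≤ 12 * κ ^ 2 * (L * X) + 2 * cv ^ 2 * Y := by positivity
  have t1 : |rho b * (M / κ) * (cutSq (zet M b) - cutSq (zet M a)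
          - cutSq' (zet M a) * (zet M b - zet M a))|
      ≤ 1 / κ * (12 * κ ^ 2 * (L * X) + 2 * cv ^ 2 * Y) := by
    have h1 := abs_cutSq_taylor_le (zet M a) (zet M b)
    rw [hz, div_pow] at h1
    rw [hz, abs_mul, abs_of_pos (by positivity : 0 < rho b * (M / κ))]
    calc _ ≤ rho b * (M / κ) * ((κ * δR - cv * δl) ^ 2 / M ^ 2) := by gcongr
      _ = 1 / κ * (rho b * (κ * δR - cv * δl) ^ 2) / M := by field_simp
      _ ≤ 1 / κ * (rho b * (κ * δR - cv * δl) ^ 2) := div_le_self (by positivity) hM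
      _ ≤ _ := by gcongr
  have t2 : |rho b * logRho a * (cutLog (zet M b) - cutLog (zet M a)
          - cutLog' (zet M a) * (zet M b - zet M a))|
      ≤ 12 * κ ^ 2 * (L * X) + 2 * cv ^ 2 * Y := by
    have h1 := abs_cutLog_taylor_le (zet M a) (zet M b)
    rw [hz, div_pow] at h1
    rw [hz, abs_mul, abs_mul, abs_of_pos rb]
    have h2 := ta.log_le.trans (hLM.trans (le_mul_of_one_le_right hM0.le hM))
    calc _ ≤ rho b * (M * M) * ((κ * δR - cv * δl) ^ 2 / M ^ 2) := by gcongr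
      _ = rho b * (κ * δR - cv * δl) ^ 2 := by field_simp
      _ ≤ _ := g5
  have t3 : |cutLog (zet M a) * (rho b * δR - (rho b - rho a))| ≤ L * X := by
    rw [abs_mul, abs_of_nonneg (cutLog_nonneg _)]
    exact mul_le_mul ((cutLog_le _).trans (ta.log_max_le hL hM)) g2 (abs_nonneg _) hL0.le
  have t4 : |rho b * (cutLog (zet M b) - cutLog (zet M a)) * δR|
      ≤ 6 * (cv + 2 * κ) * (L * X) + cv * Y := by
    have h1 := (abs_cutLog_sub_le (zet M a) (zet M b)).trans (div_max_le _ _)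
    rw [one_mul, hz, abs_div, abs_of_pos hM0] at h1
    have h2 : |κ * δR - cv * δl| / M ≤ κ * |δR| + cv * |δl| := by
      refine (div_le_self (abs_nonneg _) hM).trans ((abs_sub _ _).trans_eq ?_)
      rw [abs_mul, abs_mul, abs_of_pos hκ, abs_of_pos hcv]
    rw [abs_mul, abs_mul, abs_of_pos rb]
    have h3 : (κ * |δR| + cv * |δl|) * |δR| ≤ (κ + cv) * δR ^ 2 + cv * δl ^ 2 := by
      rw [← sq_abs δR, ← sq_abs δl]
      have f1 := mul_nonneg hcv.le (sq_nonneg (|δR| - |δl|))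
      have f2 := mul_nonneg hcv.le (sq_nonneg (|δR|))
      have f3 := mul_nonneg hcv.le (sq_nonneg (|δl|))
      linarith
    calc _ ≤ rho b * (κ * |δR| + cv * |δl|) * |δR| := by gcongr; exact h1.trans h2
      _ = rho b * ((κ * |δR| + cv * |δl|) * |δR|) := by ring
      _ ≤ rho b * ((κ + cv) * δR ^ 2 + cv * δl ^ 2) := by gcongr
      _ = (κ + cv) * (rho b * δR ^ 2) + cv * (rho b * δl ^ 2) := by ring
      _ ≤ (κ + cv) * (6 * L * X) + cv * Y := by gcongr
      _ ≤ _ := by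
        have : 0 ≤ κ * (L * X) := by positivity
        linarith
  have htot : |renormDefect γ cv M a b| ≤ L * (C1 * X + C2 * Y) := by
    rw [renormDefect_eq hM0 ra rb, ← hκdef]
    refine (abs_add_le _ _).trans ?_
    refine (add_le_add_left (abs_add_three _ _ _) _).trans ?_
    have e : L * (C1 * X + C2 * Y) = (1 / κ * (12 * κ ^ 2 * (L * X) + 2 * cv ^ 2 * (L * Y))
        + (12 * κ ^ 2 * (L * X) + 2 * cv ^ 2 * (L * Y)) + L * X)
        + (6 * (cv + 2 * κ) * (L * X) + cv * (L * Y)) := by rw [hC1, hC2]; ring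
    have hYL : Y ≤ L * Y := le_mul_of_one_le_left hY0 hL
    have h1 : 12 * κ ^ 2 * (L * X) + 2 * cv ^ 2 * Y ≤ 12 * κ ^ 2 * (L * X) + 2 * cv ^ 2 * (L * Y) := by
      gcongr
    have h2 := mul_le_mul_of_nonneg_left h1 (by positivity : 0 ≤ 1 / κ)
    have h3 := mul_le_mul_of_nonneg_left hYL hcv.le
    rw [e]
    linarith
  have hl := lam_nonneg (γ := γ) (cv := cv) s a b
  have p1 := density_le_prod hγ hcv ra rb s
  have p2 := temp_le_prod hγ hcv ra rb s
  rw [← hδR, ← hX, ← hκdef] at p1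
  rw [← hδl] at p2
  calc _ ≤ lam γ cv s a b * (L * (C1 * X + C2 * Y)) := by gcongr
    _ = L * (C1 / κ * (lam γ cv s a b * (κ * X))
        + C2 * 2 / cv * (lam γ cv s a b * (cv / 2 * (rho a + rho b) * δl ^ 2))) := by
      rw [hY]; field_simp
    _ ≤ L * (C1 / κ * prod γ cv s a b + C2 * 2 / cv * prod γ cv s a b) := by gcongr
    _ = _ := by ring

/-- Where the gas is cold, the velocity jump is controlled by the entropy production. -/
lemma cold_vel_jump_le (hγ : 1 < γ) (hcv : 0 < cv) : ∃ C, 0 ≤ C ∧ ∀ {h : ℝ}, 0 ≤ h →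
    ∀ {a b : State d}, 0 < rho a → 0 < rho b → temperature γ cv a ≤ h ^ 2 → ∀ s : Fin d,
      rho a * |vel b s - vel a s| ≤ C * (prod γ cv s a b + h * rho a) := by
  have hk : 0 < Real.sqrt (γ * (cv * (γ - 1))) := by
    refine Real.sqrt_pos.2 (mul_pos (by linarith) (mul_pos hcv (by linarith)))
  set k := Real.sqrt (γ * (cv * (γ - 1)))
  refine ⟨1 + 4 / k, by positivity, fun {h} hh {a b} ra rb hθ s => ?_⟩
  have θa := temperature_pos hγ hcv ra
  have θb := temperature_pos hγ hcv rb
  set r := Real.sqrt (temperature γ cv a) with hr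
  have hr0 : 0 < r := Real.sqrt_pos.2 θa
  have hrr : r * r = temperature γ cv a := Real.mul_self_sqrt θa.le
  have hrh : r ≤ h := by
    rw [hr, Real.sqrt_le_iff]; exact ⟨hh, hθ⟩
  have hl : k * r ≤ 2 * lam γ cv s a b := by
    have := sqrt_temperature_le_lam_left (γ := γ) hcv ra s b
    rwa [Real.sqrt_mul' _ θa.le] at this
  have hl0 := lam_nonneg (γ := γ) (cv := cv) s a b
  have hp := vel_le_prod hγ hcv ra rb s
  set v := |vel b s - vel a s| with hv
  have hv0 : 0 ≤ v := abs_nonneg _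
  have hvj : v ^ 2 ≤ velJump a b := by
    rw [hv, sq_abs]
    exact Finset.single_le_sum (f := fun i => (vel b i - vel a i) ^ 2)
      (fun i _ => sq_nonneg _) (Finset.mem_univ s)
  -- The weight `1/T` against `λ`, at least a multiple of `√T`, leaves `v²/√T`: in cold gas velocity
  -- jumps are expensive.
  have hlow : k / 4 * (rho a * v ^ 2 / r) ≤ prod γ cv s a b := by
    refine le_trans ?_ hp
    have h1 : k * r / 2 * (rho a / 2 * v ^ 2) * (1 / temperature γ cv a)
        = k / 4 * (rho a * v ^ 2 / r) := by
      rw [← hrr]; field_simp; ring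
    rw [← h1]
    have h2 : 1 / temperature γ cv a ≤ 1 / temperature γ cv a + 1 / temperature γ cv b := by
      have : 0 < 1 / temperature γ cv b := by positivity
      linarith
    have h3 : rho a / 2 ≤ (rho a + rho b) / 2 := by linarith
    have h4 : k * r / 2 ≤ lam γ cv s a b := by linarith
    have h5 := velJump_nonneg a b
    gcongr
  -- Young's inequality at the scale `r = √T ≤ h`, so that the leftover is of order `h`, which
  -- survives division by `h`.
  have hyoung : v ≤ v ^ 2 / r + r := by
    rw [← sub_nonneg]
    have : v ^ 2 / r + r - v = (v ^ 2 + r * r - v * r) / r := by field_simp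
    rw [this]
    refine div_nonneg ?_ hr0.le
    nlinarith [sq_nonneg (v - r), mul_nonneg hv0 hr0.le]
  have h5 : rho a * v ≤ 4 / k * (k / 4 * (rho a * v ^ 2 / r)) + h * rho a := by
    have h6 := mul_le_mul_of_nonneg_left hyoung ra.le
    have h7 := mul_le_mul_of_nonneg_left hrh ra.le
    have : 4 / k * (k / 4 * (rho a * v ^ 2 / r)) = rho a * (v ^ 2 / r) := by field_simp
    rw [this]; linarith
  have h8 := mul_le_mul_of_nonneg_left hlow (by positivity : 0 ≤ 4 / k)
  have h9 := prod_nonneg hγ hcv ra rb s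
  have h10 : 0 ≤ 4 / k * (h * rho a) := by positivity
  linarith

/-- A discrete chain rule: convective flux of `ρ Φ` (which telescopes), minus the compression term,
plus second-order remainders. Both `a`- and `b`-based defects appear because the central flux is
symmetric. -/
lemma renorm_flux_eq {M : ℝ} (hM : 0 < M) {a b : State d} (ha : 0 < rho a)
    (hb : 0 < rho b) (s : Fin d) :
    1 / 2 * dot (flux γ cv s a + flux γ cv s b) (renormGrad γ cv M b - renormGrad γ cv M a)
      - lam γ cv s a b * dot (b - a) (renormGrad γ cv M b - renormGrad γ cv M a)
      = (rho b * cutLog (zet M b) * vel b s - rho a * cutLog (zet M a) * vel a s)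
        - 1 / 2 * (rho a * cutLog (zet M a) + rho b * cutLog (zet M b)) * (vel b s - vel a s)
        + (vel a s + vel b s) / 2 * (1 / 2 * (renormDefect γ cv M a b - renormDefect γ cv M b a))
        + 1 / 4 * (vel b s - vel a s) * (renormDefect γ cv M a b + renormDefect γ cv M b a)
        - lam γ cv s a b * (renormDefect γ cv M a b + renormDefect γ cv M b a) := by
  have l1 := renorm_legendre (γ := γ) (cv := cv) M hM ha
  have l2 := renorm_legendre (γ := γ) (cv := cv) M hM hb
  rw [dot_renormGrad_sub, dot_renormGrad_sub, renormDefect, renormDefect, dot_renormGrad,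
    dot_renormGrad]
  have e1 : ∀ x y : State d, rho (x - y) = rho x - rho y := fun _ _ => rfl
  have e2 : ∀ x y : State d, ent (x - y) = ent x - ent y := fun _ _ => rfl
  have e3 : rho (flux γ cv s a + flux γ cv s b) = rho a * vel a s + rho b * vel b s := by
    change mom a s + mom b s = _
    rw [mom_eq ha, mom_eq hb]
  have e4 : ent (flux γ cv s a + flux γ cv s b) = ent a * vel a s + ent b * vel b s := by
    change ent a * mom a s / rho a + ent b * mom b s / rho b = _
    rw [mom_eq ha, mom_eq hb]; field_simp
  rw [e1, e1, e2, e2, e3, e4, ← l1, ← l2]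
  ring

/-- Remainders with prefactors of velocity size are absorbed through `|v_s| ≤ 2 λ`. The compression
term has no such structure and is the reason for the cold-gas estimate; the rest telescopes. -/
lemma renorm_interface_le (hγ : 1 < γ) (hcv : 0 < cv) (B : ℝ) :
    ∃ C, 0 ≤ C ∧ ∀ {L M h : ℝ}, 1 ≤ L → L ≤ M → 0 ≤ h → ∀ {a b : State d}, Bounded γ cv B a →
      Bounded γ cv B b → Tame γ cv L M h a → Tame γ cv L M h b → ∀ s : Fin d,
      1 / 2 * dot (flux γ cv s a + flux γ cv s b) (renormGrad γ cv M b - renormGrad γ cv M a)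
      - dot (diffusion γ cv s a b) (renormGrad γ cv M b - renormGrad γ cv M a)
      ≤ (rho b * cutLog (zet M b) * vel b s - rho a * cutLog (zet M a) * vel a s)
        + C * L * (prod γ cv s a b + h * (rho a + rho b)) := by
  obtain ⟨C1, hC1, h1⟩ := alpha_renorm_le (d := d) hγ hcv B
  obtain ⟨C2, hC2, h2⟩ := abs_renormDefect_le (d := d) hγ hcv
  obtain ⟨C3, hC3, h3⟩ := cold_vel_jump_le (d := d) hγ hcv
  refine ⟨C1 + 6 * C2 + C3, by positivity, fun {L M h} hL hLM hh {a b} ba bb ta tb s => ?_⟩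
  have hM : 1 ≤ M := hL.trans hLM
  have hM0 : 0 < M := by linarith
  have hL0 : 0 < L := by linarith
  have ra := ba.pos
  have rb := bb.pos
  have hp := prod_nonneg hγ hcv ra rb s
  have k1 := h1 hL hLM ba bb ta tb s
  have k2 := h2 hL hLM ra rb ta tb s
  have k3 := h2 hL hLM rb ra tb ta s
  rw [lam_comm, prod_comm] at k3
  have hc : ∀ {q q' : State d}, 0 < rho q → 0 < rho q' → Tame γ cv L M h q →
      rho q * cutLog (zet M q) * |vel q' s - vel q s|
        ≤ C3 * L * (prod γ cv s q q' + h * rho q) := by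
    intro q q' rq rq' tq
    have hp' := prod_nonneg hγ hcv rq rq' s
    -- Either the gas is cold enough for the velocity estimate, or the profile vanishes.
    rcases le_or_gt M (-spec q) with hs | hs
    · have g1 := h3 hh rq rq' (tq.cold hs) s
      have g2 := (cutLog_le (zet M q)).trans (tq.log_max_le hL hM)
      calc _ = cutLog (zet M q) * (rho q * |vel q' s - vel q s|) := by ring
        _ ≤ L * (C3 * (prod γ cv s q q' + h * rho q)) :=
          mul_le_mul g2 g1 (by positivity) hL0.le
        _ = _ := by ring
    · have : zet M q ≤ 1 := by unfold zet; rw [div_le_one hM0]; exact hs.le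
      rw [(cut_of_le_one this).1]
      have : 0 ≤ C3 * L * (prod γ cv s q q' + h * rho q) := by positivity
      linarith
  have k4 := hc ra rb ta
  have k5 := hc rb ra tb
  rw [prod_comm, abs_sub_comm] at k5
  have e : dot (diffusion γ cv s a b) (renormGrad γ cv M b - renormGrad γ cv M a)
      = alpha γ cv s a b * dot (dual γ cv b - dual γ cv a)
          (renormGrad γ cv M b - renormGrad γ cv M a)
        + lam γ cv s a b * dot (b - a) (renormGrad γ cv M b - renormGrad γ cv M a) := by
    rw [diffusion, dot_add_left, dot_smul_left, dot_smul_left]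
  have hf := renorm_flux_eq (γ := γ) (cv := cv) hM0 ra rb s
  rw [e]
  have hv1 := abs_le.1 (abs_vel_le_lam_left (γ := γ) (cv := cv) s a b)
  have hv2 := abs_le.1 (abs_vel_le_lam_right (γ := γ) (cv := cv) s a b)
  set l := lam γ cv s a b
  set T := renormDefect γ cv M a b
  set T' := renormDefect γ cv M b a
  have hl : 0 ≤ l := lam_nonneg s a b
  have b1 : (vel a s + vel b s) / 2 * (1 / 2 * (T - T')) ≤ l * |T| + l * |T'| := by
    refine (le_abs_self _).trans ?_
    rw [abs_mul, abs_mul, abs_of_pos (by norm_num : (0 : ℝ) < 1 / 2)]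
    have g1 : |(vel a s + vel b s) / 2| ≤ 2 * l := by rw [abs_le]; constructor <;> linarith
    calc _ ≤ 2 * l * (1 / 2 * (|T| + |T'|)) := by gcongr; exact abs_sub _ _
      _ = _ := by ring
  have b2 : 1 / 4 * (vel b s - vel a s) * (T + T') ≤ l * |T| + l * |T'| := by
    refine (le_abs_self _).trans ?_
    rw [abs_mul]
    have g1 : |1 / 4 * (vel b s - vel a s)| ≤ l := by rw [abs_le]; constructor <;> linarith
    calc _ ≤ l * (|T| + |T'|) := by gcongr; exact abs_add_le _ _
      _ = _ := by ring
  have b3 : -(l * (T + T')) ≤ l * |T| + l * |T'| := by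
    rw [← mul_add, ← mul_neg]
    refine mul_le_mul_of_nonneg_left ?_ hl
    linarith [neg_abs_le T, neg_abs_le T']
  have b4 : -(1 / 2 * (rho a * cutLog (zet M a) + rho b * cutLog (zet M b)) * (vel b s - vel a s))
      ≤ C3 * L * (prod γ cv s a b + h * (rho a + rho b)) := by
    have g1 : 0 ≤ rho a * cutLog (zet M a) := mul_nonneg ra.le (cutLog_nonneg _)
    have g2 : 0 ≤ rho b * cutLog (zet M b) := mul_nonneg rb.le (cutLog_nonneg _)
    have g3 := mul_le_mul_of_nonneg_left (neg_abs_le (vel b s - vel a s)) (add_nonneg g1 g2)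
    have g4 : 0 ≤ C3 * L * (h * (rho a + rho b)) := by positivity
    linarith
  have b5 := neg_le_of_abs_le k1
  have g6 : 0 ≤ (C1 + 6 * C2) * L * (h * (rho a + rho b)) := by positivity
  linarith

/-! ## Equi-integrability of the entropy -/

section equi

variable {n : ℕ} [NeZero n] {T B : ℝ}

/-- Inverse estimate: a single cell carries at most the whole sum. The loss `n^d` is affordable
since only its logarithm is used. -/
lemma le_of_cellSum_le {g : Cell d n → ℝ} (hg : ∀ K, 0 ≤ g K) {c : ℝ} (h : cellSum g ≤ c)
    (K : Cell d n) : g K ≤ c * (n : ℝ) ^ d := by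
  have hn : (0 : ℝ) < n := Nat.cast_pos.2 (Nat.pos_of_ne_zero (NeZero.ne n))
  have h1 : g K ≤ ∑ K, g K := Finset.single_le_sum (fun K _ => hg K) (Finset.mem_univ K)
  have h2 : ∑ K, g K = cellSum g * (n : ℝ) ^ d := by
    unfold cellSum meshSize; rw [one_div, inv_pow]; field_simp
  rw [h2] at h1
  exact h1.trans (mul_le_mul_of_nonneg_right h (by positivity))

/-- The logarithmic scale of the mesh. -/
def logScale (n : ℕ) : ℝ := 1 + Real.log n

lemma one_le_logScale : 1 ≤ logScale n := by
  have : (1 : ℝ) ≤ n := Nat.one_le_cast.2 (Nat.pos_of_ne_zero (NeZero.ne n))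
  unfold logScale; linarith [Real.log_nonneg this]

lemma Bounded.neg_le_logRho {q : State d} (hq : Bounded γ cv B q) : -B ≤ logRho q := by
  have hB : 0 < B := by linarith [hq.one_le]
  have h1 : 1 / B ≤ rho q := by rw [div_le_iff₀ hB]; linarith [hq.low]
  have h2 : Real.log (1 / B) ≤ logRho q := Real.log_le_log (by positivity) h1
  rw [one_div, Real.log_inv] at h2
  linarith [Real.log_le_sub_one_of_pos hB]

/-- The bounds on mass and entropy give polynomial bounds in `n` for `ρ` and `-s`, so their
logarithms are of order `log n`. The level `M`, also of order `log n`, is taken so large that `-s ≥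
M` outweighs `(γ - 1) log ρ` in `log T` and still leaves `log T ≤ -2 log n`. -/
lemma BoundedSolution.tame (hγ : 1 < γ) (hcv : 0 < cv) {q : ℝ → Cell d n → State d}
    (hq : BoundedSolution γ cv T B q) {t : ℝ} (ht : t ∈ Icc 0 T) {C1 : ℝ}
    (hC1 : cv * ((γ - 1) * (d + 2 * B) + |Real.log ((γ - 1) * cv)| + 2) ≤ C1) (K : Cell d n) :
    Tame γ cv ((d + 2 * B) * logScale n) (C1 * logScale n) (meshSize n) (q t K) := by
  have hb := hq.bdd t ht K
  have hB : 1 ≤ B := hb.one_le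
  have hB0 : 0 < B := by linarith
  have hn : (1 : ℝ) ≤ n := Nat.one_le_cast.2 (Nat.pos_of_ne_zero (NeZero.ne n))
  have hln := Real.log_nonneg hn
  have hΛ := one_le_logScale (n := n)
  have hlB : Real.log B ≤ B := by linarith [Real.log_le_sub_one_of_pos hB0]
  have hd : (0 : ℝ) ≤ d := Nat.cast_nonneg d
  have hr := hb.pos
  have hup : logRho (q t K) ≤ d * Real.log n + B := by
    have h1 := le_of_cellSum_le (fun K => (hq.bdd t ht K).pos.le) (hq.mass t ht) K
    have h2 := Real.log_le_log hr h1
    rw [Real.log_mul hB0.ne' (by positivity), Real.log_pow] at h2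
    exact h2.trans (by linarith)
  have hL : d * Real.log n + 2 * B ≤ (d + 2 * B) * logScale n := by
    unfold logScale; nlinarith
  have hupL : logRho (q t K) ≤ (d + 2 * B) * logScale n := by linarith
  refine ⟨abs_le.2 ⟨?_, hupL⟩, ?_, fun hs => ?_⟩
  · have h1 := hb.neg_le_logRho
    have h2 : B ≤ d * Real.log n + 2 * B := by nlinarith
    linarith
  · have h1 := le_of_cellSum_le (fun K => abs_nonneg (ent (q t K))) (hq.entropy t ht) K
    have h2 : -spec (q t K) ≤ B ^ 2 * (n : ℝ) ^ d := by
      unfold spec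
      rw [← neg_div, div_le_iff₀ hr]
      have h3 := hb.low
      calc -ent (q t K) ≤ |ent (q t K)| := neg_le_abs _
        _ ≤ B * (n : ℝ) ^ d * 1 := by rw [mul_one]; exact h1
        _ ≤ B * (n : ℝ) ^ d * (B * rho (q t K)) := by gcongr
        _ = _ := by ring
    refine h2.trans ?_
    have h3 : B ^ 2 * (n : ℝ) ^ d = Real.exp (2 * Real.log B + d * Real.log n) := by
      rw [show 2 * Real.log B = Real.log (B ^ 2) by rw [Real.log_pow]; norm_num, ← Real.log_pow,
        Real.exp_add, Real.exp_log (by positivity), Real.exp_log (by positivity)]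
    rw [h3, Real.exp_le_exp]
    linarith
  · rw [← exp_logTemp hγ hcv hr, logTemp_eq hγ hcv hr]
    have h1 : meshSize n ^ 2 = Real.exp (-2 * Real.log n) := by
      have : -2 * Real.log n = Real.log ((n : ℝ) ^ (-2 : ℤ)) := by
        rw [Real.log_zpow]; norm_num
      rw [this, Real.exp_log (by positivity), meshSize, one_div, inv_pow]
      rfl
    rw [h1, Real.exp_le_exp]
    have h2 : spec (q t K) / cv
        ≤ -(((γ - 1) * (d + 2 * B) + |Real.log ((γ - 1) * cv)| + 2) * logScale n) := by
      rw [div_le_iff₀ hcv]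
      have := mul_le_mul_of_nonneg_right hC1 (by linarith : 0 ≤ logScale n)
      linarith
    have h3 : (γ - 1) * logRho (q t K) ≤ (γ - 1) * ((d + 2 * B) * logScale n) :=
      mul_le_mul_of_nonneg_left hupL (by linarith)
    have h4 := neg_abs_le (Real.log ((γ - 1) * cv))
    have h5 : |Real.log ((γ - 1) * cv)| ≤ |Real.log ((γ - 1) * cv)| * logScale n :=
      le_mul_of_one_le_right (abs_nonneg _) hΛ
    have h6 : Real.log n ≤ logScale n := by unfold logScale; linarith
    linarith

/-- Production increases `S`, and a one-sided bound on the entropy derivative is enough: where the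
derivative is very negative, production only lowers the renormalised entropy. The derivative of
`cutSq` is bounded below by completing the square in the logarithm. -/
lemma neg_renormEnt_le (hγ : 1 < γ) (hcv : 0 < cv) {L M h : ℝ} (hM : 1 ≤ M) (hLM : L ≤ M)
    {q : State d} (hq : Tame γ cv L M h q) :
    -renormEnt γ cv M q ≤ 2 / (cv * (γ - 1)) + 1 := by
  have hκ : 0 < cv * (γ - 1) := mul_pos hcv (by linarith)
  have hM0 : 0 < M := by linarith
  have h1 := neg_two_le_cutSq' (zet M q)
  have h2 : -1 ≤ logRho q * cutLog' (zet M q) / M := by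
    have h3 : |logRho q * cutLog' (zet M q) / M| ≤ 1 := by
      rw [abs_div, abs_of_pos hM0, div_le_one hM0, abs_mul, abs_of_nonneg (cutLog'_nonneg _)]
      have h4 : cutLog' (zet M q) ≤ 1 := by
        refine (cutLog'_le _).trans ?_
        have : (1 : ℝ) ≤ max (zet M q) 1 := le_max_right _ _
        rw [div_le_one (by linarith)]; exact this
      calc _ ≤ M * 1 := mul_le_mul (hq.log_le.trans hLM) h4 (cutLog'_nonneg _) hM0.le
        _ = M := mul_one M
    exact (abs_le.1 h3).1
  have h5 := mul_le_mul_of_nonneg_left h1 (by positivity : 0 ≤ 1 / (cv * (γ - 1)))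
  have h6 : 1 / (cv * (γ - 1)) * -2 = -(2 / (cv * (γ - 1))) := by ring
  unfold renormEnt
  linarith

/-- The telescoping terms vanish on the torus. The leftover `h ρ` at the interfaces is divided by
`h` and gives the mass, hence the constant `B` beside the production rate. -/
lemma sum_renormGrad_rhs_le (hγ : 1 < γ) (hcv : 0 < cv) (B : ℝ) :
    ∃ C, 0 ≤ C ∧ ∀ {n : ℕ} [NeZero n] {L M : ℝ}, 1 ≤ L → L ≤ M → ∀ {q : Cell d n → State d},
      (∀ K, Bounded γ cv B (q K)) → (∀ K, Tame γ cv L M (meshSize n) (q K)) →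
      cellSum (fun K => rho (q K)) ≤ B →
      cellSum (fun K => dot (renormGrad γ cv M (q K)) (rhs γ cv q K))
        ≤ C * L * (prodRate γ cv q + B) := by
  obtain ⟨C1, hC1, h1⟩ := renorm_interface_le (d := d) hγ hcv B
  have hκ : 0 < cv * (γ - 1) := mul_pos hcv (by linarith)
  refine ⟨C1 * (1 + 2 * d) + (2 / (cv * (γ - 1)) + 1), by positivity,
    fun {n} _ {L M} hL hLM {q} hb ht hm => ?_⟩
  set κ0 := 2 / (cv * (γ - 1)) + 1 with hκ0
  have hκ00 : 0 < κ0 := by positivity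
  have hh := meshSize_pos (n := n)
  set h := meshSize n with hh'
  have hL0 : 0 < L := by linarith
  have hpos : ∀ K, 0 < rho (q K) := fun K => (hb K).pos
  have hP := prodRate_nonneg hγ hcv hpos
  set G : Fin d → Cell d n → ℝ := fun s K => rho (q K) * cutLog (zet M (q K)) * vel (q K) s with hG
  have f1 : ∑ K, ∑ s, (1 / 2 * dot (flux γ cv s (q K) + flux γ cv s (q (right K s)))
          (renormGrad γ cv M (q (right K s)) - renormGrad γ cv M (q K))
        - dot (diffusion γ cv s (q K) (q (right K s)))
          (renormGrad γ cv M (q (right K s)) - renormGrad γ cv M (q K)))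
      ≤ C1 * L * (∑ K, ∑ s, prod γ cv s (q K) (q (right K s)))
        + C1 * L * (h * (2 * d * ∑ K, rho (q K))) := by
    have g1 : ∀ K ∈ (Finset.univ : Finset (Cell d n)),
        ∑ s, (1 / 2 * dot (flux γ cv s (q K) + flux γ cv s (q (right K s)))
          (renormGrad γ cv M (q (right K s)) - renormGrad γ cv M (q K))
        - dot (diffusion γ cv s (q K) (q (right K s)))
          (renormGrad γ cv M (q (right K s)) - renormGrad γ cv M (q K)))
        ≤ ∑ s, ((G s (right K s) - G s K) + C1 * L * (prod γ cv s (q K) (q (right K s))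
          + h * (rho (q K) + rho (q (right K s))))) := fun K _ =>
      Finset.sum_le_sum fun s _ =>
        h1 hL hLM hh.le (hb K) (hb (right K s)) (ht K) (ht (right K s)) s
    refine (Finset.sum_le_sum g1).trans_eq ?_
    have g2 : ∑ K, ∑ s, (G s (right K s) - G s K) = 0 := by
      rw [Finset.sum_comm]
      simp only [Finset.sum_sub_distrib, sum_right, sub_self, Finset.sum_const_zero]
    have g3 : ∑ K : Cell d n, ∑ s, (rho (q K) + rho (q (right K s))) = 2 * d * ∑ K, rho (q K) := by
      rw [Finset.sum_comm]
      have : ∀ s : Fin d, ∑ K, (rho (q K) + rho (q (right K s))) = 2 * ∑ K, rho (q K) := fun s => by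
        rw [Finset.sum_add_distrib, sum_right (fun K => rho (q K)) s]; ring
      simp only [this, Finset.sum_const, Finset.card_univ, Fintype.card_fin, nsmul_eq_mul]
      ring
    simp only [Finset.sum_add_distrib (f := fun s => G s (right _ s) - G s _)]
    rw [Finset.sum_add_distrib, g2, zero_add]
    simp only [← Finset.mul_sum, Finset.sum_add_distrib]
    simp only [Finset.sum_add_distrib] at g3
    rw [g3]; ring
  have f2 : ∑ K, (renormGrad γ cv M (q K)).2.2 * production γ cv q K
      ≤ κ0 * ∑ K, ∑ s, prod γ cv s (q K) (q (right K s)) := by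
    rw [sum_mul_production hpos, Finset.mul_sum, Finset.mul_sum]
    refine Finset.sum_le_sum fun K _ => ?_
    rw [Finset.mul_sum, Finset.mul_sum]
    refine Finset.sum_le_sum fun s _ => ?_
    have θ1 := temperature_pos hγ hcv (hpos K)
    have θ2 := temperature_pos hγ hcv (hpos (right K s))
    have e1 : (renormGrad γ cv M (q K)).2.2 ≤ κ0 :=
      neg_renormEnt_le hγ hcv (hL.trans hLM) hLM (ht K)
    have e2 : (renormGrad γ cv M (q (right K s))).2.2 ≤ κ0 :=
      neg_renormEnt_le hγ hcv (hL.trans hLM) hLM (ht (right K s))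
    have e3 := lam_nonneg (γ := γ) (cv := cv) s (q K) (q (right K s))
    have e4 := jumpForm_nonneg hγ hcv (hpos K) (hpos (right K s))
    have e5 := prod_nonneg hγ hcv (hpos K) (hpos (right K s)) s
    calc _ ≤ 1 / 2 * (lam γ cv s (q K) (q (right K s)) * jumpForm γ cv (q K) (q (right K s))
          * (κ0 * (1 / temperature γ cv (q K)) + κ0 * (1 / temperature γ cv (q (right K s))))) := by
          gcongr
      _ = 1 / 2 * (κ0 * prod γ cv s (q K) (q (right K s))) := by unfold prod; ring
      _ ≤ _ := by nlinarith
  rw [cellSum, sum_dot_rhs q fun K => renormGrad γ cv M (q K), ← mul_add]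
  have hd0 : 0 < h ^ d := pow_pos hh d
  calc _ ≤ h ^ d * (1 / h * ((C1 * L * (∑ K, ∑ s, prod γ cv s (q K) (q (right K s)))
        + C1 * L * (h * (2 * d * ∑ K, rho (q K))))
        + κ0 * ∑ K, ∑ s, prod γ cv s (q K) (q (right K s)))) := by gcongr
    _ = C1 * L * prodRate γ cv q + C1 * L * (2 * d * cellSum (fun K => rho (q K)))
        + κ0 * prodRate γ cv q := by
      unfold prodRate cellSum
      rw [← hh']
      field_simp
    _ ≤ C1 * L * prodRate γ cv q + C1 * L * (2 * d * B) + κ0 * L * (prodRate γ cv q + B) := by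
      have hB0 : 0 ≤ B := (cellSum_nonneg fun K => (hpos K).le).trans hm
      have : κ0 * prodRate γ cv q ≤ κ0 * L * (prodRate γ cv q + B) := by
        rw [mul_assoc]
        refine mul_le_mul_of_nonneg_left ?_ hκ00.le
        nlinarith
      gcongr
    _ ≤ _ := by
      have hB0 : 0 ≤ B := (cellSum_nonneg fun K => (hpos K).le).trans hm
      have : 0 ≤ C1 * L * B := by positivity
      have : 0 ≤ C1 * L * (2 * d) * prodRate γ cv q := by positivity
      linarith

/-- The superlinear terms are `y/2 ((log y - 3)² + 1)` with `y = max z 1`. -/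
lemma cutSq_lower (z : ℝ) :
    1 / 2 * max z 1 - 2 * Real.log (max z 1) - 5 ≤ cutSq z := by
  have h1 : (1 : ℝ) ≤ max z 1 := le_max_right _ _
  unfold cutSq
  nlinarith [mul_nonneg (by linarith : 0 ≤ max z 1) (sq_nonneg (Real.log (max z 1) - 3))]

lemma cutSq_lower_of_large {z : ℝ} (hz : 10 ≤ Real.log (max z 1)) :
    max z 1 * Real.log (max z 1) ^ 2 / 8 ≤ cutSq z := by
  have h1 : (1 : ℝ) ≤ max z 1 := le_max_right _ _
  have h2 := Real.log_le_sub_one_of_pos (by linarith : 0 < max z 1)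
  unfold cutSq
  set y := max z 1
  set l := Real.log y
  have h3 : 0 ≤ y * ((l - 10) * (l - 2)) :=
    mul_nonneg (by linarith) (mul_nonneg (by linarith) (by linarith))
  have h4 : 0 ≤ (y - 11) * (l ^ 2) := mul_nonneg (by linarith) (sq_nonneg l)
  nlinarith

/-- Only a lower bound of `log ρ` is needed, as its coefficient is nonnegative. The linear growth in
`z` beats every multiple of `log z`. -/
lemma exists_renorm_lower {κ : ℝ} (hκ : 0 < κ) {B : ℝ} (hB : 0 ≤ B) : ∃ C, 0 ≤ C ∧ ∀ {M : ℝ},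
    1 ≤ M → ∀ z R : ℝ, -B ≤ R → -(C * M) ≤ M / κ * cutSq z + R * cutLog z := by
  set A := 2 / κ + B with hA
  have hA0 : 0 < A := by positivity
  set ε := 1 / (2 * κ) / A with hε
  have hε0 : 0 < ε := by positivity
  refine ⟨5 / κ + A * |Real.log ε|, by positivity, fun {M} hM z R hR => ?_⟩
  have hM0 : 0 < M := by linarith
  have h1 : (1 : ℝ) ≤ max z 1 := le_max_right _ _
  have h2 := cutSq_lower z
  have h3 := cutLog_nonneg z
  have h4 := cutLog_le z
  have hl := Real.log_nonneg h1
  set y := max z 1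
  set l := Real.log y
  -- Tangent line of the logarithm with slope `ε`, where `A ε = 1/(2 κ)` is precisely the linear
  -- coefficient available from `cutSq_lower`.
  have h5 : l ≤ ε * y - 1 - Real.log ε := by
    have := Real.log_le_sub_one_of_pos (by positivity : 0 < ε * y)
    rw [Real.log_mul hε0.ne' (by positivity)] at this
    linarith
  have h6 : -(B * l) ≤ R * cutLog z := by nlinarith
  have h7 : M / κ * (1 / 2 * y - 2 * l - 5) ≤ M / κ * cutSq z := by gcongr
  have h8 : A * l ≤ 1 / (2 * κ) * y + A * |Real.log ε| := by
    have := mul_le_mul_of_nonneg_left h5 hA0.le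
    have e : A * (ε * y) = 1 / (2 * κ) * y := by rw [hε]; field_simp
    have := neg_abs_le (Real.log ε)
    nlinarith
  have h9 : B * l ≤ M * (B * l) := le_mul_of_one_le_left (by positivity) hM
  have e1 : M / κ * (1 / 2 * y - 2 * l - 5) = M * (1 / (2 * κ) * y - 2 / κ * l - 5 / κ) := by
    field_simp
  have h10 := mul_le_mul_of_nonneg_left h8 hM0.le
  rw [e1] at h7
  rw [hA] at h10
  rw [hA]
  nlinarith

/-- Half of the quadratic-logarithmic growth pays for the possibly negative term with `log ρ`, which
is at most linear in the logarithm. -/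
lemma renorm_growth {κ B M z R : ℝ} (hκ : 0 < κ) (hM : 1 ≤ M) (hR : -B ≤ R) (hB : 0 ≤ B)
    (hz : 10 ≤ Real.log (max z 1)) (hz' : 16 * κ * B ≤ M * max z 1) :
    M * max z 1 * Real.log (max z 1) ^ 2 / (16 * κ) ≤ M / κ * cutSq z + R * cutLog z := by
  have hM0 : 0 < M := by linarith
  have h1 : (1 : ℝ) ≤ max z 1 := le_max_right _ _
  have h2 := cutSq_lower_of_large hz
  have h3 := cutLog_nonneg z
  have h4 := cutLog_le z
  set y := max z 1
  set l := Real.log y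
  have h6 : -(B * l) ≤ R * cutLog z := by nlinarith
  have h7 : M / κ * (y * l ^ 2 / 8) ≤ M / κ * cutSq z := by gcongr
  have h8 : B * l ≤ M * y * l ^ 2 / (16 * κ) := by
    rw [le_div_iff₀ (by positivity)]
    have h9 := mul_le_mul_of_nonneg_right hz' (by positivity : 0 ≤ l ^ 2)
    have h10 : 0 ≤ 16 * κ * B * (l * (l - 1)) := by
      have : 0 ≤ l * (l - 1) := mul_nonneg (by linarith) (by linarith)
      positivity
    nlinarith
  have e : M / κ * (y * l ^ 2 / 8) = 2 * (M * y * l ^ 2 / (16 * κ)) := by field_simp; ring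
  linarith

end equi

/-- The truncation level for the specific entropy. -/
def cutLevel (n : ℕ) : ℝ := (n : ℝ) ^ (1 / 4 : ℝ)

/-- The logarithm of `n^(1/4)` is `log n / 4`, and dividing by a multiple of `log n` changes it by
`o(log n)`, so an eighth of the scale remains. The threshold `80` makes this eighth at least `10`,
as `renorm_growth` requires. -/
lemma eventually_levels (A C1 : ℝ) (hC1 : 0 < C1) : ∀ᶠ n : ℕ in atTop,
    A ≤ cutLevel n ∧ 80 ≤ logScale n ∧
      logScale n / 8 ≤ Real.log (cutLevel n / (C1 * logScale n)) := by
  have hc : Tendsto (fun n : ℕ => cutLevel n) atTop atTop :=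
    (tendsto_rpow_atTop (by norm_num)).comp tendsto_natCast_atTop_atTop
  have hl : Tendsto (fun n : ℕ => Real.log n) atTop atTop :=
    Real.tendsto_log_atTop.comp tendsto_natCast_atTop_atTop
  filter_upwards [hc.eventually_ge_atTop A, hl.eventually_ge_atTop 79,
    hl.eventually_ge_atTop (16 * (3 / 16 + Real.log C1 + Real.log 16)),
    eventually_ge_atTop 1] with n h1 h2 h3 hn
  have hn0 : (0 : ℝ) < n := by exact_mod_cast hn
  have hΛ : 80 ≤ logScale n := by unfold logScale; linarith
  refine ⟨h1, hΛ, ?_⟩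
  have hΛ0 : 0 < logScale n := by linarith
  have h4 : Real.log (logScale n) ≤ logScale n / 16 + Real.log 16 := by
    have := Real.log_le_sub_one_of_pos (by positivity : 0 < logScale n / 16)
    rw [Real.log_div hΛ0.ne' (by norm_num)] at this
    linarith
  rw [cutLevel, Real.log_div (Real.rpow_pos_of_pos hn0 _).ne' (by positivity),
    Real.log_mul hC1.ne' hΛ0.ne', Real.log_rpow hn0]
  unfold logScale at h4 ⊢
  linarith

/-- Integrated in time, the renormalised entropy is at most of order `Λ = logScale n`, since it
vanishes initially. On the tail it is at least of order `Λ² ρ |s|`. The quotient gives the decay. -/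
lemma exists_equi_bound (d : ℕ) (hγ : 1 < γ) (hcv : 0 < cv) {T : ℝ} (hT : 0 < T) {B : ℝ}
    (hB : 1 ≤ B) : ∃ C N, 0 ≤ C ∧ ∀ n, N ≤ n → ∀ [NeZero n] (q : ℝ → Cell d n → State d),
      BoundedSolution γ cv T B q → ∀ t ∈ Icc 0 T,
      cellSum (fun K => rho (q t K) * max 0 (|spec (q t K)| - cutLevel n)) ≤ C / logScale n := by
  have hκ : 0 < cv * (γ - 1) := mul_pos hcv (by linarith)
  set κ := cv * (γ - 1) with hκdef
  have hB0 : 0 < B := by linarith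
  have hg : 0 < γ - 1 := by linarith
  set C1 := (d + 2 * B) + cv * ((γ - 1) * (d + 2 * B) + |Real.log ((γ - 1) * cv)| + 2) with hC1
  have hC1' : cv * ((γ - 1) * (d + 2 * B) + |Real.log ((γ - 1) * cv)| + 2) ≤ C1 :=
    le_add_of_nonneg_left (by positivity)
  have hC1'' : d + 2 * B ≤ C1 := le_add_of_nonneg_right (by positivity)
  have hd0 : (0 : ℝ) ≤ d := Nat.cast_nonneg d
  have hC10 : 0 < C1 := by linarith
  obtain ⟨C2, hC2, h2⟩ := sum_renormGrad_rhs_le (d := d) hγ hcv B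
  obtain ⟨C3, hC3, h3⟩ := exists_renorm_lower hκ hB0.le
  -- The summand `B` ensures that `|s| > Y` can only mean `s < 0`; the summand `16 κ B` is the size
  -- condition of `renorm_growth`.
  obtain ⟨N, hN⟩ := eventually_atTop.1 (eventually_levels (B + 16 * κ * B) C1 hC10)
  -- The factor `1024` is `16 · 8²`: the constant of `renorm_growth` times the square of the eighth
  -- of the logarithmic scale.
  refine ⟨1024 * κ * (C2 * (d + 2 * B) * (B + T * B) + C3 * C1 * B), N, by positivity,
    fun n hn _ q hq t ht => ?_⟩
  obtain ⟨l1, l2, l3⟩ := hN n hn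
  set Λ := logScale n with hΛ
  set Y := cutLevel n
  have hΛ1 : 1 ≤ Λ := by linarith
  have hΛ0 : 0 < Λ := by linarith
  set L := (d + 2 * B) * Λ with hL
  set M := C1 * Λ with hM
  have hL1 : 1 ≤ L := one_le_mul_of_one_le_of_one_le (by linarith) hΛ1
  have hLM : L ≤ M := mul_le_mul_of_nonneg_right hC1'' hΛ0.le
  have hM1 : 1 ≤ M := hL1.trans hLM
  have hM0 : 0 < M := by linarith
  have hpos : ∀ t ∈ Icc 0 T, ∀ K, 0 < rho (q t K) := fun t ht K => (hq.bdd t ht K).pos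
  have htame : ∀ t ∈ Icc 0 T, ∀ K, Tame γ cv L M (meshSize n) (q t K) := fun t ht K =>
    hq.tame hγ hcv ht hC1' K
  have h0T : (0 : ℝ) ∈ Icc 0 T := ⟨le_rfl, hT.le⟩
  -- The initial specific entropy is bounded by `B ≤ C1 ≤ M`, so initially no cell reaches the
  -- cutoff.
  have hΦ0 : cellSum (fun K => renorm γ cv M (q 0 K)) = 0 := by
    have : ∀ K, renorm γ cv M (q 0 K) = 0 := fun K => by
      have hz : zet M (q 0 K) ≤ 1 := by
        unfold zet
        rw [div_le_one hM0]
        have h4 := (neg_le_abs _).trans (hq.init K)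
        have : C1 ≤ M := le_mul_of_one_le_right hC10.le hΛ1
        linarith
      rw [renorm, (cut_of_le_one hz).1, (cut_of_le_one hz).2.2.2.1]; ring
    simp [cellSum, this]
  have hΦ : cellSum (fun K => renorm γ cv M (q t K)) ≤ C2 * L * (B + T * B) := by
    have hcont : ContinuousOn (fun t => cellSum fun K => renorm γ cv M (q t K)) (Icc 0 T) := by
      refine continuousOn_const.mul (continuousOn_finsetSum _ fun K _ => ?_)
      have hz : ContinuousOn (fun t => zet M (q t K)) (Icc 0 T) :=
        ((hq.sol K).1.state_spec fun t ht => hpos t ht K).neg.div_const M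
      have c1 : Continuous cutSq := continuous_iff_continuousAt.2 fun z =>
        (hasDerivAt_cutSq z).continuousAt
      have c2 : Continuous cutLog := continuous_iff_continuousAt.2 fun z =>
        (hasDerivAt_cutLog z).continuousAt
      exact (hq.sol K).1.state_rho.mul ((continuousOn_const.mul (c1.comp_continuousOn hz)).add
        (((hq.sol K).1.state_logRho fun t ht => hpos t ht K).mul (c2.comp_continuousOn hz)))
    have hderiv : ∀ t ∈ Ioo 0 T, HasDerivAt (fun t => cellSum fun K => renorm γ cv M (q t K))
        (cellSum fun K => dot (renormGrad γ cv M (q t K)) (rhs γ cv (q t) K)) t := fun t ht =>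
      (HasDerivAt.fun_sum fun K _ => ((hq.sol K).2 t ht).state_renorm hγ hcv hM0
        (hpos t (Ioo_subset_Icc_self ht) K)).const_mul _
    have hcP := hq.sol.continuousOn_prodRate hγ hcv hpos
    have key := sub_le_integral_of_deriv_le ht hcont hderiv
      (g := fun t => C2 * L * (prodRate γ cv (q t) + B))
      (continuousOn_const.mul (hcP.add continuousOn_const)) fun t ht =>
        h2 hL1 hLM (hq.bdd t (Ioo_subset_Icc_self ht)) (htame t (Ioo_subset_Icc_self ht))
          (hq.mass t (Ioo_subset_Icc_self ht))
    rw [hΦ0, sub_zero, intervalIntegral.integral_const_mul, intervalIntegral.integral_add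
      ((hcP.mono (Icc_subset_Icc_right ht.2)).intervalIntegrable_of_Icc ht.1)
      intervalIntegrable_const, intervalIntegral.integral_const, sub_zero, smul_eq_mul] at key
    refine key.trans ?_
    have := hq.prod_le t ht
    have := ht.2
    gcongr
  have hpt : ∀ K, Λ ^ 2 / (1024 * κ) * (rho (q t K) * max 0 (|spec (q t K)| - Y))
      ≤ renorm γ cv M (q t K) + C3 * M * rho (q t K) := fun K => by
    have hb := hq.bdd t ht K
    have hr := hb.pos
    have hRB := hb.neg_le_logRho
    suffices h : Λ ^ 2 / (1024 * κ) * max 0 (|spec (q t K)| - Y)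
        ≤ M / κ * cutSq (zet M (q t K)) + logRho (q t K) * cutLog (zet M (q t K)) + C3 * M by
      have := mul_le_mul_of_nonneg_left h hr.le
      unfold renorm
      rw [← hκdef]
      linarith
    rcases le_or_gt (|spec (q t K)|) Y with hs | hs
    · rw [max_eq_left (by linarith), mul_zero]
      linarith [h3 hM1 (zet M (q t K)) (logRho (q t K)) hRB]
    · have hκB : 0 ≤ 16 * κ * B := by positivity
      have hBY : B ≤ Y := by linarith
      have hneg : spec (q t K) < 0 := by
        by_contra h0
        rw [abs_of_nonneg (not_lt.1 h0)] at hs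
        linarith [hb.spec_le]
      rw [abs_of_neg hneg] at hs ⊢
      have hY0 : 0 < Y := by linarith
      have hz : Y / M ≤ zet M (q t K) := by unfold zet; gcongr
      have hlog : Λ / 8 ≤ Real.log (max (zet M (q t K)) 1) :=
        l3.trans (Real.log_le_log (by positivity) (hz.trans (le_max_left _ _)))
      have hz1 : 1 ≤ zet M (q t K) := by
        by_contra h0
        rw [max_eq_right (le_of_not_ge h0), Real.log_one] at hlog
        linarith
      have hMz : M * max (zet M (q t K)) 1 = -spec (q t K) := by
        rw [max_eq_left hz1]; unfold zet; field_simp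
      have hgr := renorm_growth hκ hM1 hRB hB0.le (z := zet M (q t K)) (by linarith)
        (by rw [hMz]; linarith)
      rw [hMz] at hgr
      have hCM : 0 ≤ C3 * M := by positivity
      rw [max_eq_right (by linarith)]
      calc Λ ^ 2 / (1024 * κ) * (-spec (q t K) - Y)
          ≤ Λ ^ 2 / (1024 * κ) * (-spec (q t K)) := by gcongr; linarith
        _ = -spec (q t K) * (Λ / 8) ^ 2 / (16 * κ) := by field_simp; ring
        _ ≤ -spec (q t K) * Real.log (max (zet M (q t K)) 1) ^ 2 / (16 * κ) := by
          have : 0 ≤ -spec (q t K) := by linarith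
          gcongr
        _ ≤ _ := by linarith
  have hsum := cellSum_mono hpt
  rw [cellSum_mul, cellSum_add, cellSum_mul] at hsum
  have hmass := mul_le_mul_of_nonneg_left (hq.mass t ht) (by positivity : 0 ≤ C3 * M)
  have hfin : Λ ^ 2 / (1024 * κ) * cellSum (fun K => rho (q t K) * max 0 (|spec (q t K)| - Y))
      ≤ (C2 * (d + 2 * B) * (B + T * B) + C3 * C1 * B) * Λ := by
    calc _ ≤ C2 * L * (B + T * B) + C3 * M * B := by linarith
      _ = _ := by rw [hL, hM]; ring
  rw [le_div_iff₀ hΛ0]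
  have h5 : Λ * (cellSum (fun K => rho (q t K) * max 0 (|spec (q t K)| - Y)) * Λ)
      ≤ Λ * (1024 * κ * (C2 * (d + 2 * B) * (B + T * B) + C3 * C1 * B)) := by
    have := mul_le_mul_of_nonneg_left hfin (by positivity : 0 ≤ 1024 * κ)
    have e : 1024 * κ * (Λ ^ 2 / (1024 * κ)
        * cellSum (fun K => rho (q t K) * max 0 (|spec (q t K)| - Y)))
        = Λ * (cellSum (fun K => rho (q t K) * max 0 (|spec (q t K)| - Y)) * Λ) := by
      field_simp
    rw [e] at this
    linarith
  exact le_of_mul_le_mul_left h5 hΛ0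

/-! ## The numerical diffusion vanishes -/

lemma abs_rho_jump {a b : State d} (ha : 0 < rho a) (hb : 0 < rho b) :
    |rho b - rho a| ^ 2 ≤ (rho a + rho b) * ((rho b - rho a) * (logRho b - logRho a)) ∧
    (rho a + rho b) / 2 * |logRho b - logRho a|
      ≤ |rho b - rho a| + (rho b - rho a) * (logRho b - logRho a) := by
  have key : ∀ {a b : State d}, 0 < rho a → 0 < rho b → rho a ≤ rho b →
      |rho b - rho a| ^ 2 ≤ (rho a + rho b) * ((rho b - rho a) * (logRho b - logRho a)) ∧
      (rho a + rho b) / 2 * |logRho b - logRho a|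
        ≤ |rho b - rho a| + (rho b - rho a) * (logRho b - logRho a) := by
    intro a b ha hb hab
    have h0 : 0 ≤ logRho b - logRho a := sub_nonneg.2 (Real.log_le_log ha hab)
    have h0' : 0 ≤ rho b - rho a := sub_nonneg.2 hab
    have h1 := density_defect_nonneg ha hb
    have h2 := density_defect_nonneg hb ha
    rw [abs_of_nonneg h0, abs_of_nonneg h0']
    set t := logRho b - logRho a with ht
    have e : logRho a - logRho b = -t := by ring
    rw [e] at h1
    constructor
    · have h3 : rho b - rho a ≤ (rho a + rho b) * t := by nlinarith
      have := mul_le_mul_of_nonneg_left h3 h0'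
      nlinarith
    · nlinarith
  rcases le_total (rho a) (rho b) with h | h
  · exact key ha hb h
  · obtain ⟨h1, h2⟩ := key hb ha h
    rw [abs_sub_comm (rho b), abs_sub_comm (logRho b)]
    constructor <;> linarith

lemma young_mul {x y r X ν : ℝ} (hν : 0 < ν) (hr : 0 ≤ r) (hX : 0 ≤ X) (h : x ^ 2 ≤ r * X) : y * x ≤ ν * X + y ^ 2 / ν * r := by
  refine abs_le_of_sq_le_sq' ?_ (by positivity) |>.2
  have e : (ν * X + y ^ 2 / ν * r) ^ 2
      = (ν * X - y ^ 2 / ν * r) ^ 2 + 4 * (y ^ 2 * (r * X)) := by field_simp; ring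
  rw [e, mul_pow]
  have := mul_le_mul_of_nonneg_left h (sq_nonneg y)
  have : 0 ≤ y ^ 2 * (r * X) := by positivity
  nlinarith [sq_nonneg (ν * X - y ^ 2 / ν * r)]

/-- Products are split into mean times jump. In `[[ρ s]]` the mean of `s` is cut at the level `Y`:
the part below costs `Y |[[ρ]]|`, the excess is collected in the tail terms. -/
lemma absSum_jump_le {a b : State d} (hγ : 1 < γ) (hcv : 0 < cv) {B : ℝ} (hb1 : Bounded γ cv B a)
    (hb2 : Bounded γ cv B b) {Y : ℝ} :
    absSum (b - a) ≤ (1 + d * B + Y + 2 * (cv * (γ - 1))) * |rho b - rho a|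
      + (rho a + rho b) / 2 * ∑ i, |vel b i - vel a i|
      + 2 * cv * ((rho a + rho b) / 2 * |logTemp γ cv b - logTemp γ cv a|)
      + 2 * (cv * (γ - 1)) * ((rho b - rho a) * (logRho b - logRho a))
      + (rho a * max 0 (|spec a| - Y) + rho b * max 0 (|spec b| - Y)) := by
  have ra := hb1.pos
  have rb := hb2.pos
  obtain ⟨κ, hκdef⟩ : ∃ κ, κ = cv * (γ - 1) := ⟨_, rfl⟩
  have hκ : 0 < κ := hκdef ▸ mul_pos hcv (by linarith)
  have hR := (abs_rho_jump ra rb).2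
  have hm : ∀ i, |mom b i - mom a i|
      ≤ (rho a + rho b) / 2 * |vel b i - vel a i| + B * |rho b - rho a| := fun i => by
    have e : mom b i - mom a i = (rho a + rho b) / 2 * (vel b i - vel a i)
        + (vel a i + vel b i) / 2 * (rho b - rho a) := by
      rw [mom_eq ra, mom_eq rb]; ring
    rw [e]
    refine (abs_add_le _ _).trans ?_
    rw [abs_mul, abs_mul, abs_of_pos (by positivity : 0 < (rho a + rho b) / 2)]
    have h1 := abs_le.1 (hb1.vel_le i)
    have h2 := abs_le.1 (hb2.vel_le i)
    have : |(vel a i + vel b i) / 2| ≤ B := by rw [abs_le]; constructor <;> linarith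
    gcongr
  have hm' : ∑ i, |mom b i - mom a i| ≤ (rho a + rho b) / 2 * ∑ i, |vel b i - vel a i|
      + d * B * |rho b - rho a| := by
    refine (Finset.sum_le_sum fun i _ => hm i).trans_eq ?_
    rw [Finset.sum_add_distrib, ← Finset.mul_sum, Finset.sum_const, Finset.card_univ,
      Fintype.card_fin, nsmul_eq_mul]
    ring
  have hδs : (rho a + rho b) / 2 * |spec b - spec a|
      ≤ cv * ((rho a + rho b) / 2 * |logTemp γ cv b - logTemp γ cv a|)
        + κ * (|rho b - rho a| + (rho b - rho a) * (logRho b - logRho a)) := by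
    have e : spec b - spec a = cv * (logTemp γ cv b - logTemp γ cv a)
        - κ * (logRho b - logRho a) := by
      rw [spec_eq hγ hcv ra, spec_eq hγ hcv rb, hκdef]; ring
    have h1 : |spec b - spec a| ≤ cv * |logTemp γ cv b - logTemp γ cv a|
        + κ * |logRho b - logRho a| := by
      rw [e]
      refine (abs_sub _ _).trans_eq ?_
      rw [abs_mul, abs_mul, abs_of_pos hcv, abs_of_pos hκ]
    have h2 := mul_le_mul_of_nonneg_left h1 (by positivity : 0 ≤ (rho a + rho b) / 2)
    have h3 := mul_le_mul_of_nonneg_left hR hκ.le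
    linarith
  have hS : |ent b - ent a| ≤ Y * |rho b - rho a|
      + (rho a * max 0 (|spec a| - Y) + rho b * max 0 (|spec b| - Y))
      + 2 * ((rho a + rho b) / 2 * |spec b - spec a|) := by
    have e : ent b - ent a = (spec a + spec b) / 2 * (rho b - rho a)
        + (rho a + rho b) / 2 * (spec b - spec a) := by
      rw [ent_eq ra, ent_eq rb]; ring
    have h1 : |(spec a + spec b) / 2| ≤ (|spec a| + |spec b|) / 2 := by
      rw [abs_div, abs_of_pos (by norm_num : (0 : ℝ) < 2)]
      have := abs_add_le (spec a) (spec b)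
      linarith
    have ha' : |spec a| ≤ Y + max 0 (|spec a| - Y) := by
      linarith [le_max_right 0 (|spec a| - Y)]
    have hb' : |spec b| ≤ Y + max 0 (|spec b| - Y) := by
      linarith [le_max_right 0 (|spec b| - Y)]
    have hab := abs_abs_sub_abs_le_abs_sub (spec b) (spec a)
    have hlip : |max 0 (|spec b| - Y) - max 0 (|spec a| - Y)| ≤ |spec b - spec a| := by
      rw [max_comm 0, max_comm 0]
      refine (abs_max_sub_max_le_abs _ _ _).trans ?_
      rw [sub_sub_sub_cancel_right]; exact hab
    have hlip' := abs_le.1 hlip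
    have pa : 0 ≤ max 0 (|spec a| - Y) := le_max_left _ _
    have pb : 0 ≤ max 0 (|spec b| - Y) := le_max_left _ _
    set ha := max 0 (|spec a| - Y)
    set hb := max 0 (|spec b| - Y)
    -- The excess is moved to the side with the larger density, where that density bounds `|[[ρ]]|`.
    -- The exchange costs a jump of `s`, because the cutoff is Lipschitz.
    have hcross : (ha + hb) / 2 * |rho b - rho a|
        ≤ rho a * ha + rho b * hb + (rho a + rho b) / 2 * |spec b - spec a| := by
      have hs0 := abs_nonneg (spec b - spec a)
      rcases le_total (rho a) (rho b) with h | h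
      · rw [abs_of_nonneg (sub_nonneg.2 h)]
        have : (ha + hb) / 2 * (rho b - rho a) ≤ (hb + |spec b - spec a| / 2) * rho b :=
          mul_le_mul (by linarith) (by linarith) (by linarith) (by positivity)
        have : 0 ≤ rho a * ha := by positivity
        have : 0 ≤ rho a * |spec b - spec a| := by positivity
        nlinarith
      · rw [abs_sub_comm, abs_of_nonneg (sub_nonneg.2 h)]
        have : (ha + hb) / 2 * (rho a - rho b) ≤ (ha + |spec b - spec a| / 2) * rho a :=
          mul_le_mul (by linarith) (by linarith) (by linarith) (by positivity)
        have : 0 ≤ rho b * hb := by positivity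
        have : 0 ≤ rho b * |spec b - spec a| := by positivity
        nlinarith
    rw [e]
    refine (abs_add_le _ _).trans ?_
    rw [abs_mul, abs_mul, abs_of_pos (by positivity : 0 < (rho a + rho b) / 2)]
    have h2 : |(spec a + spec b) / 2| * |rho b - rho a|
        ≤ (Y + (ha + hb) / 2) * |rho b - rho a| :=
      mul_le_mul_of_nonneg_right (by linarith) (abs_nonneg _)
    linarith
  have e : absSum (b - a) = |rho b - rho a| + (∑ i, |mom b i - mom a i|) + |ent b - ent a| := rfl
  rw [e, ← hκdef]
  linarith

/-- Production controls squares of jumps, so linear jumps are split by Young's inequality with a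
large weight on the production and a remainder `ρ/Y`. -/
lemma lam_absSum_le (hγ : 1 < γ) (hcv : 0 < cv) {B : ℝ} (hB : 1 ≤ B) : ∃ C, 0 ≤ C ∧
    ∀ {Y : ℝ}, 1 ≤ Y → ∀ {a b : State d}, Bounded γ cv B a → Bounded γ cv B b → ∀ s : Fin d,
      lam γ cv s a b * absSum (b - a) ≤ C * (Y ^ 3 * prod γ cv s a b + 1 / Y * (rho a + rho b)
        + (rho a * max 0 (|spec a| - Y) + rho b * max 0 (|spec b| - Y))) := by
  obtain ⟨κ, hκdef⟩ : ∃ κ, κ = cv * (γ - 1) := ⟨_, rfl⟩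
  have hκ : 0 < κ := hκdef ▸ mul_pos hcv (by linarith)
  have hB0 : 0 < B := by linarith
  set A := 2 + d * B + 2 * κ with hA
  have hA0 : 0 < A := by positivity
  refine ⟨A * (1 / κ + B) + d * (B + B) + (2 + 2 * cv * B) + 2 + B, by positivity,
    fun {Y} hY {a b} ba bb s => ?_⟩
  have ra := ba.pos
  have rb := bb.pos
  have hY0 : 0 < Y := by linarith
  set Z := prod γ cv s a b with hZ
  have hZ0 : 0 ≤ Z := prod_nonneg hγ hcv ra rb s
  have hl := lam_nonneg (γ := γ) (cv := cv) s a b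
  have hlB := ba.lam_le bb s
  set l := lam γ cv s a b with hldef
  set r := rho a + rho b with hr
  have hr0 : 0 < r := by positivity
  have z1 := density_le_prod hγ hcv ra rb s
  have z2 := temp_le_prod hγ hcv ra rb s
  have z3 := vel_le_prod hγ hcv ra rb s
  rw [← hldef, ← hZ] at z1 z2 z3
  rw [← hκdef] at z1
  rw [← hr] at z2 z3
  have hX := (density_log_jump ra rb).1
  have hρ := (abs_rho_jump ra rb).1
  set X := (rho b - rho a) * (logRho b - logRho a)
  have hY3 : 1 ≤ Y ^ 3 := one_le_pow₀ hY
  have hYi : 1 / Y ^ 3 ≤ 1 / Y :=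
    one_div_le_one_div_of_le hY0 (le_self_pow₀ hY (by norm_num))
  -- The density jump carries the factor `Y` of the cutoff entropy. The weight `Y³` is the one for
  -- which the remainder `Y²/Y³` is still `1/Y`.
  have t1 : l * (A * (Y * |rho b - rho a|)) ≤ A * (1 / κ + B) * (Y ^ 3 * Z + 1 / Y * r) := by
    have h1 := young_mul (by positivity : 0 < Y ^ 3) hr0.le hX (y := Y) hρ
    have e : Y ^ 2 / Y ^ 3 = 1 / Y := by field_simp
    rw [e] at h1
    have h2 : l * X ≤ 1 / κ * Z := by
      rw [one_div, ← div_eq_inv_mul, le_div_iff₀ hκ]; linarith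
    calc l * (A * (Y * |rho b - rho a|)) ≤ l * (A * (Y ^ 3 * X + 1 / Y * r)) := by gcongr
      _ = A * (Y ^ 3 * (l * X) + l * (1 / Y * r)) := by ring
      _ ≤ A * (Y ^ 3 * (1 / κ * Z) + B * (1 / Y * r)) := by gcongr
      _ ≤ _ := by
        have p1 : 0 ≤ A * (B * (Y ^ 3 * Z)) := by positivity
        have p2 : 0 ≤ A * (1 / κ * (1 / Y * r)) := by positivity
        linarith
  have t2 : l * (r / 2 * ∑ i, |vel b i - vel a i|) ≤ d * (B + B) * (Y ^ 3 * Z + 1 / Y * r) := by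
    have h1 : ∀ i, l * (r / 2 * |vel b i - vel a i|) ≤ (B + B) * (Y ^ 3 * Z + 1 / Y * r) := by
      intro i
      have g1 : |vel b i - vel a i| ^ 2 ≤ velJump a b := by
        rw [sq_abs]
        exact Finset.single_le_sum (f := fun i => (vel b i - vel a i) ^ 2)
          (fun i _ => sq_nonneg _) (Finset.mem_univ i)
      have g2 := young_mul (x := |vel b i - vel a i|) (y := 1) (r := 1)
        (X := |vel b i - vel a i| ^ 2) (by positivity : 0 < Y ^ 3) zero_le_one (sq_nonneg _)
        (by rw [one_mul])
      rw [one_mul, one_pow, mul_one] at g2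
      have θa := temperature_pos hγ hcv ra
      have θb := temperature_pos hγ hcv rb
      -- Here only the upper bound of the temperature is used: `1/T ≥ 1/B`.
      have g3 : l * (r / 2 * velJump a b) ≤ B * Z := by
        have h5 : 1 / B ≤ 1 / temperature γ cv a + 1 / temperature γ cv b := by
          have := one_div_le_one_div_of_le θa ba.temp
          have : 0 < 1 / temperature γ cv b := by positivity
          linarith
        have h6 : 0 ≤ l * (r / 2 * velJump a b) := by
          have := velJump_nonneg a b
          positivity
        have h7 := (mul_le_mul_of_nonneg_left h5 h6).trans z3
        rw [mul_one_div, div_le_iff₀ hB0] at h7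
        linarith
      calc _ ≤ l * (r / 2 * (Y ^ 3 * velJump a b + 1 / Y)) := by
            gcongr
            refine g2.trans ?_
            gcongr
        _ = Y ^ 3 * (l * (r / 2 * velJump a b)) + l * (1 / Y * r) / 2 := by ring
        _ ≤ Y ^ 3 * (B * Z) + B * (1 / Y * r) / 2 := by gcongr
        _ ≤ _ := by
          have p1 : 0 ≤ B * (Y ^ 3 * Z) := by positivity
          have p2 : 0 ≤ B * (1 / Y * r) := by positivity
          linarith
    rw [Finset.mul_sum, Finset.mul_sum]
    refine (Finset.sum_le_sum fun i _ => h1 i).trans_eq ?_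
    rw [Finset.sum_const, Finset.card_univ, Fintype.card_fin, nsmul_eq_mul]
    ring
  have t3 : l * (2 * cv * (r / 2 * |logTemp γ cv b - logTemp γ cv a|))
      ≤ (2 + 2 * cv * B) * (Y ^ 3 * Z + 1 / Y * r) := by
    set δ := logTemp γ cv b - logTemp γ cv a
    have g2 := young_mul (x := |δ|) (y := 1) (r := 1)
        (X := |δ| ^ 2) (by positivity : 0 < Y ^ 3) zero_le_one (sq_nonneg _)
        (by rw [one_mul])
    rw [one_mul, one_pow, mul_one, sq_abs] at g2
    calc _ ≤ l * (2 * cv * (r / 2 * (Y ^ 3 * δ ^ 2 + 1 / Y))) := by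
          gcongr
          linarith
      _ = 2 * Y ^ 3 * (l * (cv / 2 * r * δ ^ 2)) + cv * (l * (1 / Y * r)) := by ring
      _ ≤ 2 * Y ^ 3 * Z + cv * (B * (1 / Y * r)) := by gcongr
      _ ≤ _ := by
        have p1 : 0 ≤ cv * B * (Y ^ 3 * Z) := by positivity
        have p2 : 0 ≤ 1 / Y * r := by positivity
        have p3 : 0 ≤ cv * (B * (1 / Y * r)) := by positivity
        linarith
  have t4 : l * (2 * κ * X) ≤ 2 * (Y ^ 3 * Z) := by
    have : Z ≤ Y ^ 3 * Z := le_mul_of_one_le_left hZ0 hY3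
    linarith
  have pa : 0 ≤ rho a * max 0 (|spec a| - Y) := mul_nonneg ra.le (le_max_left _ _)
  have pb : 0 ≤ rho b * max 0 (|spec b| - Y) := mul_nonneg rb.le (le_max_left _ _)
  have hsum := absSum_jump_le hγ hcv ba bb (Y := Y)
  rw [← hκdef, ← hr] at hsum
  have hcoef : (1 + d * B + Y + 2 * κ) * |rho b - rho a| ≤ A * (Y * |rho b - rho a|) := by
    rw [← mul_assoc]
    refine mul_le_mul_of_nonneg_right ?_ (abs_nonneg _)
    have : 0 ≤ (1 + d * B + 2 * κ) * (Y - 1) := mul_nonneg (by positivity) (by linarith)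
    rw [hA]; linarith
  set H := rho a * max 0 (|spec a| - Y) + rho b * max 0 (|spec b| - Y)
  have hH : 0 ≤ H := add_nonneg pa pb
  have t5 : l * H ≤ B * H := mul_le_mul_of_nonneg_right hlB hH
  have hfin := mul_le_mul_of_nonneg_left (hsum.trans (by linarith :
    _ ≤ A * (Y * |rho b - rho a|) + r / 2 * (∑ i, |vel b i - vel a i|)
      + 2 * cv * (r / 2 * |logTemp γ cv b - logTemp γ cv a|) + 2 * κ * X + H)) hl
  have q1 : 0 ≤ Y ^ 3 * Z := by positivity
  have q2 : 0 ≤ 1 / Y * r := by positivity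
  have q3 : 0 ≤ (A * (1 / κ + B) + d * (B + B) + (2 + 2 * cv * B) + 2) * H := by positivity
  have q4 : 0 ≤ (2 + B) * (1 / Y * r) := by positivity
  have q5 : 0 ≤ B * (Y ^ 3 * Z) := by positivity
  linarith

/-- The total diffusion per unit time. -/
def diffRate {n : ℕ} [NeZero n] (γ cv : ℝ) (q : Cell d n → State d) : ℝ :=
  cellSum fun K => ∑ s, lam γ cv s (q K) (q (right K s)) * absSum (q (right K s) - q K)

lemma IsSolution.continuousOn_diffRate {n : ℕ} [NeZero n] {T : ℝ}
    {q : ℝ → Cell d n → State d} (hq : IsSolution γ cv T q)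
    (hpos : ∀ t ∈ Icc 0 T, ∀ K, 0 < rho (q t K)) :
    ContinuousOn (fun t => diffRate γ cv (q t)) (Icc 0 T) :=
  continuousOn_const.mul (continuousOn_finsetSum _ fun K _ =>
    continuousOn_finsetSum _ fun s _ => ((hq K).1.state_lam (fun t ht => hpos t ht K)
      (hq (right K s)).1 (fun t ht => hpos t ht (right K s)) s).mul
      ((hq (right K s)).1.sub (hq K).1).state_absSum)

lemma tendsto_cutLevel : Tendsto (fun n : ℕ => 1 / cutLevel n) atTop (𝓝 0) := by
  have : Tendsto (fun n : ℕ => cutLevel n) atTop atTop :=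
    (tendsto_rpow_atTop (by norm_num)).comp tendsto_natCast_atTop_atTop
  exact tendsto_const_nhds.div_atTop this

lemma tendsto_logScale : Tendsto (fun n : ℕ => 1 / logScale n) atTop (𝓝 0) := by
  have : Tendsto (fun n : ℕ => logScale n) atTop atTop :=
    tendsto_atTop_add_const_left _ _ (Real.tendsto_log_atTop.comp tendsto_natCast_atTop_atTop)
  exact tendsto_const_nhds.div_atTop this

/-- The weak BV bound controls production divided by `h`, so the production term becomes `Y³ h`.
With `Y = n^(1/4)` this equals the other error `1/Y`, and the entropy tail adds `1 / log n`. -/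
lemma exists_diffRate_bound (d : ℕ) (hγ : 1 < γ) (hcv : 0 < cv) {T : ℝ} (hT : 0 < T) {B : ℝ}
    (hB : 1 ≤ B) : ∃ (ε : ℕ → ℝ) (N : ℕ), Tendsto ε atTop (𝓝 0) ∧ ∀ n, N ≤ n → ∀ [NeZero n]
      (q : ℝ → Cell d n → State d), BoundedSolution γ cv T B q → ∀ τ ∈ Icc 0 T,
      ∫ t in (0 : ℝ)..τ, diffRate γ cv (q t) ≤ ε n := by
  obtain ⟨C1, hC1, h1⟩ := lam_absSum_le (d := d) hγ hcv hB
  obtain ⟨C2, N, hC2, h2⟩ := exists_equi_bound d hγ hcv hT hB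
  have hB0 : 0 < B := by linarith
  refine ⟨fun n => C1 * (1 / cutLevel n * B
    + T * (2 * d * B * (1 / cutLevel n) + 2 * d * C2 * (1 / logScale n))), N, ?_,
    fun n hn _ q hq τ hτ => ?_⟩
  · have := ((tendsto_cutLevel.mul_const B).add (((tendsto_cutLevel.const_mul (2 * d * B)).add
      (tendsto_logScale.const_mul (2 * d * C2))).const_mul T)).const_mul C1
    simpa using this
  have hn1 : (1 : ℝ) ≤ n := Nat.one_le_cast.2 (Nat.pos_of_ne_zero (NeZero.ne n))
  have hY1 : 1 ≤ cutLevel n := Real.one_le_rpow hn1 (by norm_num)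
  -- Balance of the two errors: `Y⁴ = n = 1/h`.
  have hYh : cutLevel n ^ 3 * meshSize n = 1 / cutLevel n := by
    have : cutLevel n ^ 4 = n := by
      rw [cutLevel, ← Real.rpow_natCast, ← Real.rpow_mul (by linarith)]; norm_num
    rw [meshSize, ← this]; field_simp
  have hpos : ∀ t ∈ Icc 0 T, ∀ K, 0 < rho (q t K) := fun t ht K => (hq.bdd t ht K).pos
  have hΛ := one_le_logScale (n := n)
  set Y := cutLevel n
  have hY0 : 0 < Y := by linarith
  have hbound : ∀ t ∈ Icc 0 T, diffRate γ cv (q t) ≤ C1 * (1 / Y * prodRate γ cv (q t)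
      + (2 * d * B * (1 / Y) + 2 * d * C2 * (1 / logScale n))) := fun t ht => by
    have g1 : diffRate γ cv (q t) ≤ cellSum fun K => ∑ s, C1 * (Y ^ 3
        * prod γ cv s (q t K) (q t (right K s)) + 1 / Y * (rho (q t K) + rho (q t (right K s)))
        + (rho (q t K) * max 0 (|spec (q t K)| - Y)
          + rho (q t (right K s)) * max 0 (|spec (q t (right K s))| - Y))) :=
      cellSum_mono fun K => Finset.sum_le_sum fun s _ =>
        h1 hY1 (hq.bdd t ht K) (hq.bdd t ht (right K s)) s
    refine g1.trans ?_
    set a1 := fun K => rho (q t K)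
    set a2 := fun K => rho (q t K) * max 0 (|spec (q t K)| - Y)
    have g2 : cellSum (fun K => ∑ s, C1 * (Y ^ 3
        * prod γ cv s (q t K) (q t (right K s)) + 1 / Y * (a1 K + a1 (right K s))
        + (a2 K + a2 (right K s))))
        = C1 * (Y ^ 3 * (meshSize n * prodRate γ cv (q t)) + 1 / Y * (2 * d * cellSum a1)
          + 2 * d * cellSum a2) := by
      have hh := (meshSize_pos (n := n)).ne'
      have e0 : meshSize n * prodRate γ cv (q t)
          = ∑ s, cellSum fun K => prod γ cv s (q t K) (q t (right K s)) := by
        rw [prodRate, ← mul_assoc, mul_one_div_cancel hh, one_mul, cellSum_finsetSum]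
      rw [cellSum_finsetSum, e0]
      simp only [cellSum_add, cellSum_mul, cellSum_right a1, cellSum_right a2]
      simp only [← Finset.mul_sum, Finset.sum_add_distrib, Finset.sum_const, Finset.card_univ,
        Fintype.card_fin, nsmul_eq_mul]
      ring
    refine g2.trans_le ?_
    have g3 := hq.mass t ht
    have g4 := h2 n hn q hq t ht
    rw [← mul_assoc (Y ^ 3), hYh]
    have e1 : 2 * d * C2 * (1 / logScale n) = 2 * d * (C2 / logScale n) := by ring
    have e2 : 2 * d * B * (1 / Y) = 1 / Y * (2 * d * B) := by ring
    rw [e1, e2, add_assoc]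
    gcongr
  have hcP := hq.sol.continuousOn_prodRate hγ hcv hpos
  have hcD := hq.sol.continuousOn_diffRate hpos
  have hsub : Icc 0 τ ⊆ Icc 0 T := Icc_subset_Icc_right hτ.2
  have hiP := (hcP.mono hsub).intervalIntegrable_of_Icc (μ := volume) hτ.1
  refine (intervalIntegral.integral_mono_on hτ.1 ((hcD.mono hsub).intervalIntegrable_of_Icc hτ.1)
    (((hiP.const_mul (1 / Y)).add intervalIntegrable_const).const_mul C1)
    fun t ht => hbound t (hsub ht)).trans ?_
  rw [intervalIntegral.integral_const_mul, intervalIntegral.integral_add (hiP.const_mul _)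
    intervalIntegrable_const, intervalIntegral.integral_const_mul, intervalIntegral.integral_const,
    sub_zero, smul_eq_mul]
  have g5 := hq.prod_le τ hτ
  have g6 := hτ.2
  change _ ≤ C1 * (1 / Y * B + T * (2 * d * B * (1 / Y) + 2 * d * C2 * (1 / logScale n)))
  gcongr

/-! ## Integrals over the mesh -/

/-- The half-open cell at the origin. -/
def unitCell (d n : ℕ) : Set (Fin d → ℝ) := univ.pi fun _ => Ico 0 (meshSize n)

lemma unitCell_subset {n : ℕ} : unitCell d n ⊆ Icc (0 : Fin d → ℝ) fun _ => meshSize n := by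
  intro x hx
  exact ⟨fun i => (hx i (mem_univ i)).1, fun i => (hx i (mem_univ i)).2.le⟩

lemma measurableSet_unitCell {n : ℕ} : MeasurableSet (unitCell d n) :=
  MeasurableSet.univ_pi fun _ => measurableSet_Ico

lemma integrableOn_unitCell {n : ℕ} {F : (Fin d → ℝ) → ℝ}
    (hF : ContinuousOn F (Icc (0 : Fin d → ℝ) fun _ => meshSize n)) :
    IntegrableOn F (unitCell d n) :=
  (hF.integrableOn_compact isCompact_Icc).mono_set unitCell_subset

section tiling

variable {n : ℕ} [NeZero n]

/-- The lower corner of a cell. -/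
def corner (K : Cell d n) : Fin d → ℝ := fun i => (K i).val * meshSize n

lemma nat_mul_meshSize : (n : ℝ) * meshSize n = 1 := by
  have : (n : ℝ) ≠ 0 := Nat.cast_ne_zero.2 (NeZero.ne n)
  unfold meshSize; field_simp

lemma corner_nonneg (K : Cell d n) (i : Fin d) : 0 ≤ corner K i :=
  mul_nonneg (Nat.cast_nonneg _) meshSize_pos.le

lemma corner_add_le (K : Cell d n) (i : Fin d) : corner K i + meshSize n ≤ 1 := by
  have h1 : ((K i).val : ℝ) + 1 ≤ n := by exact_mod_cast ZMod.val_lt (K i)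
  have h2 := mul_le_mul_of_nonneg_right h1 (meshSize_pos (n := n)).le
  rw [nat_mul_meshSize] at h2
  unfold corner; linarith

lemma cellOf_eq_iff {x : Fin d → ℝ} (hx : x ∈ univ.pi fun _ => Ico (0 : ℝ) 1) (K : Cell d n) :
    cellOf d n x = K ↔ x ∈ univ.pi fun i => Ico (corner K i) (corner K i + meshSize n) := by
  have hn : (0 : ℝ) < n := Nat.cast_pos.2 (Nat.pos_of_ne_zero (NeZero.ne n))
  have hh := meshSize_pos (n := n)
  have hnh := nat_mul_meshSize (n := n)
  rw [funext_iff, mem_univ_pi]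
  refine forall_congr' fun i => ?_
  have hxi := hx i (mem_univ i)
  have h0 : 0 ≤ (n : ℝ) * x i := mul_nonneg hn.le hxi.1
  have e1 : x i ∈ Ico (corner K i) (corner K i + meshSize n)
      ↔ ⌊(n : ℝ) * x i⌋ = ((K i).val : ℤ) := by
    rw [Int.floor_eq_iff, mem_Ico]
    have e2 : x i = (n * x i) * meshSize n := by rw [mul_right_comm, hnh, one_mul]
    have e3 : corner K i + meshSize n = ((K i).val + 1 : ℝ) * meshSize n := by
      unfold corner; ring
    rw [e3]
    conv_lhs => rw [e2]
    unfold corner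
    rw [mul_le_mul_iff_left₀ hh, mul_lt_mul_iff_left₀ hh]
    norm_cast
  rw [e1]
  have hfl : 0 ≤ ⌊(n : ℝ) * x i⌋ := Int.floor_nonneg.2 h0
  have hlt : ⌊(n : ℝ) * x i⌋ < n := by
    rw [Int.floor_lt]
    have := mul_lt_mul_of_pos_left hxi.2 hn
    simpa using this
  obtain ⟨m, hm⟩ := Int.eq_ofNat_of_zero_le hfl
  unfold cellOf
  rw [hm]
  rw [hm] at hlt
  have hmn : m < n := by exact_mod_cast hlt
  constructor
  · intro h
    rw [← h]
    simp [ZMod.val_natCast, Nat.mod_eq_of_lt hmn]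
  · intro h
    have : m = (K i).val := by exact_mod_cast h
    rw [this]
    simp

lemma cell_subset (K : Cell d n) :
    (univ.pi fun i => Ico (corner K i) (corner K i + meshSize n)) ⊆ univ.pi fun _ => Ico (0 : ℝ) 1 :=
  pi_mono fun i _ => Ico_subset_Ico (corner_nonneg K i) (corner_add_le K i)

lemma add_corner_mem {x : Fin d → ℝ} (hx : x ∈ Icc (0 : Fin d → ℝ) fun _ => meshSize n)
    (K : Cell d n) : x + corner K ∈ Icc (0 : Fin d → ℝ) 1 := by
  refine ⟨fun i => add_nonneg (hx.1 i) (corner_nonneg K i), fun i => ?_⟩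
  have h1 := hx.2 i
  have h2 := corner_add_le K i
  simp only [Pi.add_apply, Pi.one_apply] at *
  linarith

lemma volume_unitCell : (volume (unitCell d n)).toReal = meshSize n ^ d := by
  rw [unitCell, Real.volume_pi_Ico_toReal (fun _ => meshSize_pos.le)]
  simp

/-- Translating all cells to the origin turns the integral into an average, over offsets `x` in one
cell, of sums over the nodes `x + corner K`. For a fixed offset the discrete calculus applies to
point values of the test field, so no projection error arises. -/
lemma integral_omega_eq {Γ : Cell d n → (Fin d → ℝ) → ℝ}
    (hΓ : ∀ K, ContinuousOn (Γ K) (Icc 0 1)) :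
    ∫ x in Omega d, Γ (cellOf d n x) x
      = (meshSize n ^ d)⁻¹ * ∫ x in unitCell d n, cellSum fun K => Γ K (x + corner K) := by
  have hae : (univ.pi fun _ : Fin d => Ico (0 : ℝ) 1) =ᵐ[volume] Omega d :=
    Measure.univ_pi_Ico_ae_eq_Icc
  set C : Cell d n → Set (Fin d → ℝ) := fun K =>
    univ.pi fun i => Ico (corner K i) (corner K i + meshSize n) with hC
  have hU : (univ.pi fun _ : Fin d => Ico (0 : ℝ) 1) = ⋃ K ∈ (Finset.univ : Finset (Cell d n)), C K := by
    ext x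
    simp only [mem_iUnion, Finset.mem_univ, exists_prop, true_and]
    exact ⟨fun hx => ⟨cellOf d n x, (cellOf_eq_iff hx _).1 rfl⟩, fun ⟨K, hK⟩ => cell_subset K hK⟩
  have hmeas : ∀ K, MeasurableSet (C K) := fun K => MeasurableSet.univ_pi fun _ => measurableSet_Ico
  have hcell : ∀ K, ∀ x ∈ C K, Γ (cellOf d n x) x = Γ K x := fun K x hx => by
    rw [(cellOf_eq_iff (cell_subset K hx) K).2 hx]
  have hsub : ∀ K, C K ⊆ Icc 0 1 := fun K x hx =>
    ⟨fun i => (cell_subset K hx i (mem_univ i)).1, fun i => (cell_subset K hx i (mem_univ i)).2.le⟩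
  have hint : ∀ K, IntegrableOn (Γ K) (C K) := fun K =>
    ((hΓ K).integrableOn_compact isCompact_Icc).mono_set (hsub K)
  -- The closed box is replaced by the half-open one, which the half-open cells tile exactly.
  rw [← setIntegral_congr_set hae, hU, integral_biUnion_finset _ (fun K _ => hmeas K) ?_ fun K _ =>
    (hint K).congr_fun (fun x hx => (hcell K x hx).symm) (hmeas K)]
  · have hshift : ∀ K, ∫ x in C K, Γ (cellOf d n x) x = ∫ x in unitCell d n, Γ K (x + corner K) := by
      intro K
      rw [setIntegral_congr_fun (hmeas K) (hcell K),
        ← (measurePreserving_add_right volume (corner K)).setIntegral_preimage_emb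
          (measurableEmbedding_addRight (corner K))]
      congr 2
      ext x
      simp only [hC, unitCell, mem_preimage, mem_univ_pi, Pi.add_apply, mem_Ico]
      refine forall_congr' fun i => ?_
      constructor <;> rintro ⟨h1, h2⟩ <;> constructor <;> linarith
    have hcont : ∀ K, IntegrableOn (fun x => Γ K (x + corner K)) (unitCell d n) := fun K =>
      integrableOn_unitCell ((hΓ K).comp (continuous_id.add continuous_const).continuousOn
        fun x hx => add_corner_mem hx K)
    have hh : meshSize n ^ d ≠ 0 := (pow_pos meshSize_pos d).ne'
    simp only [cellSum]
    rw [integral_const_mul, ← mul_assoc, inv_mul_cancel₀ hh, one_mul,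
      integral_finsetSum _ fun K _ => hcont K]
    exact Finset.sum_congr rfl fun K _ => hshift K
  · intro K _ K' _ hKK'
    refine Set.disjoint_left.2 fun x hx hx' => hKK' ?_
    rw [← (cellOf_eq_iff (cell_subset K hx) K).2 hx, (cellOf_eq_iff (cell_subset K' hx') K').2 hx']

/-- Across an interface the corner moves by one mesh size, up to a period. -/
lemma corner_right (K : Cell d n) (s : Fin d) :
    corner (right K s) = corner K + Pi.single s (meshSize n) ∨
    corner (right K s) + Pi.single s 1 = corner K + Pi.single s (meshSize n) := by
  have hnh := nat_mul_meshSize (n := n)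
  have hoff : ∀ i, i ≠ s → corner (right K s) i = corner K i := fun i hi => by
    simp [corner, right, hi]
  have hs : right K s s = K s + 1 := by simp [right]
  have hval : ((right K s s).val : ℝ) = (K s).val + 1 ∨
      ((right K s s).val : ℝ) + n = (K s).val + 1 := by
    rw [hs]
    rcases Nat.lt_or_ge ((K s).val + 1) n with h | h
    · left
      have h1 : K s + 1 = (((K s).val + 1 : ℕ) : ZMod n) := by simp
      rw [h1, ZMod.val_natCast, Nat.mod_eq_of_lt h]
      push_cast; ring
    · right
      have h2 : (K s).val + 1 = n := le_antisymm (ZMod.val_lt (K s)) h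
      have h1 : K s + 1 = (((K s).val + 1 : ℕ) : ZMod n) := by simp
      have h3 : K s + 1 = 0 := by rw [h1, h2]; simp
      rw [h3, ZMod.val_zero]
      rw [Nat.cast_zero, zero_add]
      exact_mod_cast h2.symm
  rcases hval with h | h
  · left
    ext i
    rcases eq_or_ne i s with rfl | hi
    · simp only [corner, Pi.add_apply, Pi.single_eq_same, h]; ring
    · simp only [Pi.add_apply, Pi.single_eq_of_ne hi, add_zero, hoff i hi]
  · right
    ext i
    rcases eq_or_ne i s with rfl | hi
    · simp only [corner, Pi.add_apply, Pi.single_eq_same]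
      linear_combination meshSize n * h - hnh
    · simp only [Pi.add_apply, Pi.single_eq_of_ne hi, add_zero, hoff i hi]

end tiling

/-! ## State-valued test fields -/

/-- A periodic test field `A` with values in the state space, with time derivative `A'` and space
derivatives `G s`. -/
structure TestField (T : ℝ) (A A' : ℝ → (Fin d → ℝ) → State d)
    (G : Fin d → ℝ → (Fin d → ℝ) → State d) : Prop where
  cont : ContinuousOn (fun z : ℝ × (Fin d → ℝ) => A z.1 z.2) (Icc 0 T ×ˢ univ)
  cont_time : ContinuousOn (fun z : ℝ × (Fin d → ℝ) => A' z.1 z.2) (Icc 0 T ×ˢ univ)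
  cont_grad : ∀ s, ContinuousOn (fun z : ℝ × (Fin d → ℝ) => G s z.1 z.2) (Icc 0 T ×ˢ univ)
  periodic : ∀ t ∈ Icc 0 T, ∀ x s, A t (x + Pi.single s 1) = A t x
  periodic_grad : ∀ t ∈ Icc 0 T, ∀ x s s', G s' t (x + Pi.single s 1) = G s' t x
  deriv_time : ∀ t ∈ Ioo 0 T, ∀ x, HasDerivAt (fun t => A t x) (A' t x) t
  deriv_space : ∀ t ∈ Icc 0 T, ∀ x s,
    HasDerivAt (fun r : ℝ => A t (x + Pi.single s r)) (G s t x) 0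

section field

variable {T : ℝ} {A A' : ℝ → (Fin d → ℝ) → State d} {G : Fin d → ℝ → (Fin d → ℝ) → State d}

lemma TestField.neg (hA : TestField T A A' G) :
    TestField T (fun t x => -A t x) (fun t x => -A' t x) (fun s t x => -G s t x) where
  cont := hA.cont.neg
  cont_time := hA.cont_time.neg
  cont_grad s := (hA.cont_grad s).neg
  periodic t ht x s := by rw [hA.periodic t ht]
  periodic_grad t ht x s s' := by rw [hA.periodic_grad t ht]
  deriv_time t ht x := (hA.deriv_time t ht x).neg
  deriv_space t ht x s := (hA.deriv_space t ht x s).neg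

lemma TestField.hasDerivAt_space (hA : TestField T A A' G) {t : ℝ} (ht : t ∈ Icc 0 T)
    (x : Fin d → ℝ) (s : Fin d) (r : ℝ) :
    HasDerivAt (fun r : ℝ => A t (x + Pi.single s r)) (G s t (x + Pi.single s r)) r := by
  have h := hA.deriv_space t ht (x + Pi.single s r) s
  have h1 : HasDerivAt (fun r' : ℝ => A t (x + Pi.single s r + Pi.single s (r' - r)))
      (G s t (x + Pi.single s r)) r := by
    have h2 : HasDerivAt (fun r' : ℝ => A t (x + Pi.single s r + Pi.single s r'))
        (G s t (x + Pi.single s r)) (r - r) := by rwa [sub_self]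
    exact h2.comp_sub_const r r
  refine h1.congr_of_eventuallyEq (Eventually.of_forall fun r' => ?_)
  simp only
  rw [add_assoc, ← Pi.single_add, add_sub_cancel]

/-- Mean value inequality after subtracting the linear function with slope `c`; `c` may be the
gradient at either end of the step, or zero. -/
lemma TestField.increment_le (hA : TestField T A A' G) {t : ℝ} (ht : t ∈ Icc 0 T)
    (x : Fin d → ℝ) (s : Fin d) {h ω : ℝ} (hh : 0 ≤ h) (c : State d)
    (hω : ∀ r ∈ Icc 0 h, ‖G s t (x + Pi.single s r) - c‖ ≤ ω) :
    ‖A t (x + Pi.single s h) - A t x - h • c‖ ≤ ω * h := by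
  have hd : ∀ r ∈ Icc 0 h, HasDerivWithinAt (fun r : ℝ => A t (x + Pi.single s r) - r • c)
      (G s t (x + Pi.single s r) - c) (Icc 0 h) r := fun r _ => by
    have := (hA.hasDerivAt_space ht x s r).sub ((hasDerivAt_id r).smul_const c)
    rw [one_smul] at this
    exact this.hasDerivWithinAt
  have := (convex_Icc 0 h).norm_image_sub_le_of_norm_hasDerivWithin_le hd hω
    (left_mem_Icc.2 hh) (right_mem_Icc.2 hh)
  simpa [abs_of_nonneg hh, sub_right_comm] using this

lemma abs_dot_le_absSum (w u : State d) : |dot w u| ≤ absSum w * ‖u‖ := by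
  have h1 := norm_fst_le u
  have h2 : ∀ i, |u.2.1 i| ≤ ‖u‖ := fun i =>
    (norm_le_pi_norm u.2.1 i).trans ((norm_fst_le u.2).trans (norm_snd_le u))
  have h3 : |u.2.2| ≤ ‖u‖ := (norm_snd_le u.2).trans (norm_snd_le u)
  unfold dot absSum
  refine (abs_add_three _ _ _).trans ?_
  rw [add_mul, add_mul, abs_mul, abs_mul, Finset.sum_mul]
  refine add_le_add (add_le_add (mul_le_mul_of_nonneg_left h1 (abs_nonneg _)) ?_)
    (mul_le_mul_of_nonneg_left h3 (abs_nonneg _))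
  refine (Finset.abs_sum_le_sum_abs _ _).trans (Finset.sum_le_sum fun i _ => ?_)
  rw [abs_mul]
  exact mul_le_mul_of_nonneg_left (h2 i) (abs_nonneg _)

lemma absSum_le_norm (u : State d) : absSum u ≤ (d + 2) * ‖u‖ := by
  have h1 : |u.1| ≤ ‖u‖ := norm_fst_le u
  have h2 : ∀ i, |u.2.1 i| ≤ ‖u‖ := fun i =>
    (norm_le_pi_norm u.2.1 i).trans ((norm_fst_le u.2).trans (norm_snd_le u))
  have h3 : |u.2.2| ≤ ‖u‖ := (norm_snd_le u.2).trans (norm_snd_le u)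
  have h4 : ∑ i, |u.2.1 i| ≤ d * ‖u‖ := by
    refine (Finset.sum_le_sum fun i _ => h2 i).trans_eq ?_
    simp
  unfold absSum
  linarith

/-- Uniform bounds and uniform continuity of the space derivatives. -/
lemma TestField.exists_bounds (hA : TestField T A A' G) :
    (∃ G0, 0 ≤ G0 ∧ ∀ s, ∀ t ∈ Icc 0 T, ∀ x ∈ Icc (0 : Fin d → ℝ) 2, ‖G s t x‖ ≤ G0) ∧
    ∀ ε > 0, ∃ δ > 0, ∀ s, ∀ t ∈ Icc 0 T, ∀ x ∈ Icc (0 : Fin d → ℝ) 2,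
      ∀ y ∈ Icc (0 : Fin d → ℝ) 2, dist x y < δ → ‖G s t x - G s t y‖ ≤ ε := by
  -- The box has side two because nodes in `[0,1]^d` are shifted by up to one mesh size without
  -- being folded back.
  have hK : IsCompact (Icc (0 : ℝ) T ×ˢ Icc (0 : Fin d → ℝ) 2) := isCompact_Icc.prod isCompact_Icc
  have hc : ∀ s, ContinuousOn (fun z : ℝ × (Fin d → ℝ) => G s z.1 z.2)
      (Icc (0 : ℝ) T ×ˢ Icc (0 : Fin d → ℝ) 2) := fun s =>
    (hA.cont_grad s).mono (prod_mono_right (subset_univ _))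
  constructor
  · choose C hC using fun s => hK.exists_bound_of_continuousOn (hc s)
    refine ⟨∑ s, |C s|, Finset.sum_nonneg fun s _ => abs_nonneg _, fun s t ht x hx => ?_⟩
    refine (hC s (t, x) ⟨ht, hx⟩).trans ((le_abs_self _).trans ?_)
    exact Finset.single_le_sum (f := fun s => |C s|) (fun s _ => abs_nonneg _) (Finset.mem_univ s)
  · intro ε hε
    have hu : ∀ s, ∃ δ > 0, ∀ t ∈ Icc 0 T, ∀ x ∈ Icc (0 : Fin d → ℝ) 2,
        ∀ y ∈ Icc (0 : Fin d → ℝ) 2, dist x y < δ → ‖G s t x - G s t y‖ ≤ ε := fun s => by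
      obtain ⟨δ, hδ, h⟩ := Metric.uniformContinuousOn_iff.1
        (hK.uniformContinuousOn_of_continuous (hc s)) ε hε
      refine ⟨δ, hδ, fun t ht x hx y hy hxy => ?_⟩
      rw [← dist_eq_norm]
      refine (h (t, x) ⟨ht, hx⟩ (t, y) ⟨ht, hy⟩ ?_).le
      rw [Prod.dist_eq, dist_self, max_eq_right dist_nonneg]; exact hxy
    choose δ hδ h using hu
    have hne : ∃ δ0 > 0, ∀ s, δ0 ≤ δ s := by
      rcases isEmpty_or_nonempty (Fin d) with h0 | h0
      · exact ⟨1, one_pos, fun s => h0.elim s⟩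
      · exact ⟨Finset.univ.inf' Finset.univ_nonempty δ,
          (Finset.lt_inf'_iff _).2 fun s _ => hδ s, fun s => Finset.inf'_le _ (Finset.mem_univ s)⟩
    obtain ⟨δ0, hδ0, hle⟩ := hne
    exact ⟨δ0, hδ0, fun s t ht x hx y hy hxy => h s t ht x hx y hy (hxy.trans_le (hle s))⟩

lemma absSum_flux_le (hγ : 1 < γ) (hcv : 0 < cv) {B : ℝ} {q : State d} (hq : Bounded γ cv B q)
    (s : Fin d) :
    absSum (flux γ cv s q) ≤ (B + d * B ^ 2) * rho q + d * B + B * |ent q| := by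
  have hr := hq.pos
  have hB : 0 ≤ B := by linarith [hq.one_le]
  have hp : 0 ≤ pressure γ cv q := by
    rw [pressure_eq hcv]
    have := temperature_pos hγ hcv hr
    have : 0 < γ - 1 := by linarith
    positivity
  have h1 : |mom q s| ≤ B * rho q := by
    rw [mom_eq hr, abs_mul, abs_of_pos hr, mul_comm]
    exact mul_le_mul_of_nonneg_right (hq.vel_le s) hr.le
  have h2 : ∀ i, |mom q i * mom q s / rho q + if i = s then pressure γ cv q else 0|
      ≤ B ^ 2 * rho q + B := fun i => by
    refine (abs_add_le _ _).trans (add_le_add ?_ ?_)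
    · have e : mom q i * mom q s / rho q = vel q i * vel q s * rho q := by
        rw [mom_eq hr, mom_eq hr]; field_simp
      rw [e, abs_mul, abs_mul, abs_of_pos hr, pow_two]
      have := hq.vel_le i
      have := hq.vel_le s
      gcongr
    · split_ifs
      · rw [abs_of_nonneg hp]; exact hq.press
      · rw [abs_zero]; exact hB
  have h3 : |ent q * mom q s / rho q| ≤ B * |ent q| := by
    have e : ent q * mom q s / rho q = vel q s * ent q := by
      rw [mom_eq hr]; field_simp
    rw [e, abs_mul]
    exact mul_le_mul_of_nonneg_right (hq.vel_le s) (abs_nonneg _)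
  have h4 : ∑ i, |mom q i * mom q s / rho q + if i = s then pressure γ cv q else 0|
      ≤ d * (B ^ 2 * rho q + B) := by
    refine (Finset.sum_le_sum fun i _ => h2 i).trans_eq ?_
    simp
    ring
  unfold absSum flux
  simp only
  linarith

lemma _root_.HasDerivAt.state_dot {x y : ℝ → State d} {x' y' : State d} {t : ℝ}
    (hx : HasDerivAt x x' t) (hy : HasDerivAt y y' t) :
    HasDerivAt (fun t => dot (x t) (y t)) (dot x' (y t) + dot (x t) y') t := by
  have h1 := hx.state_rho.mul hy.state_rho
  have h2 := HasDerivAt.fun_sum (u := Finset.univ) fun i _ =>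
    (hx.state_mom i).mul (hy.state_mom i)
  have h3 := hx.state_ent.mul hy.state_ent
  refine ((h1.add h2).add h3).congr_deriv ?_
  unfold dot
  simp only [rho, mom, ent, Finset.sum_add_distrib]
  ring

lemma _root_.ContinuousOn.state_flux {X : Type*} [TopologicalSpace X] {u : Set X} {x : X → State d}
    (h : ContinuousOn x u) (hx : ∀ t ∈ u, 0 < rho (x t)) (s : Fin d) :
    ContinuousOn (fun t => flux γ cv s (x t)) u := by
  have hne : ∀ t ∈ u, rho (x t) ≠ 0 := fun t ht => (hx t ht).ne'
  refine (h.state_mom s).prodMk ((continuousOn_pi.2 fun i => ?_).prodMk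
    ((h.state_ent.mul (h.state_mom s)).div h.state_rho hne))
  refine (((h.state_mom i).mul (h.state_mom s)).div h.state_rho hne).add ?_
  split_ifs
  · exact h.state_pressure hx
  · exact continuousOn_const

variable {n : ℕ} [NeZero n]

/-- Crossing the boundary of the fundamental domain changes the corner by a full period, which the
test field does not see. -/
lemma TestField.right_eq (hA : TestField T A A' G) {t : ℝ} (ht : t ∈ Icc 0 T) (x : Fin d → ℝ)
    (K : Cell d n) (s : Fin d) :
    A t (x + corner (right K s)) = A t (x + corner K + Pi.single s (meshSize n)) ∧
    ∀ s', G s' t (x + corner (right K s)) = G s' t (x + corner K + Pi.single s (meshSize n)) := by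
  rcases corner_right K s with h | h
  · rw [h, add_assoc]; exact ⟨rfl, fun _ => rfl⟩
  · rw [add_assoc, ← h, ← add_assoc]
    exact ⟨(hA.periodic t ht _ s).symm, fun s' => (hA.periodic_grad t ht _ s s').symm⟩

/-- The weak residual of the discrete fluxes, tested at the nodes `x + corner K`. -/
lemma TestField.flux_error_le (hγ : 1 < γ) (hcv : 0 < cv) (hA : TestField T A A' G) {t : ℝ}
    (ht : t ∈ Icc 0 T) (x : Fin d → ℝ) {ω G0 : ℝ}
    (hω : ∀ (K : Cell d n) (s : Fin d), ∀ r ∈ Icc 0 (meshSize n), ∀ r' ∈ Icc 0 (meshSize n),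
      ‖G s t (x + corner K + Pi.single s r) - G s t (x + corner K + Pi.single s r')‖ ≤ ω)
    (hG : ∀ (K : Cell d n) (s : Fin d), ∀ r ∈ Icc 0 (meshSize n),
      ‖G s t (x + corner K + Pi.single s r)‖ ≤ G0)
    {q : Cell d n → State d} (hq : ∀ K, 0 < rho (q K)) :
    |∑ K, ∑ s, (1 / 2 * dot (flux γ cv s (q K) + flux γ cv s (q (right K s)))
          (A t (x + corner (right K s)) - A t (x + corner K))
        - dot (diffusion γ cv s (q K) (q (right K s)))
          (A t (x + corner (right K s)) - A t (x + corner K)))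
      - meshSize n * ∑ K, ∑ s, dot (flux γ cv s (q K)) (G s t (x + corner K))|
    ≤ meshSize n * (ω * (∑ K, ∑ s, absSum (flux γ cv s (q K)))
      + 3 * (d + 2) * G0 * ∑ K, ∑ s, lam γ cv s (q K) (q (right K s))
        * absSum (q (right K s) - q K)) := by
  have hh := meshSize_pos (n := n)
  set h := meshSize n with hhdef
  have h0 : (0 : ℝ) ∈ Icc 0 h := left_mem_Icc.2 hh.le
  have hhm : h ∈ Icc 0 h := right_mem_Icc.2 hh.le
  set f : Fin d → Cell d n → ℝ := fun s K => dot (flux γ cv s (q K)) (G s t (x + corner K)) with hf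
  set m : Fin d → Cell d n → ℝ := fun s K => absSum (flux γ cv s (q K)) with hm
  have key : ∀ K s, |1 / 2 * dot (flux γ cv s (q K) + flux γ cv s (q (right K s)))
          (A t (x + corner (right K s)) - A t (x + corner K))
        - dot (diffusion γ cv s (q K) (q (right K s)))
          (A t (x + corner (right K s)) - A t (x + corner K))
        - h * (1 / 2 * (f s K + f s (right K s)))|
      ≤ h * (ω * (1 / 2 * (m s K + m s (right K s))) + 3 * (d + 2) * G0
        * (lam γ cv s (q K) (q (right K s)) * absSum (q (right K s) - q K))) := by
    intro K s
    obtain ⟨e1, e2⟩ := hA.right_eq ht x K s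
    -- The same increment is compared with the gradient at each of the two nodes, so that either
    -- flux is paired with the gradient at its own node. Summing over the torus then yields each
    -- cell's flux term with full weight.
    have i1 := hA.increment_le ht (x + corner K) s hh.le (G s t (x + corner K)) (ω := ω) fun r hr => by
      have := hω K s r hr 0 h0
      simpa using this
    have i2 := hA.increment_le ht (x + corner K) s hh.le (G s t (x + corner (right K s)))
      (ω := ω) fun r hr => by
        rw [e2 s]; exact hω K s r hr h hhm
    have i3 := hA.increment_le ht (x + corner K) s hh.le 0 (ω := G0) fun r hr => by
      rw [sub_zero]; exact hG K s r hr
    rw [smul_zero, sub_zero] at i3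
    rw [← e1] at i1 i2 i3
    set δ := A t (x + corner (right K s)) - A t (x + corner K)
    have b1 := (abs_dot_le_absSum (flux γ cv s (q K)) _).trans
      (mul_le_mul_of_nonneg_left i1 (absSum_nonneg _))
    have b2 := (abs_dot_le_absSum (flux γ cv s (q (right K s))) _).trans
      (mul_le_mul_of_nonneg_left i2 (absSum_nonneg _))
    have b3 : |dot (diffusion γ cv s (q K) (q (right K s))) δ|
        ≤ 3 * lam γ cv s (q K) (q (right K s)) * absSum (q (right K s) - q K)
          * ((d + 2) * (G0 * h)) := by
      have hl := lam_nonneg (γ := γ) (cv := cv) s (q K) (q (right K s))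
      refine (abs_dot_diffusion_le hγ hcv (hq K) (hq (right K s)) s δ).trans ?_
      have g1 := len_le_absSum (q (right K s) - q K)
      have g2 := (len_le_absSum δ).trans ((absSum_le_norm δ).trans
        (mul_le_mul_of_nonneg_left i3 (by positivity)))
      have g3 := len_nonneg δ
      have g4 := absSum_nonneg (q (right K s) - q K)
      gcongr
    rw [dot_sub_right, dot_smul_right] at b1 b2
    change |dot (flux γ cv s (q K)) δ - h * f s K| ≤ m s K * (ω * h) at b1
    change |dot (flux γ cv s (q (right K s))) δ - h * f s (right K s)|
      ≤ m s (right K s) * (ω * h) at b2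
    rw [dot_add_left]
    rw [abs_le] at b1 b2 b3 ⊢
    constructor <;> linarith
  have e3 : h * ∑ K, ∑ s, f s K = ∑ K : Cell d n, ∑ s, h * (1 / 2 * (f s K + f s (right K s))) := by
    rw [Finset.sum_comm, Finset.sum_comm (s := Finset.univ (α := Cell d n)), Finset.mul_sum]
    refine Finset.sum_congr rfl fun s _ => ?_
    rw [← Finset.mul_sum, ← Finset.mul_sum, Finset.sum_add_distrib, sum_right (f s)]
    ring
  have e4 : ∑ K : Cell d n, ∑ s, m s K = ∑ K : Cell d n, ∑ s, 1 / 2 * (m s K + m s (right K s)) := by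
    rw [Finset.sum_comm, Finset.sum_comm (s := Finset.univ (α := Cell d n))]
    refine Finset.sum_congr rfl fun s _ => ?_
    rw [← Finset.mul_sum, Finset.sum_add_distrib, sum_right (m s)]
    ring
  rw [e3, e4, ← Finset.sum_sub_distrib]
  refine (Finset.abs_sum_le_sum_abs _ _).trans ?_
  rw [Finset.mul_sum, Finset.mul_sum, ← Finset.sum_add_distrib, Finset.mul_sum]
  refine Finset.sum_le_sum fun K _ => ?_
  rw [← Finset.sum_sub_distrib]
  refine (Finset.abs_sum_le_sum_abs _ _).trans ?_
  rw [Finset.mul_sum, Finset.mul_sum, ← Finset.sum_add_distrib, Finset.mul_sum]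
  exact Finset.sum_le_sum fun s _ => key K s

end field

/-! ## Consistency for test fields -/

lemma production_nonneg {n : ℕ} (hγ : 1 < γ) (hcv : 0 < cv) {q : Cell d n → State d}
    (hq : ∀ K, 0 < rho (q K)) (K : Cell d n) : 0 ≤ production γ cv q K := by
  have ht := temperature_pos hγ hcv (hq K)
  unfold production
  refine mul_nonneg (by positivity) (Finset.sum_nonneg fun s _ => ?_)
  rw [dissipation_eq (hq _) (hq _) s, dissipation_eq (hq _) (hq _) s]
  exact add_nonneg (mul_nonneg (lam_nonneg _ _ _) (jumpForm_nonneg hγ hcv (hq _) (hq _)))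
    (mul_nonneg (lam_nonneg _ _ _) (jumpForm_nonneg hγ hcv (hq _) (hq _)))

section consistency

variable {T : ℝ} {A A' : ℝ → (Fin d → ℝ) → State d} {G : Fin d → ℝ → (Fin d → ℝ) → State d}
variable {n : ℕ} [NeZero n]

/-- The integrand of the weak form at a point. -/
def weakDensity (γ cv : ℝ) (a' : State d) (g : Fin d → State d) (q : State d) : ℝ :=
  dot a' q + ∑ s, dot (flux γ cv s q) (g s)

lemma cellSum_flux_le (hγ : 1 < γ) (hcv : 0 < cv) {B : ℝ} {q : Cell d n → State d}
    (hq : ∀ K, Bounded γ cv B (q K)) (hm : cellSum (fun K => rho (q K)) ≤ B)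
    (he : cellSum (fun K => |ent (q K)|) ≤ B) :
    cellSum (fun K => ∑ s, absSum (flux γ cv s (q K)))
      ≤ d * ((B + d * B ^ 2) * B + d * B + B * B) := by
  rcases isEmpty_or_nonempty (Cell d n) with h0 | h0
  · exact ((h0.false fun _ => 0).elim)
  have hB : 0 ≤ B := by
    have := (hq h0.some).one_le
    linarith
  have h1 : ∀ K, ∑ s, absSum (flux γ cv s (q K))
      ≤ d * (((B + d * B ^ 2) * rho (q K) + d * B) + B * |ent (q K)|) := fun K => by
    refine (Finset.sum_le_sum fun s _ => absSum_flux_le hγ hcv (hq K) s).trans_eq ?_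
    rw [Finset.sum_const, Finset.card_univ, Fintype.card_fin, nsmul_eq_mul]
  refine (cellSum_mono h1).trans ?_
  rw [cellSum_mul, cellSum_add, cellSum_add, cellSum_mul, cellSum_const,
    cellSum_mul]
  gcongr

lemma TestField.continuousOn_shift {H : ℝ × (Fin d → ℝ) → State d}
    (h : ContinuousOn H (Icc 0 T ×ˢ univ)) (x : Fin d → ℝ) :
    ContinuousOn (fun t => H (t, x)) (Icc 0 T) :=
  h.comp (continuous_id.prodMk continuous_const).continuousOn fun _ ht => ⟨ht, mem_univ _⟩

/-- The weak form sampled at the nodes `x + corner K`. -/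
lemma TestField.node_le (hγ : 1 < γ) (hcv : 0 < cv) (hA : TestField T A A' G)
    (hpos : ∀ t ∈ Icc 0 T, ∀ x, 0 ≤ (A t x).2.2) {B : ℝ}
    {q : ℝ → Cell d n → State d} (hq : BoundedSolution γ cv T B q) (x : Fin d → ℝ) {ω G0 : ℝ}
    (hω0 : 0 ≤ ω)
    (hω : ∀ t ∈ Icc 0 T, ∀ (K : Cell d n) (s : Fin d), ∀ r ∈ Icc 0 (meshSize n),
      ∀ r' ∈ Icc 0 (meshSize n),
      ‖G s t (x + corner K + Pi.single s r) - G s t (x + corner K + Pi.single s r')‖ ≤ ω)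
    (hG : ∀ t ∈ Icc 0 T, ∀ (K : Cell d n) (s : Fin d), ∀ r ∈ Icc 0 (meshSize n),
      ‖G s t (x + corner K + Pi.single s r)‖ ≤ G0) {τ : ℝ} (hτ : τ ∈ Icc 0 T) :
    (∫ t in (0 : ℝ)..τ, cellSum fun K => weakDensity γ cv (A' t (x + corner K))
        (fun s => G s t (x + corner K)) (q t K))
      ≤ cellSum (fun K => dot (A τ (x + corner K)) (q τ K))
        - cellSum (fun K => dot (A 0 (x + corner K)) (q 0 K))
        + (τ * (ω * (d * ((B + d * B ^ 2) * B + d * B + B * B)))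
          + 3 * (d + 2) * G0 * ∫ t in (0 : ℝ)..τ, diffRate γ cv (q t)) := by
  have hh := meshSize_pos (n := n)
  have hp : ∀ t ∈ Icc 0 T, ∀ K, 0 < rho (q t K) := fun t ht K => (hq.bdd t ht K).pos
  set F0 := d * ((B + d * B ^ 2) * B + d * B + B * B) with hF0
  set I : ℝ → ℝ := fun t => cellSum fun K => weakDensity γ cv (A' t (x + corner K))
        (fun s => G s t (x + corner K)) (q t K) with hI
  have hIc : ContinuousOn I (Icc 0 T) :=
    continuousOn_const.mul (continuousOn_finsetSum _ fun K _ =>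
      ((TestField.continuousOn_shift hA.cont_time _).state_dot (hq.sol K).1).add
        (continuousOn_finsetSum _ fun s _ =>
          ((hq.sol K).1.state_flux (fun t ht => hp t ht K) s).state_dot
            (TestField.continuousOn_shift (hA.cont_grad s) _)))
  have hDc := hq.sol.continuousOn_diffRate hp
  have hW : ContinuousOn (fun t => -cellSum fun K => dot (A t (x + corner K)) (q t K)) (Icc 0 T) :=
    (continuousOn_const.mul (continuousOn_finsetSum _ fun K _ =>
      (TestField.continuousOn_shift hA.cont _).state_dot (hq.sol K).1)).neg
  have hW' : ∀ t ∈ Ioo 0 T, HasDerivAt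
      (fun t => -cellSum fun K => dot (A t (x + corner K)) (q t K))
      (-cellSum fun K => dot (A' t (x + corner K)) (q t K)
        + dot (A t (x + corner K)) (rhs γ cv (q t) K)) t := fun t ht =>
    ((HasDerivAt.fun_sum fun K _ => (hA.deriv_time t ht _).state_dot
      ((hq.sol K).2 t ht)).const_mul _).neg
  have hint : ∀ f : ℝ → ℝ, ContinuousOn f (Icc 0 T) → IntervalIntegrable f volume 0 τ :=
    fun f hf => (hf.mono (by rw [uIcc_of_le hτ.1]; exact Icc_subset_Icc_right hτ.2)).intervalIntegrable
  -- Applied to minus the tested average, since the comparison lemma bounds increments from above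
  -- and a lower bound is wanted.
  have main := sub_le_integral_of_deriv_le
    (g := fun t => -I t + (ω * F0 + 3 * (d + 2) * G0 * diffRate γ cv (q t))) hτ hW hW'
    (hIc.neg.add (continuousOn_const.add (continuousOn_const.mul hDc))) ?_
  · have hDc' : ContinuousOn (fun t => 3 * (d + 2) * G0 * diffRate γ cv (q t)) (Icc 0 T) :=
      continuousOn_const.mul hDc
    rw [intervalIntegral.integral_add (f := fun t => -I t)
        (g := fun t => ω * F0 + 3 * (d + 2) * G0 * diffRate γ cv (q t)) (hint _ hIc.neg)
        (hint _ (continuousOn_const.add hDc')),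
      intervalIntegral.integral_add (hint _ continuousOn_const) (hint _ hDc'),
      intervalIntegral.integral_neg,
      intervalIntegral.integral_const, intervalIntegral.integral_const_mul] at main
    simp only [sub_zero, smul_eq_mul] at main
    linarith
  · intro t ht
    have ht' := Ioo_subset_Icc_self ht
    have e := sum_dot_rhs (γ := γ) (cv := cv) (q t) fun K => A t (x + corner K)
    have f := hA.flux_error_le hγ hcv ht' x (hω t ht') (hG t ht') (hp t ht')
    -- Only the sign of the production is used; this is where the equation becomes an inequality.
    have g : 0 ≤ 1 / meshSize n * ∑ K, (A t (x + corner K)).2.2 * production γ cv (q t) K :=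
      mul_nonneg (one_div_nonneg.2 hh.le) (Finset.sum_nonneg fun K _ =>
        mul_nonneg (hpos t ht' _) (production_nonneg hγ hcv (hp t ht') K))
    have f0 := cellSum_flux_le hγ hcv (hq.bdd t ht') (hq.mass t ht') (hq.entropy t ht')
    have f1 := mul_le_mul_of_nonneg_left f0 hω0
    set X := ∑ K, ∑ s,
      (1 / 2 * dot (flux γ cv s (q t K) + flux γ cv s (q t (right K s)))
          (A t (x + corner (right K s)) - A t (x + corner K))
        - dot (diffusion γ cv s (q t K) (q t (right K s)))
          (A t (x + corner (right K s)) - A t (x + corner K)))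
    set Y := ∑ K, ∑ s, dot (flux γ cv s (q t K)) (G s t (x + corner K)) with hY
    set U := ∑ K, ∑ s, absSum (flux γ cv s (q t K)) with hU
    set V := ∑ K, ∑ s, lam γ cv s (q t K) (q t (right K s))
        * absSum (q t (right K s) - q t K) with hV
    have k1 : Y - (ω * U + 3 * (d + 2) * G0 * V) ≤ 1 / meshSize n * X := by
      rw [one_div, ← div_eq_inv_mul, le_div_iff₀ hh]
      have := (abs_le.1 f).1
      linarith
    have k2 := mul_le_mul_of_nonneg_left (k1.trans (le_add_of_nonneg_right g))
      (pow_nonneg hh.le d)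
    rw [← e] at k2
    have e1 : I t = meshSize n ^ d * ((∑ K, dot (A' t (x + corner K)) (q t K)) + Y) := by
      simp only [hI, cellSum, weakDensity, Finset.sum_add_distrib, hY]
    have e2 : (cellSum fun K => dot (A' t (x + corner K)) (q t K)
        + dot (A t (x + corner K)) (rhs γ cv (q t) K))
        = meshSize n ^ d * ((∑ K, dot (A' t (x + corner K)) (q t K))
          + ∑ K, dot (A t (x + corner K)) (rhs γ cv (q t) K)) := by
      simp only [cellSum, Finset.sum_add_distrib]
    have e3 : diffRate γ cv (q t) = meshSize n ^ d * V := rfl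
    have e4 : (cellSum fun K => ∑ s, absSum (flux γ cv s (q t K))) = meshSize n ^ d * U := rfl
    rw [e4] at f1
    rw [e1, e2, e3]
    linarith

/-- The residual of the weak form on the torus. -/
def weakError (γ cv : ℝ) (A A' : ℝ → (Fin d → ℝ) → State d)
    (G : Fin d → ℝ → (Fin d → ℝ) → State d) (q : ℝ → Cell d n → State d) (τ : ℝ) : ℝ :=
  (∫ x in Omega d, dot (A τ x) (pwc (q τ) x)) - (∫ x in Omega d, dot (A 0 x) (pwc (q 0) x))
    - ∫ t in (0 : ℝ)..τ, ∫ x in Omega d, weakDensity γ cv (A' t x) (fun s => G s t x) (pwc (q t) x)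

/-- Average of the nodal inequality over all offsets in one cell; Fubini exchanges this average with
the time integral. The bounds `ω` and `G0` do not depend on the offset. -/
lemma TestField.le_weakError (hγ : 1 < γ) (hcv : 0 < cv) (hA : TestField T A A' G)
    (hpos : ∀ t ∈ Icc 0 T, ∀ x, 0 ≤ (A t x).2.2) {B : ℝ}
    {q : ℝ → Cell d n → State d} (hq : BoundedSolution γ cv T B q) {ω G0 : ℝ} (hω0 : 0 ≤ ω)
    (hω : ∀ t ∈ Icc 0 T, ∀ x ∈ Icc (0 : Fin d → ℝ) fun _ => meshSize n,
      ∀ (K : Cell d n) (s : Fin d), ∀ r ∈ Icc 0 (meshSize n), ∀ r' ∈ Icc 0 (meshSize n),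
      ‖G s t (x + corner K + Pi.single s r) - G s t (x + corner K + Pi.single s r')‖ ≤ ω)
    (hG : ∀ t ∈ Icc 0 T, ∀ x ∈ Icc (0 : Fin d → ℝ) fun _ => meshSize n,
      ∀ (K : Cell d n) (s : Fin d), ∀ r ∈ Icc 0 (meshSize n),
      ‖G s t (x + corner K + Pi.single s r)‖ ≤ G0) {τ : ℝ} (hτ : τ ∈ Icc 0 T) :
    -(τ * (ω * (d * ((B + d * B ^ 2) * B + d * B + B * B)))
          + 3 * (d + 2) * G0 * ∫ t in (0 : ℝ)..τ, diffRate γ cv (q t))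
      ≤ weakError γ cv A A' G q τ := by
  have hh := meshSize_pos (n := n)
  have hp : ∀ t ∈ Icc 0 T, ∀ K, 0 < rho (q t K) := fun t ht K => (hq.bdd t ht K).pos
  have hsub : Icc 0 τ ⊆ Icc 0 T := Icc_subset_Icc_right hτ.2
  set R := τ * (ω * (d * ((B + d * B ^ 2) * B + d * B + B * B)))
    + 3 * (d + 2) * G0 * ∫ t in (0 : ℝ)..τ, diffRate γ cv (q t) with hR
  set P : ℝ → (Fin d → ℝ) → ℝ := fun t x => cellSum fun K =>
    weakDensity γ cv (A' t (x + corner K)) (fun s => G s t (x + corner K)) (q t K) with hP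
  set W : ℝ → (Fin d → ℝ) → ℝ := fun t x => cellSum fun K => dot (A t (x + corner K)) (q t K) with hW
  have hAx : ∀ t ∈ Icc 0 T, ∀ K : Cell d n, Continuous fun x => dot (A t x) (q t K) := fun t ht K => by
    rw [← continuousOn_univ]
    exact ContinuousOn.state_dot (hA.cont.comp
      (continuous_const.prodMk continuous_id).continuousOn fun x _ => ⟨ht, mem_univ _⟩)
      continuousOn_const
  have hWc : ∀ t ∈ Icc 0 T, IntegrableOn (W t) (unitCell d n) := fun t ht =>
    integrableOn_unitCell (continuousOn_const.mul (continuousOn_finsetSum _ fun K _ =>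
      ((hAx t ht K).comp (continuous_id.add continuous_const)).continuousOn))
  have hcomp : ∀ (H : ℝ × (Fin d → ℝ) → State d), ContinuousOn H (Icc 0 T ×ˢ univ) →
      ∀ c : Fin d → ℝ, ContinuousOn (fun z : ℝ × (Fin d → ℝ) => H (z.1, z.2 + c))
        (Icc 0 T ×ˢ univ) := fun H hH c =>
    hH.comp (continuous_fst.prodMk (continuous_snd.add continuous_const)).continuousOn
      fun z hz => ⟨hz.1, mem_univ _⟩
  have hqc : ∀ K, ContinuousOn (fun z : ℝ × (Fin d → ℝ) => q z.1 K) (Icc 0 T ×ˢ univ) := fun K =>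
    (hq.sol K).1.comp continuousOn_fst fun z hz => hz.1
  have hD : ∀ (K : Cell d n) (c : Fin d → ℝ), ContinuousOn (fun z : ℝ × (Fin d → ℝ) =>
      weakDensity γ cv (A' z.1 (z.2 + c)) (fun s => G s z.1 (z.2 + c)) (q z.1 K))
      (Icc 0 T ×ˢ univ) := fun K c =>
    ((hcomp _ hA.cont_time c).state_dot (hqc K)).add (continuousOn_finsetSum _ fun s _ =>
      ((hqc K).state_flux (fun z hz => hp z.1 hz.1 K) s).state_dot (hcomp _ (hA.cont_grad s) c))
  have hPc : ContinuousOn (Function.uncurry P) (Icc 0 T ×ˢ univ) :=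
    continuousOn_const.mul (continuousOn_finsetSum _ fun K _ => hD K _)
  have hPi : Integrable (Function.uncurry P)
      ((volume.restrict (uIoc 0 τ)).prod (volume.restrict (unitCell d n))) := by
    rw [Measure.prod_restrict, ← Measure.volume_eq_prod, uIoc_of_le hτ.1]
    refine IntegrableOn.mono_set (t := Icc 0 τ ×ˢ Icc 0 fun _ => meshSize n) ?_
      (prod_mono Ioc_subset_Icc_self unitCell_subset)
    exact (hPc.mono (prod_mono hsub (subset_univ _))).integrableOn_compact
      (isCompact_Icc.prod isCompact_Icc)
  have e1 : ∀ t ∈ Icc 0 T, ∫ x in Omega d, dot (A t x) (pwc (q t) x)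
      = (meshSize n ^ d)⁻¹ * ∫ x in unitCell d n, W t x := fun t ht =>
    integral_omega_eq (Γ := fun K x => dot (A t x) (q t K)) fun K => (hAx t ht K).continuousOn
  have e2 : ∀ t ∈ Icc 0 T, ∫ x in Omega d,
      weakDensity γ cv (A' t x) (fun s => G s t x) (pwc (q t) x)
      = (meshSize n ^ d)⁻¹ * ∫ x in unitCell d n, P t x := fun t ht =>
    integral_omega_eq
      (Γ := fun K x => weakDensity γ cv (A' t x) (fun s => G s t x) (q t K)) fun K => by
        have := (hD K 0).comp (continuous_const.prodMk continuous_id).continuousOn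
          (fun x (_ : x ∈ Icc (0 : Fin d → ℝ) 1) => ⟨ht, mem_univ x⟩)
        simpa [Function.comp_def] using this
  have e3 : (∫ t in (0 : ℝ)..τ, ∫ x in Omega d,
      weakDensity γ cv (A' t x) (fun s => G s t x) (pwc (q t) x))
      = (meshSize n ^ d)⁻¹ * ∫ x in unitCell d n, ∫ t in (0 : ℝ)..τ, P t x := by
    rw [← intervalIntegral_integral_swap hPi, ← intervalIntegral.integral_const_mul]
    refine intervalIntegral.integral_congr fun t ht => ?_
    rw [uIcc_of_le hτ.1] at ht
    exact e2 t (hsub ht)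
  have hPx : IntegrableOn (fun x => ∫ t in (0 : ℝ)..τ, P t x) (unitCell d n) := by
    have := hPi.integral_prod_right
    simp only [intervalIntegral.integral_of_le hτ.1]
    rwa [uIoc_of_le hτ.1] at this
  have hle : ∫ x in unitCell d n, ∫ t in (0 : ℝ)..τ, P t x
      ≤ ∫ x in unitCell d n, (W τ x - W 0 x + R) := by
    refine setIntegral_mono_on hPx (((hWc τ hτ).sub (hWc 0 ⟨le_rfl, hτ.1.trans hτ.2⟩)).add ?_)
      measurableSet_unitCell fun x hx => ?_
    · exact integrableOn_unitCell continuousOn_const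
    · have hx' := unitCell_subset hx
      exact hA.node_le hγ hcv hpos hq x hω0 (fun t ht => hω t ht x hx')
        (fun t ht => hG t ht x hx') hτ
  have hT0 : (0 : ℝ) ∈ Icc 0 T := ⟨le_rfl, hτ.1.trans hτ.2⟩
  rw [integral_add (f := fun x => W τ x - W 0 x) ((hWc τ hτ).sub (hWc 0 hT0))
    (integrableOn_unitCell continuousOn_const),
    integral_sub (hWc τ hτ) (hWc 0 hT0), setIntegral_const, measureReal_def, volume_unitCell,
    smul_eq_mul] at hle
  have hv : 0 < meshSize n ^ d := pow_pos hh d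
  have h2 := mul_le_mul_of_nonneg_left hle (inv_nonneg.2 hv.le)
  rw [mul_add, ← mul_assoc _ (meshSize n ^ d), inv_mul_cancel₀ hv.ne', one_mul, mul_sub] at h2
  unfold weakError
  rw [e1 τ hτ, e1 0 hT0, e3]
  linarith

end consistency

/-- Asymptotic one-sided consistency for test fields with nonnegative entropy component. -/
lemma TestField.eventually_le_weakError {T : ℝ} {A A' : ℝ → (Fin d → ℝ) → State d}
    {G : Fin d → ℝ → (Fin d → ℝ) → State d} (hγ : 1 < γ) (hcv : 0 < cv) (hT : 0 < T)
    (hA : TestField T A A' G) (hpos : ∀ t ∈ Icc 0 T, ∀ x, 0 ≤ (A t x).2.2) {B : ℝ} (hB : 1 ≤ B)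
    {τ : ℝ} (hτ : τ ∈ Icc 0 T) {ε : ℝ} (hε : 0 < ε) :
    ∃ N : ℕ, ∀ n, N ≤ n → ∀ [NeZero n] (q : ℝ → Cell d n → State d),
      BoundedSolution γ cv T B q → -ε ≤ weakError γ cv A A' G q τ := by
  obtain ⟨⟨G0, hG0, hG⟩, hu⟩ := hA.exists_bounds
  obtain ⟨e, N1, he, hN1⟩ := exists_diffRate_bound d hγ hcv hT hB
  have hB0 : 0 ≤ B := by linarith
  set F0 := d * ((B + d * B ^ 2) * B + d * B + B * B) with hF0
  have hF : 0 ≤ F0 := by positivity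
  have hτ0 := hτ.1
  -- Half of `ε` is for the modulus of continuity times the flux bound `F0`, half for the diffusion;
  -- the added `1` avoids a vanishing denominator.
  set ω := ε / (2 * (τ * F0 + 1)) with hω
  have hω0 : 0 < ω := by positivity
  have hωle : τ * (ω * F0) ≤ ε / 2 := by
    have : τ * (ω * F0) = ε / 2 * (τ * F0 / (τ * F0 + 1)) := by rw [hω]; field_simp
    rw [this]
    refine mul_le_of_le_one_right (by positivity) ?_
    rw [div_le_one (by positivity)]
    linarith
  obtain ⟨δ, hδ, hu⟩ := hu ω hω0
  have he2 : Tendsto (fun n => 3 * (d + 2) * G0 * e n) atTop (𝓝 0) := by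
    simpa using he.const_mul (3 * (d + 2) * G0)
  obtain ⟨N2, hN2⟩ := eventually_atTop.1 (he2.eventually_le_const (half_pos hε))
  obtain ⟨N3, hN3⟩ := exists_nat_one_div_lt hδ
  refine ⟨max N1 (max N2 (N3 + 1)), fun n hn _ q hq => ?_⟩
  have hn1 : N1 ≤ n := (le_max_left _ _).trans hn
  have hn2 : N2 ≤ n := ((le_max_left _ _).trans (le_max_right _ _)).trans hn
  have hn3 : N3 + 1 ≤ n := ((le_max_right _ _).trans (le_max_right _ _)).trans hn
  have hh := meshSize_pos (n := n)
  have hmesh : meshSize n < δ := by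
    refine lt_of_le_of_lt ?_ hN3
    exact one_div_le_one_div_of_le (by positivity) (by exact_mod_cast hn3)
  have hmem : ∀ x ∈ Icc (0 : Fin d → ℝ) fun _ => meshSize n, ∀ (K : Cell d n) (s : Fin d),
      ∀ r ∈ Icc 0 (meshSize n), x + corner K + Pi.single s r ∈ Icc (0 : Fin d → ℝ) 2 := by
    intro x hx K s r hr
    have h1 := add_corner_mem hx K
    have h3 : meshSize n ≤ 1 := by
      have := corner_add_le K s
      have := corner_nonneg K s
      linarith
    have h2 : ∀ i, (Pi.single s r : Fin d → ℝ) i ∈ Icc (0 : ℝ) 1 := fun i => by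
      rcases eq_or_ne i s with rfl | hi
      · rw [Pi.single_eq_same]; exact ⟨hr.1, hr.2.trans h3⟩
      · rw [Pi.single_eq_of_ne hi]; exact ⟨le_rfl, zero_le_one⟩
    refine ⟨fun i => add_nonneg (h1.1 i) (h2 i).1, fun i => ?_⟩
    have := h1.2 i
    have := (h2 i).2
    simp only [Pi.add_apply, Pi.ofNat_apply] at *
    linarith
  have main := hA.le_weakError hγ hcv hpos hq hω0.le (fun t ht x hx K s r hr r' hr' =>
      hu s t ht _ (hmem x hx K s r hr) _ (hmem x hx K s r' hr') ?_)
    (fun t ht x hx K s r hr => hG s t ht _ (hmem x hx K s r hr)) hτ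
  · have h1 := mul_le_mul_of_nonneg_left (hN1 n hn1 q hq τ hτ)
      (by positivity : 0 ≤ 3 * ((d : ℝ) + 2) * G0)
    have h2 := hN2 n hn2
    linarith
  · refine lt_of_le_of_lt ?_ hmesh
    rw [dist_add_left]
    refine (dist_pi_le_iff hh.le).2 fun i => ?_
    rcases eq_or_ne i s with rfl | hi
    · rw [Pi.single_eq_same, Pi.single_eq_same, Real.dist_eq, abs_le]
      constructor <;> linarith [hr.1, hr.2, hr'.1, hr'.2]
    · rw [Pi.single_eq_of_ne hi, Pi.single_eq_of_ne hi, dist_self]; exact hh.le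

section limits

variable {T : ℝ} {A A' : ℝ → (Fin d → ℝ) → State d} {G : Fin d → ℝ → (Fin d → ℝ) → State d}

lemma weakError_neg {n : ℕ} (q : ℝ → Cell d n → State d) (τ : ℝ) :
    weakError γ cv (fun t x => -A t x) (fun t x => -A' t x) (fun s t x => -G s t x) q τ
      = -weakError γ cv A A' G q τ := by
  have h1 : ∀ a b : State d, dot (-a) b = -dot a b := fun a b => by
    have := dot_smul_left (-1) a b
    simpa using this
  have h2 : ∀ a b : State d, dot b (-a) = -dot b a := fun a b => by
    rw [dot_comm, h1, dot_comm]
  unfold weakError weakDensity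
  simp only [h1, h2, Finset.sum_neg_distrib, ← neg_add, integral_neg, intervalIntegral.integral_neg]
  ring

/-- Without an entropy component the production is invisible, so the one-sided estimate holds for
the field and for its negative. -/
lemma TestField.tendsto_weakError (hγ : 1 < γ) (hcv : 0 < cv) (hT : 0 < T)
    (hA : TestField T A A' G) (h0 : ∀ t x, (A t x).2.2 = 0) {B : ℝ} (hB : 1 ≤ B) {n : ℕ → ℕ}
    [∀ k, NeZero (n k)] (hn : Tendsto n atTop atTop) {q : (k : ℕ) → ℝ → Cell d (n k) → State d}
    (hq : ∀ k, BoundedSolution γ cv T B (q k)) {τ : ℝ} (hτ : τ ∈ Icc 0 T) :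
    Tendsto (fun k => weakError γ cv A A' G (q k) τ) atTop (𝓝 0) := by
  rw [Metric.tendsto_nhds]
  intro ε hε
  obtain ⟨N1, h1⟩ := hA.eventually_le_weakError hγ hcv hT (fun t _ x => (h0 t x).ge) hB hτ
    (half_pos hε)
  obtain ⟨N2, h2⟩ := hA.neg.eventually_le_weakError hγ hcv hT
    (fun t _ x => by simp [h0 t x]) hB hτ (half_pos hε)
  filter_upwards [hn.eventually_ge_atTop N1, hn.eventually_ge_atTop N2] with k hk1 hk2
  have g1 := h1 (n k) hk1 (q k) (hq k)
  have g2 := h2 (n k) hk2 (q k) (hq k)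
  rw [weakError_neg] at g2
  rw [Real.dist_0_eq_abs, abs_lt]
  constructor <;> linarith

lemma TestField.tendsto_min_weakError (hγ : 1 < γ) (hcv : 0 < cv) (hT : 0 < T)
    (hA : TestField T A A' G) (h0 : ∀ t ∈ Icc 0 T, ∀ x, 0 ≤ (A t x).2.2) {B : ℝ} (hB : 1 ≤ B)
    {n : ℕ → ℕ}
    [∀ k, NeZero (n k)] (hn : Tendsto n atTop atTop) {q : (k : ℕ) → ℝ → Cell d (n k) → State d}
    (hq : ∀ k, BoundedSolution γ cv T B (q k)) {τ : ℝ} (hτ : τ ∈ Icc 0 T) :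
    Tendsto (fun k => min 0 (weakError γ cv A A' G (q k) τ)) atTop (𝓝 0) := by
  rw [Metric.tendsto_nhds]
  intro ε hε
  obtain ⟨N1, h1⟩ := hA.eventually_le_weakError hγ hcv hT h0 hB hτ (half_pos hε)
  filter_upwards [hn.eventually_ge_atTop N1] with k hk1
  have g1 := h1 (n k) hk1 (q k) (hq k)
  have g2 : min 0 (weakError γ cv A A' G (q k) τ) ≤ 0 := min_le_left _ _
  have g3 : -(ε / 2) ≤ min 0 (weakError γ cv A A' G (q k) τ) := le_min (by linarith) g1
  rw [Real.dist_0_eq_abs, abs_lt]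
  constructor <;> linarith

lemma IsSolution.integral_energy {n : ℕ} [NeZero n] (hγ : 1 < γ) (hcv : 0 < cv)
    {q : ℝ → Cell d n → State d}
    (hq : IsSolution γ cv T q) (hpos : ∀ t ∈ Icc 0 T, ∀ K, 0 < rho (q t K)) {τ : ℝ}
    (hτ : τ ∈ Icc 0 T) :
    ∫ x in Omega d, totalEnergy γ cv (pwc (q τ) x)
      = ∫ x in Omega d, totalEnergy γ cv (pwc (q 0) x) := by
  have h : ∀ t, ∫ x in Omega d, totalEnergy γ cv (pwc (q t) x) = (meshSize n ^ d)⁻¹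
      * ∫ x in unitCell d n, cellSum fun K => totalEnergy γ cv (q t K) := fun t =>
    integral_omega_eq (Γ := fun K _ => totalEnergy γ cv (q t K)) fun K => continuousOn_const
  rw [h, h]
  unfold cellSum
  rw [hq.sum_energy hγ hcv hpos hτ]

end limits

/-! ## The test functions of the weak formulation -/

section tests

variable {F : Type*} [NormedAddCommGroup F] [NormedSpace ℝ F] {T : ℝ} {φ : ℝ → (Fin d → ℝ) → F}

/-- A test function, embedded linearly in the state space, is a test field. -/
lemma IsTest.exists_testField (hφ : IsTest T φ) : ∃ ψ : ℝ → (Fin d → ℝ) → F,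
    (∀ t ∈ Ioo 0 T, ∀ x, HasDerivAt (fun t => φ t x) (ψ t x) t) ∧
    ∀ L : F →L[ℝ] State d, TestField T (fun t x => L (φ t x)) (fun t x => L (ψ t x))
      fun s t x => L (fderiv ℝ (φ t) x (Pi.single s 1)) := by
  obtain ⟨ψ, -, hψ⟩ := hφ.time_deriv
  -- Evaluation of an iterated derivative at fixed vectors is continuous; order zero recovers the
  -- function itself and order one the partial derivatives.
  have happ : ∀ (j : ℕ) (m : Fin j → Fin d → ℝ) {H : ℝ × (Fin d → ℝ) → (Fin d → ℝ) [×j]→L[ℝ] F},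
      ContinuousOn H (Icc 0 T ×ˢ univ) → ContinuousOn (fun z => H z m) (Icc 0 T ×ˢ univ) :=
    fun j m H hH =>
      (ContinuousMultilinearMap.apply ℝ (fun _ : Fin j => Fin d → ℝ) F m).continuous.comp_continuousOn hH
  have hder : ∀ t ∈ Ioo 0 T, ∀ x, HasDerivAt (fun t => φ t x) (ψ t x) t := fun t ht x => by
    have h1 := (hψ 0 (by norm_num)).2 t (Ioo_subset_Icc_self ht) x
    have h2 := (ContinuousMultilinearMap.apply ℝ (fun _ : Fin 0 => Fin d → ℝ) F
      0).hasFDerivAt.comp_hasDerivWithinAt t h1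
    exact h2.hasDerivAt (Icc_mem_nhds ht.1 ht.2)
  have hdiff : ∀ t ∈ Icc 0 T, Differentiable ℝ (φ t) := fun t ht =>
    (hφ.contDiff t ht).differentiable (by norm_num)
  refine ⟨ψ, hder, fun L => ?_⟩
  constructor
  · exact L.continuous.comp_continuousOn (happ 0 0 (hφ.continuous_deriv 0 (by norm_num)))
  · exact L.continuous.comp_continuousOn (happ 0 0 (hψ 0 (by norm_num)).1)
  · intro s
    have := happ 1 (fun _ => Pi.single s 1) (hφ.continuous_deriv 1 (by norm_num))
    simp only [iteratedFDeriv_one_apply] at this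
    exact L.continuous.comp_continuousOn this
  · intro t ht x s
    rw [hφ.periodic t ht]
  · intro t ht x s s'
    have h1 : (fun y => φ t (y + Pi.single s 1)) = φ t := funext fun y => hφ.periodic t ht y s
    have h2 := fderiv_comp_add_right (𝕜 := ℝ) (f := φ t) (x := x) (Pi.single s 1)
    rw [h1] at h2
    rw [← h2]
  · intro t ht x
    exact L.hasFDerivAt.comp_hasDerivAt t (hder t ht x)
  · intro t ht x s
    refine L.hasFDerivAt.comp_hasDerivAt (0 : ℝ) ?_
    have h1 : HasDerivAt (fun r : ℝ => x + r • (Pi.single s 1 : Fin d → ℝ)) (Pi.single s 1) 0 := by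
      have := ((hasDerivAt_id (0 : ℝ)).smul_const (Pi.single s 1 : Fin d → ℝ)).const_add x
      simpa using this
    have h2 : HasFDerivAt (φ t) (fderiv ℝ (φ t) x) (x + (0 : ℝ) • (Pi.single s 1 : Fin d → ℝ)) := by
      rw [zero_smul, add_zero]; exact (hdiff t ht x).hasFDerivAt
    have h3 := h2.comp_hasDerivAt (0 : ℝ) h1
    refine h3.congr_of_eventuallyEq (Eventually.of_forall fun r => ?_)
    simp only [Function.comp_apply]
    rw [← Pi.single_smul, smul_eq_mul, mul_one]

/-- The embedding of the density component. -/
def rhoEmb (d : ℕ) : ℝ →L[ℝ] State d := ContinuousLinearMap.inl ℝ ℝ _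

/-- The embedding of the momentum component. -/
def momEmb (d : ℕ) : (Fin d → ℝ) →L[ℝ] State d :=
  (ContinuousLinearMap.inr ℝ ℝ _).comp (ContinuousLinearMap.inl ℝ _ ℝ)

/-- The embedding of the entropy component. -/
def entEmb (d : ℕ) : ℝ →L[ℝ] State d :=
  (ContinuousLinearMap.inr ℝ ℝ _).comp (ContinuousLinearMap.inr ℝ (Fin d → ℝ) ℝ)

lemma rhoEmb_apply (a : ℝ) : rhoEmb d a = (a, 0, 0) := rfl

lemma momEmb_apply (a : Fin d → ℝ) : momEmb d a = (0, a, 0) := rfl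

lemma entEmb_apply (a : ℝ) : entEmb d a = (0, 0, a) := rfl

/-- The integrands need agree only at interior times, where the derivative in time is two-sided: the
interval `(0, τ]` lies in `(0, T)` because `τ < T`. -/
lemma integral_weakDensity_congr {n : ℕ} {A' : ℝ → (Fin d → ℝ) → State d}
    {G : Fin d → ℝ → (Fin d → ℝ) → State d} {q : ℝ → Cell d n → State d} {τ : ℝ}
    (hτ : τ ∈ Ioo 0 T) {f : ℝ → (Fin d → ℝ) → ℝ}
    (h : ∀ t ∈ Ioo 0 T, ∀ x, f t x = weakDensity γ cv (A' t x) (fun s => G s t x) (pwc (q t) x)) :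
    ∫ t in (0 : ℝ)..τ, ∫ x in Omega d, f t x = ∫ t in (0 : ℝ)..τ, ∫ x in Omega d,
      weakDensity γ cv (A' t x) (fun s => G s t x) (pwc (q t) x) := by
  rw [intervalIntegral.integral_of_le hτ.1.le, intervalIntegral.integral_of_le hτ.1.le]
  refine setIntegral_congr_fun measurableSet_Ioc fun t ht => ?_
  exact integral_congr_ae (Eventually.of_forall fun x => h t ⟨ht.1, ht.2.trans_lt hτ.2⟩ x)

lemma densityError_eq {n : ℕ} {φ ψ : ℝ → (Fin d → ℝ) → ℝ}
    (hψ : ∀ t ∈ Ioo 0 T, ∀ x, HasDerivAt (fun t => φ t x) (ψ t x) t)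
    (q : ℝ → Cell d n → State d) {τ : ℝ} (hτ : τ ∈ Ioo 0 T) :
    densityError q φ τ = weakError γ cv (fun t x => rhoEmb d (φ t x)) (fun t x => rhoEmb d (ψ t x))
      (fun s t x => rhoEmb d (fderiv ℝ (φ t) x (Pi.single s 1))) q τ := by
  have e : ∀ (a : ℝ) (u : State d), dot (rhoEmb d a) u = rho u * a := fun a u => by
    simp [dot, rhoEmb_apply, rho, mul_comm]
  unfold densityError weakError
  simp only [e]
  congr 1
  refine integral_weakDensity_congr hτ fun t ht x => ?_
  unfold weakDensity
  simp only [dot_comm (flux _ _ _ _), e]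
  rw [(hψ t ht x).deriv]
  rfl

lemma entropyError_eq {n : ℕ} {φ ψ : ℝ → (Fin d → ℝ) → ℝ}
    (hψ : ∀ t ∈ Ioo 0 T, ∀ x, HasDerivAt (fun t => φ t x) (ψ t x) t)
    (q : ℝ → Cell d n → State d) {τ : ℝ} (hτ : τ ∈ Ioo 0 T) :
    entropyError q φ τ = weakError γ cv (fun t x => entEmb d (φ t x)) (fun t x => entEmb d (ψ t x))
      (fun s t x => entEmb d (fderiv ℝ (φ t) x (Pi.single s 1))) q τ := by
  have e : ∀ (a : ℝ) (u : State d), dot (entEmb d a) u = ent u * a := fun a u => by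
    simp [dot, entEmb_apply, ent, mul_comm]
  unfold entropyError weakError
  simp only [e]
  congr 1
  refine integral_weakDensity_congr hτ fun t ht x => ?_
  unfold weakDensity
  simp only [dot_comm (flux _ _ _ _), e]
  rw [(hψ t ht x).deriv]
  congr 1
  refine Finset.sum_congr rfl fun s _ => ?_
  rw [mul_comm (mom _ _)]
  rfl

lemma momentumError_eq {n : ℕ} {φ ψ : ℝ → (Fin d → ℝ) → (Fin d → ℝ)}
    (hφ : ∀ t ∈ Icc 0 T, ContDiff ℝ 2 (φ t))
    (hψ : ∀ t ∈ Ioo 0 T, ∀ x, HasDerivAt (fun t => φ t x) (ψ t x) t)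
    (q : ℝ → Cell d n → State d) {τ : ℝ} (hτ : τ ∈ Ioo 0 T) :
    momentumError γ cv q φ τ = weakError γ cv (fun t x => momEmb d (φ t x))
      (fun t x => momEmb d (ψ t x))
      (fun s t x => momEmb d (fderiv ℝ (φ t) x (Pi.single s 1))) q τ := by
  have e : ∀ (a : Fin d → ℝ) (u : State d), dot (momEmb d a) u = ∑ i, mom u i * a i := fun a u => by
    simp [dot, momEmb_apply, mom, mul_comm]
  unfold momentumError weakError
  simp only [e]
  congr 1
  refine integral_weakDensity_congr hτ fun t ht x => ?_
  have hd := (hφ t (Ioo_subset_Icc_self ht)).differentiable (by norm_num) x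
  unfold weakDensity
  simp only [dot_comm (flux _ _ _ _), e]
  congr 1
  · exact Finset.sum_congr rfl fun i _ => by rw [(hasDerivAt_pi.1 (hψ t ht x) i).deriv]
  · rw [Finset.sum_comm]
    refine Finset.sum_congr rfl fun s _ => Finset.sum_congr rfl fun i _ => ?_
    have : pderiv s (fun y => φ t y i) x = fderiv ℝ (φ t) x (Pi.single s 1) i := by
      unfold pderiv
      rw [(hasFDerivAt_pi'.1 hd.hasFDerivAt i).fderiv]
      rfl
    rw [this]
    rfl

end tests

end HTC

end

theorem mainTheorem3 (d : ℕ) (hd1 : 1 ≤ d) (hd3 : d ≤ 3) (γ cv T : ℝ) (hγ : 1 < γ) (hcv : 0 < cv)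
    (hT : 0 < T)
    (n : ℕ → ℕ) [∀ k, NeZero (n k)] (hn : Tendsto n atTop atTop)
    (q : (k : ℕ) → ℝ → HTC.Cell d (n k) → HTC.State d)
    (hq : ∀ k, HTC.IsSolution γ cv T (q k))
    (hinit : ∃ C : ℝ, ∀ k K, ‖q k 0 K‖ ≤ C)
    (ρlow Ebar : ℝ) (hρlow : 0 < ρlow) (hEbar : 0 < Ebar)
    (hdensity : ∀ k, ∀ t ∈ Icc 0 T, ∀ K, ρlow ≤ HTC.rho (q k t K))
    (henergy : ∀ k, ∀ t ∈ Icc 0 T, ∀ K, HTC.totalEnergy γ cv (q k t K) ≤ Ebar) :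
    ∀ τ ∈ Ioo 0 T,
      (∀ φ : ℝ → (Fin d → ℝ) → ℝ, HTC.IsTest T φ →
        Tendsto (fun k => HTC.densityError (q k) φ τ) atTop (𝓝 0)) ∧
      (∀ φ : ℝ → (Fin d → ℝ) → (Fin d → ℝ), HTC.IsTest T φ →
        Tendsto (fun k => HTC.momentumError γ cv (q k) φ τ) atTop (𝓝 0)) ∧
      (∀ φ : ℝ → (Fin d → ℝ) → ℝ, HTC.IsTest T φ → (∀ t ∈ Icc 0 T, ∀ x, 0 ≤ φ t x) →
        ∃ ε : ℕ → ℝ, Tendsto ε atTop (𝓝 0) ∧ ∀ k, ε k ≤ HTC.entropyError (q k) φ τ) ∧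
      (∀ k, ∫ x in HTC.Omega d, HTC.totalEnergy γ cv (HTC.pwc (q k τ) x)
        = ∫ x in HTC.Omega d, HTC.totalEnergy γ cv (HTC.pwc (q k 0) x)) := by
  intro τ hτ
  obtain ⟨C, hC⟩ := hinit
  obtain ⟨B, hB, hb⟩ := HTC.exists_boundedSolution d hγ hcv hT hρlow hEbar C
  have hbs : ∀ k, HTC.BoundedSolution γ cv T B (q k) := fun k =>
    hb (n k) (q k) (hq k) (hC k) (hdensity k) (henergy k)
  have hτ' := Ioo_subset_Icc_self hτ
  refine ⟨fun φ hφ => ?_, fun φ hφ => ?_, fun φ hφ hφ0 => ?_, fun k =>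
    (hq k).integral_energy hγ hcv (fun t ht K => hρlow.trans_le (hdensity k t ht K)) hτ'⟩
  · obtain ⟨ψ, hψ, hA⟩ := hφ.exists_testField
    simp only [HTC.densityError_eq (γ := γ) (cv := cv) hψ _ hτ]
    exact (hA (HTC.rhoEmb d)).tendsto_weakError hγ hcv hT (fun _ _ => rfl) hB hn hbs hτ'
  · obtain ⟨ψ, hψ, hA⟩ := hφ.exists_testField
    simp only [HTC.momentumError_eq hφ.contDiff hψ _ hτ]
    exact (hA (HTC.momEmb d)).tendsto_weakError hγ hcv hT (fun _ _ => rfl) hB hn hbs hτ'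
  · obtain ⟨ψ, hψ, hA⟩ := hφ.exists_testField
    -- The lower sequence is the negative part `min 0` of the error itself, which tends to zero by
    -- the one-sided estimate.
    refine ⟨_, (hA (HTC.entEmb d)).tendsto_min_weakError hγ hcv hT hφ0 hB hn hbs hτ', fun k => ?_⟩
    rw [HTC.entropyError_eq (γ := γ) (cv := cv) hψ _ hτ]
    exact min_le_right _ _
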